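/- **Theorem.** There is a randomized data structure in the word RAM model that takes as input positive integers $\lambda,\kappa,q$ and initializes a function $$\Gamma:\bigl(\{0,1\}^{\kappa}\bigr)^{2^{\lambda}}\to\bigl(\{0,1\}^{2\kappa+26}\bigr)^{48\cdot 2^{\lambda}},$$ such that, for every word length $w\ge 1$ that is large enough to address the space used, the following hold, with constants in the $O$-notation that do not depend on $\lambda,\kappa,q,w$. - The space usage is $O\bigl(\lceil 2^{(1+3/q)\kappa+2\lambda}\,q^{2}\kappa/w\rceil\bigr)$ words. - The evaluation time of $\Gamma$ is $O\bigl(2^{\lambda}q^{2}(\lambda+2^{\lambda}\kappa/w)\bigr)$. - With probability at least $1-2^{-2(\kappa-1)}$ the function $\Gamma$ is $2^{\kappa}$-unique. Here the machine has the usual unit-cost instructions on $w$-bit words (loads and stores, addition, subtraction, bitwise operations, shifts, comparisons and conditional jumps; no multiplication is needed) and, for initialization, an instruction that generates a uniformly random and independent integer in $\{0,\dots,r-1\}$ for a given $1\le r\le 2^{w}$. "Data structure" means one pair of programs, independent of $\lambda,\kappa,q,w$, one for initialization and one for evaluation. Keys and values of $\Gamma$ are stored with $w$ bits to the word. The space usage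 is the number of memory words, and the word length suffices to address the space used if the space bound, with its constant, is at most $2^{w}$. For $\Gamma:(\{0,1\}^n)^c\to(\{0,1\}^m)^d$ and a set $S$ of inputs put $\Gamma(S)=\{(i,\Gamma(x)_i): x\in S,\ 1\le i\le d\}$; then $\Gamma$ is *$k$-unique* if every nonempty set $S$ of at most $k$ inputs contains some $x$ with $\Gamma(\{x\})\setminus\Gamma(S\setminus\{x\})\ne\emptyset$. -/

import Mathlib

/-!
# Word RAM programs, bit strings in memory, and unique neighbours
-/

/-- Strings of length `m` over the alphabet of `n`-bit characters: the set `({0,1}^n)^m`. -/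
abbrev BitStrings (n m : ℕ) : Type := Fin m → Fin n → Bool

/-- The set of outputs `Γ(S) = {(i, Γ(x)_i) | x ∈ S}` of a set of inputs `S`. -/
def outputs {n c m d : ℕ} (Γ : BitStrings n c → BitStrings m d)
    (S : Finset (BitStrings n c)) : Finset (Fin d × (Fin m → Bool)) :=
  S.biUnion fun x => Finset.univ.image fun i => (i, Γ x i)

/-- `Γ` is `k`-unique: every nonempty set of at most `k` inputs contains an input with a
neighbour that it shares with no other input of the set. -/
def IsKUnique {n c m d : ℕ} (k : ℕ) (Γ : BitStrings n c → BitStrings m d) : Prop :=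
  ∀ S : Finset (BitStrings n c), S.Nonempty → S.card ≤ k →
    ∃ x ∈ S, 0 < (outputs Γ {x} \ outputs Γ (S \ {x})).card

namespace WordRAM

/-- The unit-cost binary operations on words: addition and subtraction modulo `2^w`, bitwise
operations, shifts, and comparisons.  There is neither multiplication nor division. -/
inductive Op
  | add | sub | and | or | xor | shl | shr | lt | eq

/-- The value of a binary operation; comparisons are on unsigned integers and give `0` or `1`. -/
def Op.eval {w : ℕ} : Op → BitVec w → BitVec w → BitVec w
  | .add, x, y => x + y
  | .sub, x, y => x - y
  | .and, x, y => x &&& y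
  | .or, x, y => x ||| y
  | .xor, x, y => x ^^^ y
  | .shl, x, y => x <<< y
  | .shr, x, y => x >>> y
  | .lt, x, y => if x.toNat < y.toNat then 1 else 0
  | .eq, x, y => if x = y then 1 else 0

/-- Word RAM programs.  Natural numbers name registers, except for the literal `c` of `const`.
A program does not depend on the word size and uses finitely many registers. -/
inductive Prog
  /-- do nothing -/
  | skip
  /-- `R[d] := c mod 2^w` -/
  | const (d c : ℕ)
  /-- `R[d] := R[a] o R[b]` -/
  | op (o : Op) (d a b : ℕ)
  /-- `R[d] := M[R[a]]` -/
  | load (d a : ℕ)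
  /-- `M[R[a]] := R[b]` -/
  | store (a b : ℕ)
  /-- `R[d] :=` a fresh uniformly random integer in `{0, …, R[a]}` -/
  | rand (d a : ℕ)
  /-- first `p`, then `q` -/
  | seq (p q : Prog)
  /-- if `R[r] ≠ 0` then `p` else `q` -/
  | ite (r : ℕ) (p q : Prog)
  /-- while `R[r] ≠ 0` do `p` -/
  | while (r : ℕ) (p : Prog)

/-- A state of the machine with word size `w`: registers, memory, and a clock that counts the
executed instructions (and cannot be read by the program). -/
structure State (w : ℕ) where
  regs : ℕ → BitVec w
  mem : ℕ → BitVec w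
  time : ℕ

namespace State

variable {w : ℕ}

/-- Advance the clock by one unit. -/
def tick (s : State w) : State w := { s with time := s.time + 1 }

/-- Write the word `v` into register `d`. -/
def setReg (s : State w) (d : ℕ) (v : BitVec w) : State w :=
  { s with regs := Function.update s.regs d v }

/-- Write the word `v` into the memory cell with address `a`. -/
def setMem (s : State w) (a : ℕ) (v : BitVec w) : State w :=
  { s with mem := Function.update s.mem a v }

/-- The initial state for the arguments `args`: they are in the first registers, and all other
registers and all memory cells are `0`. -/
def start (w : ℕ) (args : List ℕ) : State w where
  regs r := BitVec.ofNat w (args.getD r 0)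
  mem _ := 0
  time := 0

end State

/-- `Exec N p s μ`: started in the state `s` on a machine whose memory consists of the `N` cells
with addresses `0, …, N - 1`, the program `p` halts for all outcomes of its random choices without
ever addressing a cell outside of the memory, and its final state has the distribution `μ`.
Every instruction and every evaluation of a branching condition costs one unit of time. -/
inductive Exec {w : ℕ} (N : ℕ) : Prog → State w → PMF (State w) → Prop
  | skip (s : State w) : Exec N .skip s (PMF.pure s.tick)
  | const (s : State w) (d c : ℕ) :
      Exec N (.const d c) s (PMF.pure (s.tick.setReg d (BitVec.ofNat w c)))
  | op (s : State w) (o : Op) (d a b : ℕ) :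
      Exec N (.op o d a b) s (PMF.pure (s.tick.setReg d (o.eval (s.regs a) (s.regs b))))
  | load (s : State w) (d a : ℕ) (h : (s.regs a).toNat < N) :
      Exec N (.load d a) s (PMF.pure (s.tick.setReg d (s.mem (s.regs a).toNat)))
  | store (s : State w) (a b : ℕ) (h : (s.regs a).toNat < N) :
      Exec N (.store a b) s (PMF.pure (s.tick.setMem (s.regs a).toNat (s.regs b)))
  | rand (s : State w) (d a : ℕ) :
      Exec N (.rand d a) s
        ((PMF.uniformOfFintype (Fin ((s.regs a).toNat + 1))).map
          fun i => s.tick.setReg d (BitVec.ofNat w i))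
  | seq (s : State w) (p q : Prog) (μ : PMF (State w)) (ν : State w → PMF (State w))
      (hp : Exec N p s μ) (hq : ∀ t ∈ μ.support, Exec N q t (ν t)) :
      Exec N (.seq p q) s (μ.bind ν)
  | ite_true (s : State w) (r : ℕ) (p q : Prog) (μ : PMF (State w))
      (hr : s.regs r ≠ 0) (hp : Exec N p s.tick μ) : Exec N (.ite r p q) s μ
  | ite_false (s : State w) (r : ℕ) (p q : Prog) (μ : PMF (State w))
      (hr : s.regs r = 0) (hq : Exec N q s.tick μ) : Exec N (.ite r p q) s μ
  | while_true (s : State w) (r : ℕ) (p : Prog) (μ : PMF (State w)) (ν : State w → PMF (State w))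
      (hr : s.regs r ≠ 0) (hp : Exec N p s.tick μ)
      (hq : ∀ t ∈ μ.support, Exec N (.while r p) t (ν t)) :
      Exec N (.while r p) s (μ.bind ν)
  | while_false (s : State w) (r : ℕ) (p : Prog) (hr : s.regs r = 0) :
      Exec N (.while r p) s (PMF.pure s.tick)

/-- The memory `M` holds the string `x` from the address `B` on, as the bit string of length
`m * n` that is the concatenation of its characters, packed with `w` bits to the word. -/
def HoldsAt {w n m : ℕ} (M : ℕ → BitVec w) (B : ℕ) (x : BitStrings n m) : Prop :=
  ∀ (i : Fin m) (j : Fin n),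
    (M (B + (i.val * n + j.val) / w)).getLsbD ((i.val * n + j.val) % w) = x i j

/-- With the program `eval`, the words `M 0, …, M (B - 1)` represent the function `Γ` with
evaluation time `T`, on a machine with `N` memory cells: whenever the first `B` cells have these
contents, register `0` contains the address `B`, and the memory holds a key `x` from the address
`B` on (all else being arbitrary), the program halts after at most `T` time units, with `Γ x` in
memory from the address `B` on, and with the first `B` cells as before. -/
def Represents {w n c m d : ℕ} (eval : Prog) (N B : ℕ) (T : ℝ) (M : ℕ → BitVec w)
    (Γ : BitStrings n c → BitStrings m d) : Prop :=
  ∀ (x : BitStrings n c) (s : State w),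
    (∀ a < B, s.mem a = M a) → (s.regs 0).toNat = B → HoldsAt s.mem B x →
      ∃ s' : State w, Exec N eval s (PMF.pure s') ∧
        (∀ a < B, s'.mem a = M a) ∧ HoldsAt s'.mem B (Γ x) ∧
        (s'.time : ℝ) ≤ (s.time : ℝ) + T

end WordRAM

/-- `2^((1 + 3/q) κ + 2 lam) * q^2 * κ / w`, rounded up to an integral number of words. -/
noncomputable def spaceBound (lam κ q w : ℕ) : ℕ :=
  ⌈(2 : ℝ) ^ ((1 + 3 / (q : ℝ)) * (κ : ℝ) + 2 * (lam : ℝ)) * (q : ℝ) ^ 2 * (κ : ℝ) / (w : ℝ)⌉₊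

/-- `2^lam * q^2 * (lam + 2^lam * κ / w)`. -/
noncomputable def timeBound (lam κ q w : ℕ) : ℝ :=
  2 ^ lam * (q : ℝ) ^ 2 * ((lam : ℝ) + 2 ^ lam * (κ : ℝ) / (w : ℝ))

/-! The function is computed along a binary tree over the `2^lam` input characters. A node above
`2^n` characters carries an array of `64 * 2^n` components of two `(κ+13)`-bit characters each. The
array of a parent is the exclusive or, over the components `i` of its two children, of a random
function of the four characters that the children have there; for `n = 0` the first character of an
array is the input character itself. The root array, cut into `48 * 2^lam` blocks of `2κ+26` bits,
is the output.

One level. Suppose that on every set `S` of at most `2^κ` strings the components have at most `8 *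
2^n * |S|` collisions in total. Then some element shares at most a quarter of its components with
others. Applying this to the left halves of a set of pairs, and then to the right halves above one
left half, gives a pair and a component whose four characters occur for no other pair. Fresh table
entries for that component make the whole new array of the pair uniform given those of the other
pairs (`exists_unshared_quad`). Peel off such pairs one at a time: every collision with a remaining
pair has probability at most `2^-(κ+26)`, independently over the output components. Many collisions
on a set are witnessed by an ordered list of its elements together with sets of colliding
components, and a union bound over all such lists (`prob_coll_le`) gives the collision bound for the
next level. At the root, some element of each small set shares at most a quarter of its outputs,
which is uniqueness (`OutGood.isKUnique`).

Space. A table indexed by four characters would be far too large. Instead, `D = O(q)` auxiliary hash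
functions are used. A pair of hash values is looked up under `Q+1 = O(q)` indices; for `g ≤ Q`, the
index keeps `gβ+x` bits of the first value and `κ+β+1-gβ+x` bits of the second, in all `L =
κ+3β+513` bits, where `β` is at most `κ/q + 1` and `x = β+256`. In a set of at most `2^κ` pairs, `g`
is chosen according to the number of first coordinates; a typical fibre is then small enough for the
bits left to the second coordinate, so some pair has a private index for all but a small fraction of
the hash functions (`Spread.exists_unshared`). Private entries allow the lookup sums on the set to
be prescribed arbitrarily (`exists_table`), and this is all that a random function of the characters
is needed for. The hash functions on single characters are random; those on pairs and triples are
obtained by the same product construction, and the product of triples and characters serves the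
components. The losses multiply to `126 G < 128 G = D`.

Independence. All functions live in disjoint blocks of one table of random bits. A good event for
one stage depends only on lower blocks, and the freshness of higher blocks is used by translating
the table by a random pattern supported there (`prob_shift`, `prob_stage`).

Machine. Programs are verified with Hoare triples that carry a time bound. Arrays of level `n`
occupy only `len n` table entries, a quantity that essentially doubles from level to level, so all
levels together cost `2^lam * D * (Q+1) * (lam + 2R)` up to a constant, where `R` is the number of
entries in a table row. -/

namespace WordRAM

/-! ### Compiled expressions and Hoare triples with time bounds -/

/-- The values of the first registers and of the memory cells, as natural numbers. -/
@[ext]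
structure St where
  r : ℕ → ℕ
  m : ℕ → ℕ

namespace St

/-- Change the value of a register. -/
def set (σ : St) (d v : ℕ) : St := ⟨Function.update σ.r d v, σ.m⟩

/-- Change the value of a memory cell. -/
def put (σ : St) (a v : ℕ) : St := ⟨σ.r, Function.update σ.m a v⟩

@[simp] theorem set_r (σ : St) (d v r : ℕ) : (σ.set d v).r r = if r = d then v else σ.r r := by
  simp [set, Function.update_apply]

@[simp] theorem set_m (σ : St) (d v : ℕ) : (σ.set d v).m = σ.m := rfl

@[simp] theorem put_r (σ : St) (a v : ℕ) : (σ.put a v).r = σ.r := rfl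

theorem put_m (σ : St) (a v b : ℕ) : (σ.put a v).m b = if b = a then v else σ.m b := by
  simp [put, Function.update_apply]

end St

/-- The part of a state that programs built from expressions depend on: the registers from `64` on
are reserved for intermediate results. -/
def State.view {w : ℕ} (s : State w) : St :=
  ⟨fun r => if r < 64 then (s.regs r).toNat else 0, fun a => (s.mem a).toNat⟩

/-- The value of a binary operation on natural numbers. -/
def Op.evalNat (w : ℕ) : Op → ℕ → ℕ → ℕ
  | .add, a, b => a + b
  | .sub, a, b => a - b
  | .and, a, b => a &&& b
  | .or, a, b => a ||| b
  | .xor, a, b => a ^^^ b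
  | .shl, a, b => a * 2 ^ b % 2 ^ w
  | .shr, a, b => a / 2 ^ b
  | .lt, a, b => if a < b then 1 else 0
  | .eq, a, b => if a = b then 1 else 0

/-- Absence of overflow in a binary operation. -/
def Op.ok (w : ℕ) : Op → ℕ → ℕ → Prop
  | .add, a, b => a + b < 2 ^ w
  | .sub, a, b => b ≤ a
  | _, _, _ => True

/-- Expressions over registers and memory. -/
inductive Expr
  | lit (n : ℕ)
  | reg (r : ℕ)
  | bin (o : Op) (a b : Expr)
  | load (a : Expr)
  | ones

namespace Expr

/-- The value of an expression. -/
def val (w : ℕ) (σ : St) : Expr → ℕ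
  | lit n => n
  | reg r => σ.r r
  | bin o a b => o.evalNat w (a.val w σ) (b.val w σ)
  | load a => σ.m (a.val w σ)
  | ones => 2 ^ w - 1

/-- An expression can be evaluated without overflow and within the memory. -/
def ok (w N : ℕ) (σ : St) : Expr → Prop
  | lit n => n < 2 ^ w
  | reg r => r < 64
  | bin o a b => a.ok w N σ ∧ b.ok w N σ ∧ o.ok w (a.val w σ) (b.val w σ)
  | load a => a.ok w N σ ∧ a.val w σ < N
  | ones => True

/-- The evaluation time of an expression. -/
def cost : Expr → ℕ
  | lit _ => 1
  | reg _ => 1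
  | bin _ a b => a.cost + b.cost + 1
  | load a => a.cost + 1
  | ones => 3

/-- A program that evaluates an expression into the register `d`. -/
def compile (d : ℕ) : Expr → Prog
  | lit n => .const d n
  -- The machine has no move instruction; the bitwise or of a register with itself replaces it.
  | reg r => .op .or d r r
  | bin o a b => .seq (a.compile d) (.seq (b.compile (d + 1)) (.op o d d (d + 1)))
  | load a => .seq (a.compile d) (.load d d)
  | ones => .seq (.const d 0) (.seq (.const (d + 1) 1) (.op .sub d d (d + 1)))

end Expr

/-- Deterministic execution of a program. -/
def Run {w : ℕ} (N : ℕ) (p : Prog) (s s' : State w) : Prop := Exec N p s (PMF.pure s')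

section
variable {w N : ℕ}

theorem Exec.seq_pure {p q : Prog} {s t : State w} {μ : PMF (State w)} (hp : Run N p s t)
    (hq : Exec N q t μ) : Exec N (.seq p q) s μ := by
  have := Exec.seq s p q (PMF.pure t) (fun _ => μ) hp (by
    intro u hu
    obtain rfl : u = t := by simpa using hu
    exact hq)
  rwa [PMF.pure_bind] at this

theorem Run.seq {p q : Prog} {s t u : State w} (hp : Run N p s t) (hq : Run N q t u) :
    Run N (.seq p q) s u := Exec.seq_pure hp hq

theorem Exec.while_pure {r : ℕ} {p : Prog} {s t : State w} {μ : PMF (State w)}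
    (hr : s.regs r ≠ 0) (hp : Run N p s.tick t) (hq : Exec N (.while r p) t μ) :
    Exec N (.while r p) s μ := by
  have := Exec.while_true s r p (PMF.pure t) (fun _ => μ) hr hp (by
    intro u hu
    obtain rfl : u = t := by simpa using hu
    exact hq)
  rwa [PMF.pure_bind] at this

theorem evalNat_eq [NeZero w] (o : Op) (x y : BitVec w) (h : o.ok w x.toNat y.toNat) :
    (o.eval x y).toNat = o.evalNat w x.toNat y.toNat := by
  have h1 : (1 : BitVec w).toNat = 1 := by
    have : 1 < 2 ^ w := Nat.one_lt_two_pow (NeZero.ne w)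
    simp [Nat.mod_eq_of_lt this]
  cases o with
  | add => exact BitVec.toNat_add_of_lt h
  | sub =>
    simp only [Op.ok] at h
    simp only [Op.eval, Op.evalNat]
    exact BitVec.toNat_sub_of_le (by rwa [BitVec.le_def])
  | and => simp [Op.eval, Op.evalNat]
  | or => simp [Op.eval, Op.evalNat]
  | xor => simp [Op.eval, Op.evalNat]
  | shl => simp [Op.eval, Op.evalNat, Nat.shiftLeft_eq]
  | shr => simp [Op.eval, Op.evalNat, Nat.shiftRight_eq_div_pow]
  | lt =>
    simp only [Op.eval, Op.evalNat]
    split_ifs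
    · exact h1
    · rfl
  | eq =>
    simp only [Op.eval, Op.evalNat, ← BitVec.toNat_inj]
    split_ifs
    · exact h1
    · rfl

theorem view_congr {s t : State w} (h : ∀ r < 64, s.regs r = t.regs r) (hm : s.mem = t.mem) :
    s.view = t.view := by
  simp only [State.view, hm, St.mk.injEq, and_true]
  funext r
  split_ifs with hr
  · rw [h r hr]
  · rfl

/-- Registers from `d` on act as a stack. Since everything below `d` is preserved, the left operand
in `d` survives the evaluation of the right one into `d + 1`, and the view, which ignores registers
from `64` on, never changes. -/
theorem run_compile [NeZero w] (e : Expr) : ∀ (d : ℕ) (_ : 64 ≤ d) (s : State w)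
    (_ : e.ok w N s.view), ∃ s', Run N (e.compile d) s s' ∧ (s'.regs d).toNat = e.val w s.view ∧
      (∀ r < d, s'.regs r = s.regs r) ∧ s'.mem = s.mem ∧ s'.time = s.time + e.cost := by
  have hne : ∀ {d r : ℕ}, r < d → r ≠ d := fun h => h.ne
  induction e with
  | lit n =>
    intro d hd s h
    refine ⟨_, Exec.const s d n, ?_, ?_, rfl, rfl⟩
    · simpa [State.setReg, Expr.val] using Nat.mod_eq_of_lt h
    · intro r hr
      simp [State.setReg, State.tick, hne hr]
  | reg r =>
    intro d hd s h
    refine ⟨_, Exec.op s .or d r r, ?_, ?_, rfl, rfl⟩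
    · have h' : r < 64 := h
      simp [State.setReg, Expr.val, Op.eval, State.view, h']
    · intro r hr
      simp [State.setReg, State.tick, hne hr]
  | bin o a b iha ihb =>
    intro d hd s h
    obtain ⟨s1, h1, v1, f1, m1, t1⟩ := iha d hd s h.1
    have hv1 : s1.view = s.view := view_congr (fun r hr => f1 r (by omega)) m1
    obtain ⟨s2, h2, v2, f2, m2, t2⟩ := ihb (d + 1) (by omega) s1 (by rw [hv1]; exact h.2.1)
    refine ⟨_, h1.seq (h2.seq (Exec.op s2 o d d (d + 1))), ?_, ?_, ?_, ?_⟩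
    · have e1 : (s2.regs d).toNat = a.val w s.view := by rw [f2 d (by omega), v1]
      have e2 : (s2.regs (d + 1)).toNat = b.val w s.view := by rw [v2, hv1]
      have := evalNat_eq o (s2.regs d) (s2.regs (d + 1)) (by rw [e1, e2]; exact h.2.2)
      simpa [State.setReg, Expr.val, e1, e2] using this
    · intro r hr
      simp only [State.setReg, State.tick]
      rw [Function.update_of_ne (hne hr), f2 r (by omega), f1 r hr]
    · simp [State.setReg, State.tick, m1, m2]
    · simp only [State.setReg, State.tick, t1, t2, Expr.cost]
      ring
  | load a iha =>
    intro d hd s h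
    obtain ⟨s1, h1, v1, f1, m1, t1⟩ := iha d hd s h.1
    refine ⟨_, h1.seq (Exec.load s1 d d (by rw [v1]; exact h.2)), ?_, ?_, ?_, ?_⟩
    · simp [State.setReg, Expr.val, v1, m1, State.view]
    · intro r hr
      simp [State.setReg, State.tick, hne hr, f1 r hr]
    · simp [State.setReg, State.tick, m1]
    · simp only [State.setReg, State.tick, t1, Expr.cost]
      ring
  | ones =>
    intro d hd s h
    refine ⟨_, Run.seq (Exec.const s d 0) (Run.seq (Exec.const _ (d + 1) 1)
      (Exec.op _ .sub d d (d + 1))), ?_, ?_, rfl, rfl⟩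
    · have : 1 < 2 ^ w := Nat.one_lt_two_pow (NeZero.ne w)
      simp [State.setReg, State.tick, Expr.val, Op.eval, Nat.mod_eq_of_lt this]
    · intro r hr
      simp [State.setReg, State.tick, hne hr, hne (Nat.lt_succ_of_lt hr)]

/-- Started in a state with view `σ`, the program `p` halts within `T` steps in a state whose view
satisfies `Q`. -/
def Ht (w N : ℕ) (p : Prog) (σ : St) (T : ℕ) (Q : St → Prop) : Prop :=
  ∀ s : State w, s.view = σ → ∃ s', Run N p s s' ∧ Q s'.view ∧ s'.time ≤ s.time + T

/-- `R[d] := e` -/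
def assign (d : ℕ) (e : Expr) : Prog := .seq (e.compile 64) (.op .or d 64 64)

/-- `M[a] := e` -/
def write (a e : Expr) : Prog := .seq (a.compile 64) (.seq (e.compile 65) (.store 64 65))

theorem view_lt_r {s : State w} (r : ℕ) : s.view.r r < 2 ^ w := by
  simp only [State.view]
  split_ifs
  · exact BitVec.isLt _
  · positivity

theorem view_lt_m {s : State w} (a : ℕ) : s.view.m a < 2 ^ w := BitVec.isLt _

theorem Ht.mono {p : Prog} {σ : St} {T T' : ℕ} {Q Q' : St → Prop} (h : Ht w N p σ T Q)
    (hT : T ≤ T') (hQ : ∀ σ', Q σ' → Q' σ') : Ht w N p σ T' Q' := by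
  intro s hs
  obtain ⟨s', h1, h2, h3⟩ := h s hs
  exact ⟨s', h1, hQ _ h2, by omega⟩

theorem Ht.seq {p q : Prog} {σ : St} {T₁ T₂ : ℕ} {R Q : St → Prop} (hp : Ht w N p σ T₁ R)
    (hq : ∀ σ', R σ' → Ht w N q σ' T₂ Q) : Ht w N (.seq p q) σ (T₁ + T₂) Q := by
  intro s hs
  obtain ⟨s1, h1, h2, h3⟩ := hp s hs
  obtain ⟨s2, h4, h5, h6⟩ := hq _ h2 s1 rfl
  exact ⟨s2, h1.seq h4, h5, by omega⟩

theorem Ht.assign [NeZero w] {d : ℕ} {e : Expr} {σ : St} {Q : St → Prop} (hd : d < 64)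
    (h : e.ok w N σ) (hQ : Q (σ.set d (e.val w σ))) :
    Ht w N (WordRAM.assign d e) σ (e.cost + 1) Q := by
  rintro s rfl
  obtain ⟨s1, h1, v1, f1, m1, t1⟩ := run_compile e 64 le_rfl s h
  refine ⟨_, h1.seq (Exec.op s1 .or d 64 64), ?_, ?_⟩
  · convert hQ using 1
    ext r
    · by_cases hr : r = d
      · subst hr
        simp [State.view, State.setReg, State.tick, Op.eval, hd, v1]
      · by_cases hr' : r < 64
        · simp [State.view, State.setReg, State.tick, hr, hr', f1 r hr']
        · simp [State.view, hr, hr']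
    · simp [State.view, State.setReg, State.tick, m1]
  · simp only [State.setReg, State.tick, t1]
    omega

theorem Ht.write [NeZero w] {a e : Expr} {σ : St} {Q : St → Prop}
    (ha : a.ok w N σ) (h : e.ok w N σ) (hN : a.val w σ < N)
    (hQ : Q (σ.put (a.val w σ) (e.val w σ))) :
    Ht w N (WordRAM.write a e) σ (a.cost + e.cost + 1) Q := by
  rintro s rfl
  obtain ⟨s1, h1, v1, f1, m1, t1⟩ := run_compile a 64 le_rfl s ha
  have hv1 : s1.view = s.view := view_congr (fun r hr => f1 r (by omega)) m1
  obtain ⟨s2, h2, v2, f2, m2, t2⟩ := run_compile e 65 (by omega) s1 (by rw [hv1]; exact h)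
  have e1 : (s2.regs 64).toNat = a.val w s.view := by rw [f2 64 (by omega), v1]
  refine ⟨_, h1.seq (h2.seq (Exec.store s2 64 65 (by rw [e1]; exact hN))), ?_, ?_⟩
  · convert hQ using 1
    ext r
    · by_cases hr' : r < 64
      · simp [State.view, State.setMem, State.tick, hr', f2 r (by omega), f1 r hr']
      · simp [State.view, hr']
    · rw [hv1] at v2
      change (Function.update s2.mem _ _ r).toNat = _
      rw [St.put_m, e1, m2, m1, Function.update_apply]
      split_ifs
      · exact v2
      · rfl
  · simp only [State.setMem, State.tick, t1, t2]
    omega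

theorem Ht.assign_seq [NeZero w] {d : ℕ} {e : Expr} {σ : St} {T : ℕ} {q : Prog} {Q : St → Prop}
    (hd : d < 64) (h : e.ok w N σ) (hQ : Ht w N q (σ.set d (e.val w σ)) T Q) :
    Ht w N (.seq (WordRAM.assign d e) q) σ (e.cost + 1 + T) Q :=
  Ht.seq (R := fun σ' => σ' = σ.set d (e.val w σ)) (Ht.assign hd h rfl) (by rintro _ rfl; exact hQ)

theorem Ht.skip {σ : St} {Q : St → Prop} (h : Q σ) : Ht w N .skip σ 1 Q := by
  rintro s rfl
  exact ⟨_, Exec.skip s, h, le_rfl⟩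

/-- If `e ≠ 0` then `p` else `q`. -/
def cond (e : Expr) (p q : Prog) : Prog := .seq (assign 63 e) (.ite 63 p q)

theorem regs_eq_zero_iff {s : State w} {r : ℕ} (hr : r < 64) :
    s.regs r = 0 ↔ s.view.r r = 0 := by
  rw [← BitVec.toNat_inj]
  simp [State.view, hr]

theorem Ht.cond [NeZero w] {e : Expr} {p q : Prog} {σ : St} {T : ℕ} {Q : St → Prop}
    (h : e.ok w N σ) (hp : e.val w σ ≠ 0 → Ht w N p (σ.set 63 (e.val w σ)) T Q)
    (hq : e.val w σ = 0 → Ht w N q (σ.set 63 (e.val w σ)) T Q) :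
    Ht w N (WordRAM.cond e p q) σ (e.cost + 1 + (T + 1)) Q := by
  refine Ht.assign_seq (by norm_num) h ?_
  intro s hs
  have h63 : s.view.r 63 = e.val w σ := by rw [hs]; simp
  by_cases h0 : e.val w σ = 0
  · obtain ⟨s', h1, h2, h3⟩ := hq h0 s.tick hs
    refine ⟨s', Exec.ite_false _ _ _ _ _ ?_ h1, h2, ?_⟩
    · rw [regs_eq_zero_iff (by norm_num), h63, h0]
    · have : s.tick.time = s.time + 1 := rfl
      omega
  · obtain ⟨s', h1, h2, h3⟩ := hp h0 s.tick hs
    refine ⟨s', Exec.ite_true _ _ _ _ _ ?_ h1, h2, ?_⟩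
    · rw [Ne, regs_eq_zero_iff (by norm_num), h63]
      exact h0
    · have : s.tick.time = s.time + 1 := rfl
      omega

/-- While `e ≠ 0` do `p`. -/
def loop (e : Expr) (p : Prog) : Prog :=
  .seq (assign 63 e) (.while 63 (.seq p (assign 63 e)))

/-- Rule for a loop that makes exactly `n` rounds, with an invariant indexed by the number of
finished rounds. The guard lives in register `63`, so the invariant must tolerate any value there. A
round costs the body, a new evaluation of the guard and one branching. -/
theorem Ht.loop [NeZero w] {e : Expr} {p : Prog} {T : ℕ → ℕ} {n : ℕ} (I : ℕ → St → Prop)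
    (hok : ∀ k ≤ n, ∀ σ, I k σ → e.ok w N σ)
    (hval : ∀ k ≤ n, ∀ σ, I k σ → (e.val w σ ≠ 0 ↔ k < n))
    (h63 : ∀ k σ v, I k σ → I k (σ.set 63 v))
    (hp : ∀ k < n, ∀ σ, I k σ → Ht w N p σ (T k) (I (k + 1))) {σ : St} (h0 : I 0 σ) :
    Ht w N (WordRAM.loop e p) σ (∑ k ∈ Finset.range n, (T k + e.cost + 2) + e.cost + 2)
      (I n) := by
  -- Induction on the number `m = n - k` of remaining rounds, starting when the guard has already
  -- been evaluated.
  have key : ∀ m k, k + m = n → ∀ σ, I k σ → (σ.r 63 ≠ 0 ↔ k < n) →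
      Ht w N (.while 63 (.seq p (WordRAM.assign 63 e))) σ
        (∑ j ∈ Finset.range m, (T (k + j) + e.cost + 2) + 1) (I n) := by
    intro m
    induction m with
    | zero =>
      rintro k hk σ hI h s rfl
      obtain rfl : k = n := by omega
      refine ⟨_, Exec.while_false _ _ _ ?_, hI, ?_⟩
      · rw [regs_eq_zero_iff (by norm_num)]
        by_contra hh
        exact lt_irrefl _ (h.1 hh)
      · simp [State.tick]
    | succ m ih =>
      rintro k hk σ hI h s rfl
      have hk' : k < n := by omega
      have hb := Ht.seq (hp k hk' _ hI) (q := WordRAM.assign 63 e) (T₂ := e.cost + 1)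
        (Q := fun σ => I (k + 1) σ ∧ (σ.r 63 ≠ 0 ↔ k + 1 < n)) (by
          intro σ' hσ'
          refine Ht.assign (by norm_num) (hok _ hk' _ hσ') ⟨h63 _ _ _ hσ', ?_⟩
          simpa using hval _ hk' _ hσ')
      obtain ⟨s1, h1, h2, h3⟩ := hb s.tick rfl
      obtain ⟨s2, h4, h5, h6⟩ := ih (k + 1) (by omega) _ h2.1 h2.2 s1 rfl
      refine ⟨s2, Exec.while_pure ?_ h1 h4, h5, ?_⟩
      · rw [Ne, regs_eq_zero_iff (by norm_num)]
        exact h.2 hk'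
      · have : s.tick.time = s.time + 1 := rfl
        rw [Finset.sum_range_succ', add_zero]
        rw [Finset.sum_congr rfl fun j _ =>
          (by rw [add_assoc k, add_comm 1 j] :
            T (k + 1 + j) + e.cost + 2 = T (k + (j + 1)) + e.cost + 2)] at h6
        omega
  refine Ht.mono (Ht.assign_seq (by norm_num) (hok 0 (by omega) _ h0)
    (key n 0 (by omega) _ (h63 _ _ _ h0) (by simpa using hval 0 (by omega) _ h0))) ?_
    (fun _ h => h)
  simp only [zero_add]
  omega

/-- For `i` from `0` to `e - 1` do `p`. -/
def forLoop (i : ℕ) (e : Expr) (p : Prog) : Prog :=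
  .seq (assign i (.lit 0))
    (loop (.bin .lt (.reg i) e) (.seq p (assign i (.bin .add (.reg i) (.lit 1)))))

/-- Two states agree on the memory and on the registers below `i`. -/
def St.Agree (i : ℕ) (σ σ' : St) : Prop := (∀ r < i, σ'.r r = σ.r r) ∧ σ'.m = σ.m

/-- The invariant may speak only of the memory and of the registers below the counter. Hence the
counter update cannot disturb it, and nested loops with increasing counters compose. -/
theorem Ht.forLoop_sum [NeZero w] {i n : ℕ} {T : ℕ → ℕ} {e : Expr} {p : Prog} (I : ℕ → St → Prop)
    (hi : i < 63) (hn : n < 2 ^ w) (hI : ∀ k σ σ', σ.Agree i σ' → I k σ → I k σ')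
    (he : ∀ k ≤ n, ∀ σ, I k σ → e.ok w N σ ∧ e.val w σ = n)
    (hp : ∀ k < n, ∀ σ, I k σ → σ.r i = k → Ht w N p σ (T k) (fun σ' => I (k + 1) σ' ∧ σ'.r i = k))
    {σ : St} (h0 : I 0 σ) :
    Ht w N (WordRAM.forLoop i e p) σ
      (∑ k ∈ Finset.range n, (T k + e.cost + 8) + e.cost + 6) (I n) := by
  have hag : ∀ (d : ℕ), i ≤ d → ∀ (σ : St) (v : ℕ), σ.Agree i (σ.set d v) := by
    intro d hd σ v
    refine ⟨fun r hr => ?_, rfl⟩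
    rw [St.set_r, if_neg (by omega)]
  have hw : 1 < 2 ^ w := Nat.one_lt_two_pow (NeZero.ne w)
  have hl := Ht.loop (w := w) (N := N) (e := .bin .lt (.reg i) e)
    (p := .seq p (WordRAM.assign i (.bin .add (.reg i) (.lit 1)))) (T := fun k => T k + 4) (n := n) (σ := σ.set i 0)
    (fun k σ => I k σ ∧ σ.r i = k)
    (by
      intro k hk σ hσ
      exact ⟨(by change i < 64; omega), (he k hk σ hσ.1).1, trivial⟩)
    (by
      intro k hk σ hσ
      simp [Expr.val, Op.evalNat, (he k hk σ hσ.1).2, hσ.2])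
    (by
      intro k σ v hσ
      refine ⟨hI _ _ _ (hag 63 (by omega) σ v) hσ.1, ?_⟩
      rw [St.set_r, if_neg (by omega), hσ.2])
    (by
      intro k hk σ hσ
      refine Ht.mono (Ht.seq (hp k hk σ hσ.1 hσ.2) (T₂ := 4) ?_) le_rfl (fun _ h => h)
      intro σ' hσ'
      refine Ht.assign (by omega) ?_ ⟨hI _ _ _ (hag i le_rfl _ _) hσ'.1, ?_⟩
      · refine ⟨(by change i < 64; omega), hw, ?_⟩
        simp only [Op.ok, Expr.val, hσ'.2]
        omega
      · simp [Expr.val, Op.evalNat, hσ'.2])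
  refine Ht.mono (Ht.assign_seq (by omega) (by simp [Expr.ok])
    (hl ⟨hI _ _ _ (hag i le_rfl _ _) h0, by simp⟩)) ?_ (fun _ h => h.1)
  simp only [Expr.cost]
  rw [Finset.sum_congr rfl fun k _ =>
    (by ring : T k + 4 + (1 + e.cost + 1) + 2 = T k + e.cost + 8)]
  omega

theorem Ht.forLoop [NeZero w] {i n T : ℕ} {e : Expr} {p : Prog} (I : ℕ → St → Prop)
    (hi : i < 63) (hn : n < 2 ^ w) (hI : ∀ k σ σ', σ.Agree i σ' → I k σ → I k σ')
    (he : ∀ k ≤ n, ∀ σ, I k σ → e.ok w N σ ∧ e.val w σ = n)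
    (hp : ∀ k < n, ∀ σ, I k σ → σ.r i = k → Ht w N p σ T (fun σ' => I (k + 1) σ' ∧ σ'.r i = k))
    {σ : St} (h0 : I 0 σ) :
    Ht w N (WordRAM.forLoop i e p) σ (n * (T + e.cost + 8) + e.cost + 6) (I n) := by
  have := Ht.forLoop_sum (T := fun _ => T) I hi hn hI he hp h0
  simpa using this

end

end WordRAM

/-! ### Probabilities by counting -/

open scoped Classical in
/-- The probability of an event for a uniformly random element of a finite type. -/
noncomputable def prob {Ω : Type*} [Fintype Ω] (E : Ω → Prop) : ℝ :=
  (Finset.univ.filter E).card / Fintype.card Ω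

section prob
variable {Ω : Type*} [Fintype Ω]

theorem prob_eq (E : Ω → Prop) [DecidablePred E] :
    prob E = (Finset.univ.filter E).card / Fintype.card Ω := by
  unfold prob
  congr!

theorem prob_mono {E E' : Ω → Prop} (h : ∀ x, E x → E' x) : prob E ≤ prob E' := by
  classical
  rw [prob_eq, prob_eq]
  have : Finset.univ.filter E ⊆ Finset.univ.filter E' := fun x hx => by
    simp only [Finset.mem_filter, Finset.mem_univ, true_and] at hx ⊢
    exact h x hx
  have := Finset.card_le_card this
  apply div_le_div_of_nonneg_right _ (by positivity)
  exact_mod_cast this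

theorem prob_le_one (E : Ω → Prop) : prob E ≤ 1 := by
  classical
  rw [prob_eq]
  apply div_le_one_of_le₀ _ (by positivity)
  exact_mod_cast Finset.card_filter_le _ _

theorem prob_false : prob (fun _ : Ω => False) = 0 := by
  simp [prob]

theorem prob_or_le (E E' : Ω → Prop) : prob (fun x => E x ∨ E' x) ≤ prob E + prob E' := by
  classical
  rw [prob_eq, prob_eq, prob_eq, ← add_div]
  have : Finset.univ.filter (fun x => E x ∨ E' x) ⊆
      Finset.univ.filter E ∪ Finset.univ.filter E' := fun x hx => by
    simpa using hx
  gcongr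
  exact_mod_cast (Finset.card_le_card this).trans (Finset.card_union_le _ _)

theorem prob_exists_le {ι : Type*} (s : Finset ι) (E : ι → Ω → Prop) :
    prob (fun x => ∃ i ∈ s, E i x) ≤ ∑ i ∈ s, prob (E i) := by
  classical
  induction s using Finset.induction_on with
  | empty => simp [prob_false]
  | insert i s hi ih =>
    rw [Finset.sum_insert hi]
    refine (prob_mono (E' := fun x => E i x ∨ ∃ i ∈ s, E i x) ?_).trans
      ((prob_or_le _ _).trans (by gcongr))
    rintro x ⟨j, hj, hx⟩
    rcases Finset.mem_insert.1 hj with rfl | hj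
    · exact Or.inl hx
    · exact Or.inr ⟨j, hj, hx⟩

theorem prob_equiv {Ω' : Type*} [Fintype Ω'] (e : Ω ≃ Ω') (E : Ω' → Prop) :
    prob (fun x => E (e x)) = prob E := by
  classical
  unfold prob
  rw [Fintype.card_congr e]
  congr 2
  refine Finset.card_bij (fun x _ => e x) ?_ ?_ ?_
  · intro x hx
    simpa using hx
  · intro x _ y _ h
    exact e.injective h
  · intro y hy
    exact ⟨e.symm y, by simpa using hy, by simp⟩

/-- A substitute for conditioning. A uniform `x` and `x + φ m` with an independent uniform `m` have
the same distribution. The event `E'` is decided by `x` alone, and given `x` the randomness of `m`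
makes `E` unlikely. -/
theorem prob_shift [AddCommGroup Ω] {M : Type*} [Fintype M] [Nonempty M] (φ : M → Ω)
    {E E' : Ω → Prop} {r : ℝ} (hE : ∀ x m, E (x + φ m) → E' x)
    (h : ∀ x, E' x → prob (fun m => E (x + φ m)) ≤ r) : prob E ≤ r * prob E' := by
  classical
  have hM : (0 : ℝ) < Fintype.card M := by exact_mod_cast Fintype.card_pos
  have hΩ : (0 : ℝ) < Fintype.card Ω := by exact_mod_cast Fintype.card_pos
  -- Double counting of the pairs `(x, m)` with `E (x + φ m)`; for each fixed `m`, translation is a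
  -- bijection.
  have key : ∑ m : M, ((Finset.univ.filter E).card : ℝ) ≤
      r * Fintype.card M * (Finset.univ.filter E').card := by
    calc ∑ m : M, ((Finset.univ.filter E).card : ℝ)
        = ∑ m : M, ((Finset.univ.filter fun x => E (x + φ m)).card : ℝ) := by
          refine Finset.sum_congr rfl fun m _ => ?_
          norm_cast
          symm
          refine Finset.card_bij (fun x _ => x + φ m) ?_ ?_ ?_
          · intro x hx
            simpa using hx
          · intro x _ y _ h
            exact add_right_cancel h
          · intro y hy
            exact ⟨y - φ m, by simpa using hy, by simp⟩
      _ = ∑ x : Ω, ((Finset.univ.filter fun m => E (x + φ m)).card : ℝ) := by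
          simp only [Finset.card_filter, Nat.cast_sum]
          rw [Finset.sum_comm]
      _ = ∑ x ∈ Finset.univ.filter E', ((Finset.univ.filter fun m => E (x + φ m)).card : ℝ) := by
          symm
          apply Finset.sum_subset (Finset.subset_univ _)
          intro x _ hx
          simp only [Nat.cast_eq_zero, Finset.card_eq_zero, Finset.filter_eq_empty_iff]
          intro m _ hm
          exact hx (by simpa using hE x m hm)
      _ ≤ ∑ x ∈ Finset.univ.filter E', r * Fintype.card M := by
          refine Finset.sum_le_sum fun x hx => ?_
          have := h x (by simpa using hx)
          unfold prob at this
          rwa [div_le_iff₀ hM] at this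
      _ = _ := by
          rw [Finset.sum_const, nsmul_eq_mul, mul_comm]
  rw [Finset.sum_const, nsmul_eq_mul, Finset.card_univ] at key
  unfold prob
  rw [div_le_iff₀ hΩ, mul_assoc, div_mul_cancel₀ _ hΩ.ne']
  nlinarith

end prob

/-! ### Collisions and shared values -/

section coll
variable {U W C : Type*}

open scoped Classical in
/-- The number of collisions of a function on a set. -/
noncomputable def coll (f : U → W) (S : Finset U) : ℕ := S.card - (S.image f).card

/-- The value of the function at `z` is taken at another element of the set. -/
def Shared (f : U → W) (S : Finset U) (z : U) : Prop := ∃ z' ∈ S, z' ≠ z ∧ f z' = f z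

theorem coll_add_card (f : U → W) (S : Finset U) [DecidableEq W] :
    coll f S + (S.image f).card = S.card := by
  unfold coll
  convert Nat.sub_add_cancel (Finset.card_image_le (s := S) (f := f))

open scoped Classical in
theorem coll_insert (f : U → W) (S : Finset U) (z : U) (hz : z ∉ S) :
    coll f (insert z S) = coll f S + if ∃ z' ∈ S, f z = f z' then 1 else 0 := by
  have h1 := coll_add_card f S
  have h2 := coll_add_card f (insert z S)
  rw [Finset.card_insert_of_notMem hz, Finset.image_insert] at h2
  split_ifs with h
  · have : f z ∈ S.image f := by
      obtain ⟨z', hz', e⟩ := h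
      exact e ▸ Finset.mem_image_of_mem _ hz'
    rw [Finset.insert_eq_of_mem this] at h2
    omega
  · rw [Finset.card_insert_of_notMem] at h2
    · omega
    · intro hh
      obtain ⟨z', hz', e⟩ := Finset.mem_image.1 hh
      exact h ⟨z', hz', e.symm⟩

open scoped Classical in
-- A new element whose value is already taken adds one collision and at most two shared elements:
-- itself, and the one that had been alone with this value.
theorem card_shared_le (f : U → W) (S : Finset U) :
    (S.filter (Shared f S)).card ≤ 2 * coll f S := by
  induction S using Finset.induction_on with
  | empty => simp
  | insert z S hz ih =>
    rw [coll_insert f S z hz]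
    split_ifs with h
    · obtain ⟨z₀, hz₀, e⟩ := h
      have hsub : (insert z S).filter (Shared f (insert z S)) ⊆
          S.filter (Shared f S) ∪ ({z} ∪ S.filter fun a => f a = f z ∧ ¬ Shared f S a) := by
        intro a ha
        obtain ⟨ha1, b, hb, hne, hfe⟩ := Finset.mem_filter.1 ha
        simp only [Finset.mem_union, Finset.mem_filter, Finset.mem_singleton]
        rcases Finset.mem_insert.1 ha1 with ha1 | ha1
        · tauto
        · by_cases hs : Shared f S a
          · tauto
          · refine Or.inr (Or.inr ⟨ha1, ?_, hs⟩)
            rcases Finset.mem_insert.1 hb with hb | hb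
            · rw [← hfe, hb]
            · exact absurd ⟨b, hb, hne, hfe⟩ hs
      have h1 : (S.filter fun a => f a = f z ∧ ¬ Shared f S a).card ≤ 1 := by
        rw [Finset.card_le_one]
        intro a ha b hb
        simp only [Finset.mem_filter] at ha hb
        by_contra hne
        exact ha.2.2 ⟨b, hb.1, Ne.symm hne, by rw [hb.2.1, ha.2.1]⟩
      have := Finset.card_le_card hsub
      have := Finset.card_union_le (S.filter (Shared f S))
        ({z} ∪ S.filter fun a => f a = f z ∧ ¬ Shared f S a)
      have := Finset.card_union_le {z} (S.filter fun a => f a = f z ∧ ¬ Shared f S a)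
      have : ({z} : Finset U).card = 1 := rfl
      omega
    · have hsub : (insert z S).filter (Shared f (insert z S)) ⊆ S.filter (Shared f S) := by
        intro a ha
        obtain ⟨ha1, b, hb, hne, hfe⟩ := Finset.mem_filter.1 ha
        rcases Finset.mem_insert.1 ha1 with rfl | ha1
        · rcases Finset.mem_insert.1 hb with rfl | hb
          · exact absurd rfl hne
          · exact absurd ⟨b, hb, hfe.symm⟩ h
        · rcases Finset.mem_insert.1 hb with rfl | hb'
          · exact absurd ⟨a, ‹a ∈ S›, hfe⟩ h
          · exact Finset.mem_filter.2 ⟨‹a ∈ S›, b, hb', hne, hfe⟩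
      have := Finset.card_le_card hsub
      omega

open scoped Classical in
theorem sum_shared_le [Fintype C] (y : U → C → W) (S : Finset U) :
    ∑ z ∈ S, (Finset.univ.filter fun c => Shared (fun z => y z c) S z).card ≤
      2 * ∑ c, coll (fun z => y z c) S := by
  rw [Finset.mul_sum]
  simp only [Finset.card_filter]
  rw [Finset.sum_comm]
  refine Finset.sum_le_sum fun c _ => ?_
  rw [← Finset.card_filter]
  exact card_shared_le _ _

open scoped Classical in
-- Averaging: by `sum_shared_le`, the elements share at most `2 * δ` components on average.
theorem exists_shared_le [Fintype C] (y : U → C → W) (S : Finset U) (hS : S.Nonempty) {δ : ℕ}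
    (h : ∑ c, coll (fun z => y z c) S ≤ δ * S.card) :
    ∃ z ∈ S, (Finset.univ.filter fun c => Shared (fun z => y z c) S z).card ≤ 2 * δ := by
  apply Finset.exists_le_of_sum_le hS
  rw [Finset.sum_const, smul_eq_mul]
  refine (sum_shared_le y S).trans ?_
  nlinarith

end coll

/-! ### Tabulation hashing and the union bound over peeling orders -/

section hash
variable {U C Key V : Type*} [AddCommGroup V]

/-- The sum of the table entries of the keys of `z`. -/
def tabHash (K : U → C → Finset Key) (T : C → Key → V) (z : U) (c : C) : V := ∑ k ∈ K z c, T c k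

/-- The table entries can be changed so that the hash value of `z` changes arbitrarily, while
those of the elements of `S` do not change. -/
def Free (V : Type*) [AddCommGroup V] (K : U → C → Finset Key) (c : C) (z : U) (S : Set U) :
    Prop :=
  ∀ u : V, ∃ m : Key → V, ∑ k ∈ K z c, m k = u ∧ ∀ z' ∈ S, ∑ k ∈ K z' c, m k = 0

/-- Each element collides with a later one in the chosen components. -/
def HitAll (y : U → C → V) : List (U × Finset C) → Prop
  | [] => True
  | (z, H) :: l => (∀ c ∈ H, ∃ p ∈ l, y z c = y p.1 c) ∧ HitAll y l

/-- Each element is free relative to the later ones in the chosen components. -/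
def FreeAll (V : Type*) [AddCommGroup V] (K : U → C → Finset Key) : List (U × Finset C) → Prop
  | [] => True
  | (z, H) :: l => (∀ c ∈ H, Free V K c z {z' | ∃ p ∈ l, p.1 = z'}) ∧ FreeAll V K l

omit [AddCommGroup V] in
theorem HitAll.congr {y y' : U → C → V} : ∀ {l : List (U × Finset C)},
    (∀ p ∈ l, ∀ c, y p.1 c = y' p.1 c) → HitAll y l → HitAll y' l
  | [], _, _ => trivial
  | (z, H) :: l, h, hy => by
    refine ⟨fun c hc => ?_, HitAll.congr (fun p hp => h p (by simp [hp])) hy.2⟩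
    obtain ⟨p, hp, e⟩ := hy.1 c hc
    exact ⟨p, hp, by
      rw [← h p (List.mem_cons_of_mem _ hp), ← e, ← h _ List.mem_cons_self]⟩

theorem tabHash_add (K : U → C → Finset Key) (T T' : C → Key → V) (z : U) (c : C) :
    tabHash K (T + T') z c = tabHash K T z c + tabHash K T' z c := by
  simp [tabHash, Finset.sum_add_distrib]

/-- If every small set contains an element with a key of its own, then the hash values on a small
set can be prescribed. -/
theorem exists_table (K : U → Finset Key) {n₀ : ℕ}
    (hK : ∀ S : Finset U, S.Nonempty → S.card ≤ n₀ → ∃ z ∈ S, ∃ k ∈ K z, ∀ z' ∈ S, z' ≠ z →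
      k ∉ K z') (τ : U → V) : ∀ S : Finset U, S.card ≤ n₀ →
    ∃ m : Key → V, ∀ z ∈ S, ∑ k ∈ K z, m k = τ z := by
  classical
  intro S
  induction hn : S.card generalizing S with
  | zero =>
    intro _
    rw [Finset.card_eq_zero] at hn
    subst hn
    exact ⟨0, by simp⟩
  | succ n ih =>
    intro hS
    obtain ⟨z, hz, k, hk, huniq⟩ := hK S (Finset.card_pos.1 (by omega)) (by omega)
    obtain ⟨m, hm⟩ := ih (S.erase z) (by rw [Finset.card_erase_of_mem hz, hn]; rfl) (by omega)
    -- After the values on the rest of the set are settled, the entry at the private key `k` of `z`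
    -- is corrected; no other element sees it.
    refine ⟨m + Pi.single k (τ z - ∑ k ∈ K z, m k), fun z' hz' => ?_⟩
    simp only [Pi.add_apply, Finset.sum_add_distrib]
    by_cases h : z' = z
    · subst h
      rw [Finset.sum_pi_single' k]
      simp [hk]
    · rw [hm z' (Finset.mem_erase.2 ⟨h, hz'⟩), Finset.sum_pi_single' k]
      simp [huniq z' hz' h]

variable [Fintype C] [Fintype Key] [Fintype V] [DecidableEq V] [DecidableEq C] [DecidableEq Key]

/-- The first element is free relative to the later ones, so its hash values in the components of
`H` can be shifted by an independent uniform vector without moving the later elements. In each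
component at most `n` of the shifts produce a collision. The later elements are handled by
recursion. -/
theorem prob_hitAll_le (K : U → C → Finset Key) (n : ℕ) : ∀ l : List (U × Finset C),
    FreeAll V K l → l.length ≤ n →
    prob (fun T : C → Key → V => HitAll (tabHash K T) l) ≤
      ((n : ℝ) / Fintype.card V) ^ (l.map fun p => p.2.card).sum
  | [], _, _ => by simpa using prob_le_one _
  | (z, H) :: l, hF, hl => by
    have ih := prob_hitAll_le K n l hF.2 (by simp at hl; omega)
    choose m hm1 hm2 using hF.1
    have hr : (0 : ℝ) ≤ (n : ℝ) / Fintype.card V := by positivity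
    -- The change of the table that realizes a vector `u` of shifts of the hash values of the first
    -- element.
    let φ : ((c : H) → V) → C → Key → V := fun u c k =>
      if h : c ∈ H then m c h (u ⟨c, h⟩) k else 0
    have hφ : ∀ u p, p ∈ l → ∀ c, tabHash K (φ u) p.1 c = 0 := by
      intro u p hp c
      simp only [tabHash, φ]
      split_ifs with h
      · exact hm2 c h _ p.1 ⟨p, hp, rfl⟩
      · simp
    have hφ' : ∀ u (c : H), tabHash K (φ u) z c = u c := by
      intro u c
      simp only [tabHash, φ, c.2, dif_pos]
      exact hm1 c c.2 _
    have hstep := prob_shift φ (E := fun T => HitAll (tabHash K T) ((z, H) :: l))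
      (E' := fun T => HitAll (tabHash K T) l) (r := ((n : ℝ) / Fintype.card V) ^ H.card)
      (by
        intro T u h
        refine HitAll.congr ?_ h.2
        intro p hp c
        rw [tabHash_add, hφ u p hp, add_zero])
      (by
        intro T hT
        -- The shifts in component `c` that move the value of `z` onto that of a later element.
        let A : (c : H) → Finset V := fun c =>
          (l.map fun p => tabHash K T p.1 c - tabHash K T z c).toFinset
        have hA : ∀ c, (A c).card ≤ n := fun c =>
          (List.toFinset_card_le _).trans (by simp at hl ⊢; omega)
        have hsub : ∀ u : (c : H) → V, HitAll (tabHash K (T + φ u)) ((z, H) :: l) →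
            u ∈ Fintype.piFinset A := by
          intro u hu
          rw [Fintype.mem_piFinset]
          intro c
          obtain ⟨p, hp, e⟩ := hu.1 c c.2
          rw [tabHash_add, tabHash_add, hφ u p hp, add_zero, hφ' u c] at e
          simp only [A, List.mem_toFinset, List.mem_map]
          exact ⟨p, hp, by rw [← e]; abel⟩
        refine (prob_mono hsub).trans ?_
        have hfil : (Finset.univ.filter fun u => u ∈ Fintype.piFinset A) = Fintype.piFinset A := by
          ext
          simp
        rw [prob_eq (fun u => u ∈ Fintype.piFinset A)]
        rw [hfil, Fintype.card_piFinset, Fintype.card_pi, Finset.prod_const,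
          Finset.card_univ, Fintype.card_coe, div_pow]
        push_cast
        gcongr
        refine (Finset.prod_le_prod (g := fun _ => (n : ℝ)) (fun _ _ => by positivity) ?_).trans ?_
        · intro c _
          exact_mod_cast hA c
        · simp)
    refine hstep.trans ?_
    rw [List.map_cons, List.sum_cons, pow_add]
    gcongr

omit [Fintype Key] [Fintype V] [DecidableEq Key] in
open scoped Classical in
-- The certificate for many collisions: remove an element that is not free in at most `F`
-- components, and continue with the rest. Each removal accounts for the components in which the
-- element collides with what remains; apart from at most `F` of them, they are recorded in its set
-- `H`.
theorem exists_hit_list (K : U → C → Finset Key) {n₀ F : ℕ}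
    (hK : ∀ S : Finset U, S.Nonempty → S.card ≤ n₀ → ∃ z ∈ S,
      (Finset.univ.filter fun c => ¬ Free V K c z (S.erase z)).card ≤ F) (y : U → C → V) :
    ∀ S : Finset U, S.card ≤ n₀ → ∃ l : List (U × Finset C), l.length = S.card ∧
      (∀ z, (∃ p ∈ l, p.1 = z) ↔ z ∈ S) ∧ FreeAll V K l ∧ HitAll y l ∧
      ∑ c, coll (fun z => y z c) S ≤ F * S.card + (l.map fun p => p.2.card).sum := by
  intro S
  induction hn : S.card generalizing S with
  | zero =>
    intro _
    rw [Finset.card_eq_zero] at hn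
    subst hn
    exact ⟨[], rfl, by simp, trivial, trivial, by simp [coll]⟩
  | succ n ih =>
    intro hS
    obtain ⟨z, hz, hF⟩ := hK S (Finset.card_pos.1 (by omega)) (by omega)
    have hcard : (S.erase z).card = n := by rw [Finset.card_erase_of_mem hz, hn]; rfl
    obtain ⟨l, h1, h2, h3, h4, h5⟩ := ih (S.erase z) hcard (by omega)
    have hset : {z' | ∃ p ∈ l, p.1 = z'} = ((S.erase z : Finset U) : Set U) := by
      ext z'
      exact h2 z'
    let H : Finset C := Finset.univ.filter fun c =>
      Free V K c z (S.erase z) ∧ ∃ z' ∈ S.erase z, y z c = y z' c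
    refine ⟨(z, H) :: l, by simp [h1], ?_, ⟨?_, h3⟩, ⟨?_, h4⟩, ?_⟩
    · intro z'
      rw [← Finset.insert_erase hz, Finset.mem_insert, ← h2]
      simp [eq_comm]
    · intro c hc
      rw [hset]
      exact (Finset.mem_filter.1 hc).2.1
    · intro c hc
      obtain ⟨z', hz', e⟩ := (Finset.mem_filter.1 hc).2.2
      obtain ⟨p, hp, rfl⟩ := (h2 z').2 hz'
      exact ⟨p, hp, e⟩
    · have hc : ∀ c, coll (fun z => y z c) S = coll (fun z => y z c) (S.erase z) +
          if ∃ z' ∈ S.erase z, y z c = y z' c then 1 else 0 := by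
        intro c
        have := coll_insert (fun z => y z c) (S.erase z) z (Finset.notMem_erase z S)
        rw [Finset.insert_erase hz] at this
        convert this
      simp only [hc]
      rw [Finset.sum_add_distrib, ← Finset.card_filter, List.map_cons, List.sum_cons]
      have hle : (Finset.univ.filter fun c => ∃ z' ∈ S.erase z, y z c = y z' c).card ≤
          F + H.card := by
        refine le_trans (le_trans (Finset.card_le_card ?_) (Finset.card_union_le
          (Finset.univ.filter fun c => ¬ Free V K c z (S.erase z)) H)) (by omega)
        intro c hc
        have := (Finset.mem_filter.1 hc).2
        by_cases hf : Free V K c z (S.erase z)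
        · exact Finset.mem_union_right _ (Finset.mem_filter.2 ⟨Finset.mem_univ _, hf, this⟩)
        · exact Finset.mem_union_left _ (Finset.mem_filter.2 ⟨Finset.mem_univ _, hf⟩)
      have : F * (n + 1) = F * n + F := by ring
      simp only
      omega

open scoped Classical in
-- Union bound over the certificates. There are `(|U| * 2^|C|)^n` lists of length `n`, and when the
-- collisions exceed `(F + G) * n` the recorded sets have total size at least `G * n`. So length `n`
-- contributes at most `η^n`, and these terms form a geometric series.
theorem prob_coll_le [Fintype U] (K : U → C → Finset Key) {n₀ F G : ℕ}
    (hK : ∀ S : Finset U, S.Nonempty → S.card ≤ n₀ → ∃ z ∈ S,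
      (Finset.univ.filter fun c => ¬ Free V K c z (S.erase z)).card ≤ F)
    (hV : n₀ ≤ Fintype.card V) {η : ℝ} (hη : η ≤ 1 / 2)
    (hle : (Fintype.card U : ℝ) * 2 ^ Fintype.card C * ((n₀ : ℝ) / Fintype.card V) ^ G ≤ η) :
    prob (fun T : C → Key → V => ∃ S : Finset U, S.card ≤ n₀ ∧
      (F + G) * S.card < ∑ c, coll (fun z => tabHash K T z c) S) ≤ 2 * η := by
  have hVpos : (0 : ℝ) < Fintype.card V := by exact_mod_cast Fintype.card_pos
  set r : ℝ := (n₀ : ℝ) / Fintype.card V with hr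
  have hr0 : 0 ≤ r := by positivity
  have hr1 : r ≤ 1 := by
    rw [hr, div_le_one hVpos]
    exact_mod_cast hV
  set η' : ℝ := (Fintype.card U : ℝ) * 2 ^ Fintype.card C * r ^ G with hη'
  have h0 : 0 ≤ η' := by positivity
  have hbad : ∀ T : C → Key → V, (∃ S : Finset U, S.card ≤ n₀ ∧
      (F + G) * S.card < ∑ c, coll (fun z => tabHash K T z c) S) →
      ∃ n ∈ Finset.Icc 1 n₀, ∃ l ∈ (Finset.univ : Finset (List.Vector (U × Finset C) n)),
        (FreeAll V K l.1 ∧ G * n ≤ (l.1.map fun p => p.2.card).sum) ∧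
          HitAll (tabHash K T) l.1 := by
    rintro T ⟨S, hS, hlt⟩
    obtain ⟨l, h1, _, h3, h4, h5⟩ := exists_hit_list K hK (tabHash K T) S hS
    refine ⟨S.card, ?_, ⟨l, h1⟩, Finset.mem_univ _, ⟨h3, ?_⟩, h4⟩
    · rw [Finset.mem_Icc]
      refine ⟨?_, hS⟩
      by_contra hc
      have : S = ∅ := by
        rw [← Finset.card_eq_zero]
        omega
      subst this
      simp [coll] at hlt
    · have : (F + G) * S.card = F * S.card + G * S.card := by ring
      change G * S.card ≤ (l.map fun p => p.2.card).sum
      omega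
  refine (prob_mono hbad).trans ((prob_exists_le _ _).trans ?_)
  have hn : ∀ n ∈ Finset.Icc 1 n₀, prob (fun T : C → Key → V =>
      ∃ l ∈ (Finset.univ : Finset (List.Vector (U × Finset C) n)),
        (FreeAll V K l.1 ∧ G * n ≤ (l.1.map fun p => p.2.card).sum) ∧
          HitAll (tabHash K T) l.1) ≤ η' ^ n := by
    intro n hn
    refine (prob_exists_le _ _).trans ?_
    have : ∀ l ∈ (Finset.univ : Finset (List.Vector (U × Finset C) n)),
        prob (fun T : C → Key → V => (FreeAll V K l.1 ∧
          G * n ≤ (l.1.map fun p => p.2.card).sum) ∧ HitAll (tabHash K T) l.1) ≤ r ^ (G * n) := by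
      intro l _
      by_cases hl : FreeAll V K l.1 ∧ G * n ≤ (l.1.map fun p => p.2.card).sum
      · refine (prob_mono fun T hT => hT.2).trans ((prob_hitAll_le K n₀ l.1 hl.1 ?_).trans ?_)
        · rw [l.2]
          exact (Finset.mem_Icc.1 hn).2
        · exact pow_le_pow_of_le_one hr0 hr1 hl.2
      · simp only [hl, false_and, prob_false]
        positivity
    refine (Finset.sum_le_sum this).trans (le_of_eq ?_)
    rw [Finset.sum_const, nsmul_eq_mul, Finset.card_univ, card_vector, Fintype.card_prod,
      Fintype.card_finset, hη', mul_pow, pow_mul]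
    push_cast
    ring
  refine (Finset.sum_le_sum hn).trans ?_
  have hη1 : η' ≤ 1 / 2 := hle.trans hη
  -- The subtracted term makes the induction go through, because `η' ≤ 1/2`.
  have hgeo : ∀ m : ℕ, ∑ n ∈ Finset.Icc 1 m, η' ^ n ≤ 2 * η' - 2 * η' ^ (m + 1) := by
    intro m
    induction m with
    | zero => simp
    | succ m ih =>
      rw [Finset.sum_Icc_succ_top (by omega)]
      have : η' ^ (m + 1 + 1) ≤ η' ^ (m + 1) / 2 := by
        rw [pow_succ]
        have : 0 ≤ η' ^ (m + 1) := by positivity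
        nlinarith
      have : 0 ≤ η' ^ (m + 1 + 1) := by positivity
      have h2 : η' ^ (m + 1 + 1) + η' ^ (m + 1 + 1) ≤ η' ^ (m + 1) := by linarith
      linarith
  have := hgeo n₀
  have : 0 ≤ η' ^ (n₀ + 1) := by positivity
  linarith

end hash

/-! ### Products of functions with few collisions -/

section product
variable {X Y C : Type*} [Fintype C]

/-- The function `f` has few collisions on each set of at most `2^a` elements even if its values
are truncated to `a + x` bits. -/
def Spread (κ x top δ : ℕ) (f : X → C → ℕ) : Prop :=
  ∀ a ≤ top, ∀ A : Finset X, A.card ≤ 2 ^ a → A.card ≤ 2 ^ κ →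
    ∑ c, coll (fun z => f z c % 2 ^ (a + x)) A ≤ δ * A.card

open scoped Classical in
-- The number of first coordinates determines how many bits must be spent on them; the bits that
-- remain suffice for the fibre above a typical first coordinate. Rounding the split to multiples of
-- `β` leaves only `Q + 1` possibilities and wastes at most `β` bits.
theorem Spread.exists_unshared {κ x β Q δ₁ δ₂ : ℕ} {f : X → C → ℕ} {h : Y → C → ℕ}
    (hf : Spread κ x (κ + β + 1) δ₁ f) (hh : Spread κ x (κ + β + 1) δ₂ h) (hδ : 0 < δ₁)
    (hQ : κ ≤ Q * β) (hQ' : Q * β < κ + β) (S : Finset (X × Y)) (hS : S.Nonempty)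
    (hcard : S.card ≤ 2 ^ κ) :
    ∃ z ∈ S, ∃ g ≤ Q, (Finset.univ.filter fun c => Shared (fun z : X × Y =>
      (f z.1 c % 2 ^ (g * β + x), h z.2 c % 2 ^ (κ + β + 1 - g * β + x))) S z).card ≤
        4 * δ₁ + 2 * δ₂ := by
  set A := S.image Prod.fst with hA
  have hA0 : A.Nonempty := hS.image _
  have hAS : A.card ≤ S.card := Finset.card_image_le
  have hex : ∃ g, A.card ≤ 2 ^ (g * β) :=
    ⟨Q, hAS.trans (hcard.trans (Nat.pow_le_pow_right (by norm_num) hQ))⟩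
  -- The least number of blocks of `β` bits that can count the first coordinates.
  set g := Nat.find hex with hg
  have hgQ : g ≤ Q :=
    Nat.find_min' hex (hAS.trans (hcard.trans (Nat.pow_le_pow_right (by norm_num) hQ)))
  have hgβ : g * β ≤ Q * β := Nat.mul_le_mul_right _ hgQ
  let bad : X → ℕ := fun a =>
    (Finset.univ.filter fun c => Shared (fun z => f z c % 2 ^ (g * β + x)) A a).card
  let fib : X → Finset Y := fun a => (S.filter fun z => z.1 = a).image Prod.snd
  have hfib : ∀ a, (fib a).card = (S.filter fun z => z.1 = a).card := by
    intro a
    apply Finset.card_image_of_injOn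
    rintro ⟨a1, b1⟩ h1 ⟨a2, b2⟩ h2 e
    simp only [Finset.coe_filter, Set.mem_ofPred_eq] at h1 h2
    ext
    · simp [h1.2, h2.2]
    · exact e
  have hsum1 : ∑ a ∈ A, bad a ≤ 2 * (δ₁ * A.card) :=
    (sum_shared_le (fun z c => f z c % 2 ^ (g * β + x)) A).trans
      (Nat.mul_le_mul_left _ (hf (g * β) (by omega) A (Nat.find_spec hex) (hAS.trans hcard)))
  have hsum2 : ∑ a ∈ A, (fib a).card = S.card := by
    simp only [hfib]
    exact (Finset.card_eq_sum_card_image Prod.fst S).symm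
  -- Each of the two summands has average at most `2 * δ₁ * S.card` over `A`. One `a` therefore
  -- satisfies both requirements up to a factor of two: few shared components and a fibre of at most
  -- twice the average size.
  obtain ⟨a, haA, ha⟩ : ∃ a ∈ A, bad a * S.card + 2 * δ₁ * A.card * (fib a).card ≤
      4 * δ₁ * S.card := by
    apply Finset.exists_le_of_sum_le hA0
    rw [Finset.sum_const, smul_eq_mul, Finset.sum_add_distrib, ← Finset.sum_mul, ← Finset.mul_sum,
      hsum2]
    nlinarith
  have hSpos : 0 < S.card := Finset.card_pos.2 hS
  have hbad : bad a ≤ 4 * δ₁ := by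
    apply Nat.le_of_mul_le_mul_right _ hSpos
    omega
  have hfa : A.card * (fib a).card ≤ 2 * S.card := by
    apply Nat.le_of_mul_le_mul_left _ (by omega : 0 < 2 * δ₁)
    have : 2 * δ₁ * (A.card * (fib a).card) = 2 * δ₁ * A.card * (fib a).card := by ring
    have : 2 * δ₁ * (2 * S.card) = 4 * δ₁ * S.card := by ring
    omega
  have hfk : (fib a).card ≤ 2 ^ κ := by
    rw [hfib]
    exact (Finset.card_filter_le _ _).trans hcard
  -- For `g > 0` minimality gives more than `2^((g-1)β)` first coordinates, so the fibre has at most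
  -- `2 * 2^κ / 2^((g-1)β)` elements; this is the origin of `κ + β + 1 - gβ`.
  have hfg : (fib a).card ≤ 2 ^ (κ + β + 1 - g * β) := by
    rcases Nat.eq_zero_or_pos g with h0 | hpos
    · rw [h0]
      exact hfk.trans (Nat.pow_le_pow_right (by norm_num) (by omega))
    · have h1 : 2 ^ ((g - 1) * β) < A.card := by
        have := Nat.find_min hex (m := g - 1) (by omega)
        omega
      have h2 : (g - 1) * β + β = g * β := by
        rw [← Nat.succ_mul, Nat.succ_eq_add_one, Nat.sub_add_cancel hpos]
      have h3 : 2 ^ ((g - 1) * β) * 2 ^ (κ + β + 1 - g * β) = 2 * 2 ^ κ := by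
        rw [← pow_add, ← pow_succ']
        congr 1
        omega
      have h4 : 2 ^ ((g - 1) * β) * (fib a).card ≤ 2 ^ ((g - 1) * β) * 2 ^ (κ + β + 1 - g * β) := by
        rw [h3]
        calc _ ≤ A.card * (fib a).card := Nat.mul_le_mul_right _ h1.le
          _ ≤ _ := by omega
      exact Nat.le_of_mul_le_mul_left h4 (by positivity)
  have hf0 : (fib a).Nonempty := by
    obtain ⟨z, hz, rfl⟩ := Finset.mem_image.1 haA
    exact ⟨z.2, Finset.mem_image.2 ⟨z, Finset.mem_filter.2 ⟨hz, rfl⟩, rfl⟩⟩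
  obtain ⟨b, hb, hbb⟩ := exists_shared_le
    (fun z c => h z c % 2 ^ (κ + β + 1 - g * β + x)) (fib a) hf0
    (hh (κ + β + 1 - g * β) (by omega) (fib a) hfg hfk)
  have hmem : ∀ b', b' ∈ fib a ↔ (a, b') ∈ S := by
    intro b'
    simp [fib]
  refine ⟨(a, b), (hmem b).1 hb, g, hgQ, ?_⟩
  refine le_trans (le_trans (Finset.card_le_card ?_) (Finset.card_union_le
    (Finset.univ.filter fun c => Shared (fun z => f z c % 2 ^ (g * β + x)) A a)
    (Finset.univ.filter fun c =>
      Shared (fun z => h z c % 2 ^ (κ + β + 1 - g * β + x)) (fib a) b))) (by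
        change bad a + _ ≤ _
        omega)
  intro c hc
  obtain ⟨⟨a', b'⟩, hz', hne, he⟩ := (Finset.mem_filter.1 hc).2
  simp only [Prod.mk.injEq] at he
  simp only [Finset.mem_union, Finset.mem_filter, Finset.mem_univ, true_and]
  -- Another pair with the same truncated values has either a different first coordinate, which `a`
  -- then shares, or lies in the fibre above `a`, where `b` is shared.
  by_cases haa : a' = a
  · subst haa
    refine Or.inr ⟨b', (hmem b').2 hz', ?_, he.2⟩
    rintro rfl
    exact hne rfl
  · exact Or.inl ⟨a', Finset.mem_image.2 ⟨_, hz', rfl⟩, haa, he.1⟩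

end product

/-! ### Bits of natural numbers -/

section bits

theorem Nat.mul_add_inj_of_lt {n a a' b b' : ℕ} (hb : b < n) (hb' : b' < n)
    (h : a * n + b = a' * n + b') : a = a' ∧ b = b' := by
  have hn : 0 < n := by omega
  have h1 : (a * n + b) / n = (a' * n + b') / n := by rw [h]
  have h2 : (a * n + b) % n = (a' * n + b') % n := by rw [h]
  rw [mul_comm a, mul_comm a', Nat.mul_add_div hn, Nat.mul_add_div hn, Nat.div_eq_of_lt hb,
    Nat.div_eq_of_lt hb'] at h1
  rw [mul_comm a, mul_comm a', Nat.mul_add_mod, Nat.mul_add_mod, Nat.mod_eq_of_lt hb,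
    Nat.mod_eq_of_lt hb'] at h2
  exact ⟨by omega, h2⟩

theorem Nat.mul_add_lt_mul {n m a b : ℕ} (ha : a < m) (hb : b < n) : a * n + b < m * n := by
  calc a * n + b < a * n + n := by omega
    _ = (a + 1) * n := by ring
    _ ≤ m * n := Nat.mul_le_mul_right _ ha

theorem Nat.mod_two_pow_eq_iff {a b l : ℕ} :
    a % 2 ^ l = b % 2 ^ l ↔ (fun i : Fin l => a.testBit i) = fun i : Fin l => b.testBit i := by
  constructor
  · intro h
    funext i
    have := congrArg (fun n => Nat.testBit n i) h
    simpa [Nat.testBit_mod_two_pow] using this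
  · intro h
    apply Nat.eq_of_testBit_eq
    intro i
    rw [Nat.testBit_mod_two_pow, Nat.testBit_mod_two_pow]
    by_cases hi : i < l
    · simpa [hi] using congrFun h ⟨i, hi⟩
    · simp [hi]

/-- The bitwise exclusive or of `f 0, …, f (n - 1)`. -/
def xorSum : ℕ → (ℕ → ℕ) → ℕ
  | 0, _ => 0
  | n + 1, f => xorSum n f ^^^ f n

/-- Addition in `Bool` is that of the Boolean ring, so bitwise exclusive or becomes a sum in an
additive group, to which `tabHash` applies. -/
theorem testBit_xorSum (n : ℕ) (f : ℕ → ℕ) (b : ℕ) :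
    (xorSum n f).testBit b = ∑ i : Fin n, (f i).testBit b := by
  induction n with
  | zero => simp [xorSum]; rfl
  | succ n ih =>
    rw [Fin.sum_univ_castSucc, xorSum, Nat.testBit_xor, ih]
    rfl

theorem xorSum_congr {n : ℕ} {f g : ℕ → ℕ} (h : ∀ i < n, f i = g i) : xorSum n f = xorSum n g := by
  induction n with
  | zero => rfl
  | succ n ih => rw [xorSum, xorSum, ih (fun i hi => h i (by omega)), h n (by omega)]

theorem coll_congr {U W W' : Type*} {f : U → W} {g : U → W'} (S : Finset U)
    (h : ∀ z z', f z = f z' ↔ g z = g z') : coll f S = coll g S := by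
  classical
  induction S using Finset.induction_on with
  | empty => simp [coll]
  | insert z S hz ih => rw [coll_insert f S z hz, coll_insert g S z hz, ih]; simp only [h]

end bits

/-! ### Fresh entries of a common table -/

section stage
variable {Ω : Type*} [Fintype Ω] [AddCommGroup Ω]

/-- The first `S` bits of the first `n` entries of the table `tab ω` can be flipped at will. -/
def Flippable (tab : Ω → ℕ → ℕ) (n S : ℕ) : Prop :=
  (∀ ω v, tab ω v < 2 ^ S) ∧ ∀ m : ℕ → ℕ → Bool, ∃ ω', ∀ ω, ∀ v < n, ∀ b < S,
    (tab (ω + ω') v).testBit b = (tab ω v).testBit b + m v b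

open scoped Classical in
-- The bits at the positions `loc` form an independent table for each component. Translating by a
-- random pattern on them leaves the entries outside `W` alone, hence also `Good` and the keys `K`,
-- and turns this table into a uniform one. So `prob_coll_le` applies for each fixed remainder of
-- the randomness.
theorem prob_stage {tab : Ω → ℕ → ℕ} {n S : ℕ} (hflip : Flippable tab n S)
    {U C Key : Type*} [Fintype U] [Fintype C] [Fintype Key] {l : ℕ} (W : Set ℕ)
    (loc : C → Key → Fin l → ℕ × ℕ)
    (hinj : ∀ c k b c' k' b', loc c k b = loc c' k' b' → c = c' ∧ k = k' ∧ b = b')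
    (hrange : ∀ c k b, (loc c k b).1 < n ∧ (loc c k b).1 ∈ W ∧ (loc c k b).2 < S)
    (Good : Ω → Prop) (K : Ω → U → C → Finset Key)
    (hGood : ∀ ω ω', (∀ v < n, v ∉ W → tab ω v = tab ω' v) → Good ω → Good ω')
    (hK' : ∀ ω ω', (∀ v < n, v ∉ W → tab ω v = tab ω' v) → K ω = K ω')
    {n₀ F G : ℕ}
    (hK : ∀ ω, Good ω → ∀ S : Finset U, S.Nonempty → S.card ≤ n₀ → ∃ z ∈ S,
      (Finset.univ.filter fun c => ¬ Free (Fin l → Bool) (K ω) c z (S.erase z)).card ≤ F)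
    (hV : n₀ ≤ 2 ^ l) {η : ℝ} (hη : η ≤ 1 / 2)
    (hle : (Fintype.card U : ℝ) * 2 ^ Fintype.card C * ((n₀ : ℝ) / 2 ^ l) ^ G ≤ η) :
    prob (fun ω => Good ω ∧ ∃ S : Finset U, S.card ≤ n₀ ∧
      (F + G) * S.card < ∑ c, coll (fun z => fun b : Fin l =>
        ∑ k ∈ K ω z c, (tab ω (loc c k b).1).testBit (loc c k b).2) S) ≤ 2 * η := by
  have hη0 : 0 ≤ η := le_trans (by positivity) hle
  have hcard : Fintype.card (Fin l → Bool) = 2 ^ l := by simp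
  let T₀ : Ω → C → Key → Fin l → Bool := fun ω c k b => (tab ω (loc c k b).1).testBit (loc c k b).2
  -- The pattern that adds `T` at the positions `loc`; the default `false` is the neutral element.
  let m : (C → Key → Fin l → Bool) → ℕ → ℕ → Bool := fun T v b =>
    if h : ∃ p : C × Key × Fin l, loc p.1 p.2.1 p.2.2 = (v, b) then
      T h.choose.1 h.choose.2.1 h.choose.2.2 else false
  have hm : ∀ T c k b, m T (loc c k b).1 (loc c k b).2 = T c k b := by
    intro T c k b
    have h : ∃ p : C × Key × Fin l, loc p.1 p.2.1 p.2.2 = ((loc c k b).1, (loc c k b).2) :=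
      ⟨(c, k, b), rfl⟩
    simp only [m]
    rw [dif_pos h]
    obtain ⟨h1, h2, h3⟩ := hinj _ _ _ _ _ _ h.choose_spec
    rw [h1, h2, h3]
  have hm0 : ∀ T v b, v ∉ W → m T v b = false := by
    intro T v b hv
    simp only [m]
    rw [dif_neg]
    rintro ⟨p, hp⟩
    apply hv
    have := (hrange p.1 p.2.1 p.2.2).2.1
    rwa [hp] at this
  choose φ hφ using fun T => hflip.2 (m T)
  have hsame : ∀ ω T, ∀ v < n, v ∉ W → tab (ω + φ T) v = tab ω v := by
    intro ω T v hv hW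
    apply Nat.eq_of_testBit_eq
    intro b
    by_cases hb : b < S
    · rw [hφ T ω v hv b hb, hm0 T v b hW]
      exact add_zero _
    · rw [Nat.testBit_eq_false_of_lt, Nat.testBit_eq_false_of_lt]
      · exact (hflip.1 _ _).trans_le (Nat.pow_le_pow_right (by norm_num) (by omega))
      · exact (hflip.1 _ _).trans_le (Nat.pow_le_pow_right (by norm_num) (by omega))
  have hT₀ : ∀ ω T, T₀ (ω + φ T) = T₀ ω + T := by
    intro ω T
    funext c k b
    obtain ⟨h1, _, h3⟩ := hrange c k b
    simp only [T₀, Pi.add_apply]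
    rw [hφ T ω _ h1 _ h3, hm]
  have hy : ∀ ω c, (fun z => fun b : Fin l =>
      ∑ k ∈ K ω z c, (tab ω (loc c k b).1).testBit (loc c k b).2) =
        fun z => tabHash (K ω) (T₀ ω) z c := by
    intro ω c
    funext z b
    simp [tabHash, T₀]
  simp only [hy]
  -- The whole estimate is in the factor `r`; the necessary condition `E'` is trivial here.
  refine (prob_shift φ (E' := fun _ => True) (r := 2 * η) (fun _ _ _ => trivial) ?_).trans ?_
  · intro ω _
    by_cases hg : Good ω
    · have hcore := prob_coll_le (V := Fin l → Bool) (K ω) (hK ω hg) (by rw [hcard]; exact hV) hη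
        (by rw [hcard]; push_cast; exact hle)
      rw [← prob_equiv (Equiv.addLeft (T₀ ω))] at hcore
      refine (prob_mono ?_).trans hcore
      rintro T ⟨_, S, hS, h⟩
      refine ⟨S, hS, ?_⟩
      rw [hT₀, hK' _ _ (hsame ω T)] at h
      exact h
    · refine (prob_mono (E' := fun _ => False) ?_).trans (by rw [prob_false]; linarith)
      intro T hT
      exact hg (hGood _ _ (hsame ω T) hT.1)
  · have := prob_le_one (fun _ : Ω => True)
    nlinarith

end stage

/-- A key that no other element has makes an element free. -/
theorem free_of_key {U C Key V : Type*} [AddCommGroup V] [DecidableEq Key]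
    {K : U → C → Finset Key} {c : C} {z : U} {S : Set U} {k : Key} (h : k ∈ K z c)
    (h' : ∀ z' ∈ S, k ∉ K z' c) : Free V K c z S := by
  intro u
  refine ⟨Pi.single k u, ?_, fun z' hz' => ?_⟩
  · rw [Finset.sum_pi_single' k]
    simp [h]
  · rw [Finset.sum_pi_single' k]
    simp [h' z' hz']

/-! ### Parameters, the virtual table and the function -/

namespace WordRAM

/-- The parameters of the data structure. -/
structure Par where
  -- There are `D = 2^lD` auxiliary hash functions; `κ` bits are split at multiples `g * β` with `g
  -- ≤ Q`. An entry of the table has `S` bits and holds `2^e` characters at distance `2^lν`; a row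
  -- consists of `R = 2^lR` entries, and `2^sr` entries share a word.
  (lam κ w lD β Q sr e lν lR S : ℕ)

namespace Par
variable (P : Par)

/-- With `x` surplus bits, a hash value truncated to `a + x` bits hits a set of `2^a` values with
probability at most `2^-x`. The length `L` of an index is the sum of the two truncation lengths, in
which `gβ` cancels, and `ν` is half the length of an output character. -/
def x : ℕ := P.β + 256
def L : ℕ := P.κ + 3 * P.β + 513
def ν : ℕ := P.κ + 13
def D : ℕ := 2 ^ P.lD
def R : ℕ := 2 ^ P.lR
def G : ℕ := P.D / 128

/-- The number of table entries with the same value of `h`. -/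
def block : ℕ := P.D * P.D * 2 ^ P.L * P.R

/-- The number of entries of the virtual table. -/
def size : ℕ := 2 ^ (6 + P.lam) * P.block

/-- The number of words of the table. -/
def words : ℕ := (P.size - 1) / 2 ^ P.sr + 1

/-- The conditions on the parameters. -/
structure Ok : Prop where
  lam_pos : 0 < P.lam
  κ_pos : 0 < P.κ
  β_pos : 0 < P.β
  β_le : P.β ≤ P.κ + 1
  le_Qβ : P.κ ≤ P.Q * P.β
  Qβ_lt : P.Q * P.β < P.κ + P.β
  Q_lt : P.Q < P.D
  D_eq : P.D = 128 * P.G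
  -- This makes `3ν + D + 3κ + 100 ≤ x * G`, the exponent inequality of the union bound for the
  -- auxiliary functions.
  D_large : 6 * P.κ + 300 ≤ P.D + P.β * P.G
  e_add : P.e + P.lR = P.lam + 7
  ν_le : P.κ + 13 ≤ 2 ^ P.lν
  char_le : (2 ^ P.e - 1) * 2 ^ P.lν + (P.κ + 13) ≤ P.S
  L_le : P.L ≤ P.S
  out_le : 96 * 2 ^ P.lam * (P.κ + 13) ≤ P.R * P.S
  S_eq : P.lR = 0 ∨ P.S = P.w
  layout : (P.sr = 0 ∧ P.S = P.w) ∨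
    (P.S = 2 ^ (P.lν + P.e) ∧ 2 ^ (P.sr + (P.lν + P.e)) ≤ P.w)
  -- Even the virtual indices of the scratch area, which count entries and not words, have to fit
  -- into a word.
  space : (20 + 4 * P.words) * 2 ^ P.sr < 2 ^ P.w

/-- The index of the table row with the given coordinates. -/
def row (h j g i : ℕ) : ℕ := (((h * P.D + j) * P.D + g) * 2 ^ P.L + i) * P.R

/-- The part of the index that depends on the hashed value. -/
def idx (g s a : ℕ) : ℕ :=
  s % 2 ^ (g * P.β + P.x) * 2 ^ (P.L - (g * P.β + P.x)) + a % 2 ^ (P.L - (g * P.β + P.x))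

variable (t : ℕ → ℕ)

/-- The hash functions on single characters. -/
def chash (j c : ℕ) : ℕ := t (P.row 0 j 0 c)

/-- The hash value of a pair. -/
def phash (m j s a : ℕ) : ℕ := xorSum (P.Q + 1) fun g => t (P.row m j g (P.idx g s a))

/-- The hash value of three characters. -/
def thash (j c₀ c₁ c₂ : ℕ) : ℕ :=
  P.phash t 2 j (P.phash t 1 j (P.chash t j c₀) (P.chash t j c₁)) (P.chash t j c₂)

/-- The character with number `c` in an array of words. -/
def char (a : ℕ → ℕ) (c : ℕ) : ℕ := a (c / 2 ^ P.e) / 2 ^ (c % 2 ^ P.e * 2 ^ P.lν) % 2 ^ P.ν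

/-- The contribution of one row of the table to a combined array. -/
def term (h j g : ℕ) (a b : ℕ → ℕ) (i k : ℕ) : ℕ :=
  t (P.row h j g (P.idx g (P.thash t j (P.char a (2 * i)) (P.char a (2 * i + 1))
    (P.char b (2 * i))) (P.chash t j (P.char b (2 * i + 1)))) + k)

/-- The array of words for a string, from those for its two halves. -/
def comb (lev : ℕ) (a b : ℕ → ℕ) (k : ℕ) : ℕ :=
  xorSum (64 * 2 ^ lev) fun i => xorSum P.D fun j => xorSum (P.Q + 1) fun g =>
    -- The first coordinates `64 * 2^lev + i` fill the interval from `64 * 2^lev` to `128 * 2^lev`.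
    -- Different levels thus use disjoint blocks, and the blocks `0`, `1`, `2` are left to the hash
    -- functions on characters, pairs and triples.
    P.term t (64 * 2 ^ lev + i) j g a b i k

end Par

/-- Strings of `2^n` characters. -/
def Tree (κ : ℕ) : ℕ → Type
  | 0 => Fin (2 ^ κ)
  | n + 1 => Tree κ n × Tree κ n

instance instFintypeTree (κ : ℕ) : (n : ℕ) → Fintype (Tree κ n)
  | 0 => inferInstanceAs (Fintype (Fin (2 ^ κ)))
  | n + 1 =>
    letI := instFintypeTree κ n
    inferInstanceAs (Fintype (Tree κ n × Tree κ n))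

theorem card_tree (κ n : ℕ) : Fintype.card (Tree κ n) = 2 ^ (κ * 2 ^ n) := by
  induction n with
  | zero =>
    have : Fintype.card (Tree κ 0) = Fintype.card (Fin (2 ^ κ)) := rfl
    simp [this]
  | succ n ih =>
    have : Fintype.card (Tree κ (n + 1)) = Fintype.card (Tree κ n × Tree κ n) := rfl
    rw [this, Fintype.card_prod, ih, ← pow_add]
    congr 1
    ring

/-- The array of words for a string. -/
def Par.node (P : Par) (t : ℕ → ℕ) : (n : ℕ) → Tree P.κ n → ℕ → ℕ
  | 0, z, k => if k = 0 then Fin.val z else 0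
  | n + 1, z, k => P.comb t n (P.node t n z.1) (P.node t n z.2) k

namespace Par
variable {P : Par}

theorem row_lt {h j g i k : ℕ} (hj : j < P.D) (hg : g < P.D) (hi : i < 2 ^ P.L) (hk : k < P.R) :
    P.row h j g i + k < (h + 1) * P.block := by
  have := Nat.mul_add_lt_mul (Nat.mul_add_lt_mul (Nat.mul_add_lt_mul (Nat.mul_add_lt_mul
    (Nat.lt_succ_self h) hj) hg) hi) hk
  simpa only [row, block, mul_assoc] using this

theorem le_row {h j g i : ℕ} : h * P.block ≤ P.row h j g i := by
  unfold row block
  calc h * (P.D * P.D * 2 ^ P.L * P.R) = ((h * P.D) * P.D * 2 ^ P.L) * P.R := by ring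
    _ ≤ _ := by
      gcongr
      exact (Nat.mul_le_mul_right _ ((Nat.mul_le_mul_right _ (Nat.le_add_right _ j)).trans
        (Nat.le_add_right _ g))).trans (Nat.le_add_right _ _)

theorem row_inj {h j g i k h' j' g' i' k' : ℕ} (hj : j < P.D) (hg : g < P.D) (hi : i < 2 ^ P.L)
    (hk : k < P.R) (hj' : j' < P.D) (hg' : g' < P.D) (hi' : i' < 2 ^ P.L) (hk' : k' < P.R)
    (heq : P.row h j g i + k = P.row h' j' g' i' + k') :
    h = h' ∧ j = j' ∧ g = g' ∧ i = i' ∧ k = k' := by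
  obtain ⟨h1, h2⟩ := Nat.mul_add_inj_of_lt hk hk' heq
  obtain ⟨h3, h4⟩ := Nat.mul_add_inj_of_lt hi hi' h1
  obtain ⟨h5, h6⟩ := Nat.mul_add_inj_of_lt hg hg' h3
  obtain ⟨h7, h8⟩ := Nat.mul_add_inj_of_lt hj hj' h5
  exact ⟨h7, h8, h6, h4, h2⟩

theorem len_le (hP : P.Ok) {g : ℕ} (hg : g ≤ P.Q) :
    P.L - (g * P.β + P.x) = P.κ + P.β + 1 - g * P.β + P.x ∧ g * P.β + P.x ≤ P.L := by
  have h1 : g * P.β ≤ P.Q * P.β := Nat.mul_le_mul_right _ hg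
  have h2 := hP.Qβ_lt
  unfold L x
  omega

theorem idx_lt (hP : P.Ok) {g : ℕ} (hg : g ≤ P.Q) (s a : ℕ) : P.idx g s a < 2 ^ P.L := by
  have h := (len_le hP hg).2
  have : 2 ^ P.L = 2 ^ (g * P.β + P.x) * 2 ^ (P.L - (g * P.β + P.x)) := by
    rw [← pow_add, Nat.add_sub_cancel' h]
  rw [this]
  exact Nat.mul_add_lt_mul (Nat.mod_lt _ (by positivity)) (Nat.mod_lt _ (by positivity))

theorem idx_inj (hP : P.Ok) {g : ℕ} (hg : g ≤ P.Q) {s a s' a' : ℕ} :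
    P.idx g s a = P.idx g s' a' ↔
      (s % 2 ^ (g * P.β + P.x), a % 2 ^ (P.κ + P.β + 1 - g * P.β + P.x)) =
        (s' % 2 ^ (g * P.β + P.x), a' % 2 ^ (P.κ + P.β + 1 - g * P.β + P.x)) := by
  rw [← (len_le hP hg).1, Prod.mk.injEq]
  constructor
  · intro h
    exact Nat.mul_add_inj_of_lt (Nat.mod_lt _ (by positivity)) (Nat.mod_lt _ (by positivity)) h
  · rintro ⟨h1, h2⟩
    simp only [idx, h1, h2]

theorem R_pos : 0 < P.R := by unfold R; positivity
theorem D_pos : 0 < P.D := by unfold D; positivity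

theorem block_le_size {h : ℕ} (hh : h < 2 ^ (6 + P.lam)) : (h + 1) * P.block ≤ P.size :=
  Nat.mul_le_mul_right _ hh

end Par

end WordRAM

/-! ### Few collisions of the auxiliary hash functions -/

namespace WordRAM

namespace Par
variable {P : Par} {Ω : Type*} [Fintype Ω] [AddCommGroup Ω] {tab : Ω → ℕ → ℕ}

/-- The elements are at most triples of characters, and each coincidence costs `2^-x`. Since `x * G
= βG + 2D`, one `D` pays for the choice of the components, and `D + βG` pays for the `3ν` bits of an
element and for the failure probability. -/
theorem union_bound_le (hP : P.Ok) {u a : ℕ} (hu : u ≤ 2 ^ (3 * P.ν)) :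
    (u : ℝ) * 2 ^ P.D * (((min (2 ^ a) (2 ^ P.κ) : ℕ) : ℝ) / 2 ^ (a + P.x)) ^ P.G ≤
      (1 / 2) ^ (3 * P.κ + 100) := by
  have h1 : (((min (2 ^ a) (2 ^ P.κ) : ℕ) : ℝ) / 2 ^ (a + P.x)) ≤ (1 / 2) ^ P.x := by
    have : ((min (2 ^ a) (2 ^ P.κ) : ℕ) : ℝ) ≤ 2 ^ a := by exact_mod_cast min_le_left _ _
    rw [div_le_iff₀ (by positivity), pow_add, one_div, inv_pow]
    field_simp
    exact this
  have h2 : (u : ℝ) ≤ 2 ^ (3 * P.ν) := by exact_mod_cast hu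
  calc (u : ℝ) * 2 ^ P.D * (((min (2 ^ a) (2 ^ P.κ) : ℕ) : ℝ) / 2 ^ (a + P.x)) ^ P.G
      ≤ 2 ^ (3 * P.ν) * 2 ^ P.D * ((1 / 2) ^ P.x) ^ P.G := by gcongr
    _ = 2 ^ (3 * P.ν + P.D) * (1 / 2) ^ (P.x * P.G) := by rw [pow_add, pow_mul (1 / 2 : ℝ)]
    _ ≤ 2 ^ (3 * P.ν + P.D) * (1 / 2) ^ (3 * P.ν + P.D + (3 * P.κ + 100)) := by
        refine mul_le_mul_of_nonneg_left ?_ (by positivity)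
        apply pow_le_pow_of_le_one (by norm_num) (by norm_num)
        have h3 := hP.D_eq
        have h4 := hP.D_large
        have : P.x * P.G = P.β * P.G + 256 * P.G := by unfold x; ring
        unfold ν
        omega
    _ = (1 / 2) ^ (3 * P.κ + 100) := by
        rw [pow_add (1 / 2 : ℝ), ← mul_assoc, ← mul_pow]
        norm_num

open scoped Classical in
/-- Hash functions with fresh table entries have few collisions with high probability. -/
theorem prob_not_spread_le (hP : P.Ok) (hflip : Flippable tab P.size P.S)
    {U Key : Type*} [Fintype U] [Fintype Key] (hU : Fintype.card U ≤ 2 ^ (3 * P.ν)) (W : Set ℕ)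
    (addr : Fin P.D → Key → ℕ)
    (hinj : ∀ c k c' k', addr c k = addr c' k' → c = c' ∧ k = k')
    (hrange : ∀ c k, addr c k < P.size ∧ addr c k ∈ W)
    (Good : Ω → Prop) (K : Ω → U → Fin P.D → Finset Key)
    (hGood : ∀ ω ω', (∀ v < P.size, v ∉ W → tab ω v = tab ω' v) → Good ω → Good ω')
    (hK' : ∀ ω ω', (∀ v < P.size, v ∉ W → tab ω v = tab ω' v) → K ω = K ω')
    {F : ℕ}
    (hK : ∀ ω, Good ω → ∀ S : Finset U, S.Nonempty → S.card ≤ 2 ^ P.κ → ∃ z ∈ S, ∀ V : Type,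
      ∀ _ : AddCommGroup V,
      (Finset.univ.filter fun c => ¬ Free V (K ω) c z (S.erase z)).card ≤ F)
    (f : Ω → U → Fin P.D → ℕ)
    (hf : ∀ ω z c b, (f ω z c).testBit b = ∑ k ∈ K ω z c, (tab ω (addr c k)).testBit b) :
    prob (fun ω => Good ω ∧ ¬ Spread P.κ P.x (P.κ + P.β + 1) (F + P.G) (f ω)) ≤
      (P.κ + P.β + 2) * (2 * (1 / 2) ^ (3 * P.κ + 100)) := by
  -- Every truncation length `a + x` is a separate application of the union bound; there are `κ + β
  -- + 2` of them.
  have hstage : ∀ a ∈ Finset.range (P.κ + P.β + 2), prob (fun ω => Good ω ∧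
      ∃ A : Finset U, A.card ≤ min (2 ^ a) (2 ^ P.κ) ∧ (F + P.G) * A.card <
        ∑ c, coll (fun z => f ω z c % 2 ^ (a + P.x)) A) ≤ 2 * (1 / 2) ^ (3 * P.κ + 100) := by
    intro a ha
    have hlen : a + P.x ≤ P.S := by
      have h1 : P.κ + 3 * P.β + 513 ≤ P.S := hP.L_le
      have h2 := Finset.mem_range.1 ha
      change a + (P.β + 256) ≤ P.S
      linarith
    have := prob_stage hflip (U := U) (l := a + P.x) W (fun c k b => (addr c k, (b : ℕ)))
      (by
        intro c k b c' k' b' h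
        rw [Prod.mk.injEq] at h
        obtain ⟨h1, h2⟩ := hinj _ _ _ _ h.1
        exact ⟨h1, h2, Fin.ext h.2⟩)
      (fun c k b => ⟨(hrange c k).1, (hrange c k).2, b.2.trans_le hlen⟩)
      Good K hGood hK' (n₀ := min (2 ^ a) (2 ^ P.κ)) (F := F) (G := P.G)
      (by
        intro ω hω S hS hc
        obtain ⟨z, hz, h⟩ := hK ω hω S hS (hc.trans (min_le_right _ _))
        exact ⟨z, hz, h _ _⟩)
      ((min_le_left _ _).trans (Nat.pow_le_pow_right (by norm_num) (by omega)))
      (η := (1 / 2) ^ (3 * P.κ + 100))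
      (by
        calc ((1 : ℝ) / 2) ^ (3 * P.κ + 100) ≤ (1 / 2) ^ 1 :=
              pow_le_pow_of_le_one (by norm_num) (by norm_num) (by omega)
          _ = 1 / 2 := pow_one _)
      (by
        rw [Fintype.card_fin]
        exact union_bound_le hP hU)
    refine (prob_mono ?_).trans this
    rintro ω ⟨h1, A, h2, h3⟩
    refine ⟨h1, A, h2, h3.trans_eq (Finset.sum_congr rfl fun c _ => ?_)⟩
    refine coll_congr A fun z z' => ?_
    rw [Nat.mod_two_pow_eq_iff]
    simp only [hf]
  have hbad : ∀ ω, (Good ω ∧ ¬ Spread P.κ P.x (P.κ + P.β + 1) (F + P.G) (f ω)) →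
      ∃ a ∈ Finset.range (P.κ + P.β + 2), Good ω ∧
        ∃ A : Finset U, A.card ≤ min (2 ^ a) (2 ^ P.κ) ∧ (F + P.G) * A.card <
          ∑ c, coll (fun z => f ω z c % 2 ^ (a + P.x)) A := by
    rintro ω ⟨h1, h2⟩
    unfold Spread at h2
    push Not at h2
    obtain ⟨a, ha, A, h3, h4, h5⟩ := h2
    exact ⟨a, Finset.mem_range.2 (by omega), h1, A, le_min h3 h4, h5⟩
  refine (prob_mono hbad).trans ((prob_exists_le _ _).trans
    ((Finset.sum_le_sum hstage).trans (le_of_eq ?_)))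
  rw [Finset.sum_const, nsmul_eq_mul, Finset.card_range]
  push_cast
  ring

/-- The hash functions on characters have few collisions. -/
def CharGood (P : Par) (t : ℕ → ℕ) : Prop :=
  Spread P.κ P.x (P.κ + P.β + 1) P.G
    (fun (z : Fin (2 ^ P.ν)) (j : Fin P.D) => P.chash t j z)

theorem ν_le_L : P.ν ≤ P.L := by
  unfold ν L
  omega

theorem chash_row_lt {j c : ℕ} (hj : j < P.D) (hc : c < 2 ^ P.ν) : P.row 0 j 0 c < P.block := by
  have := row_lt (h := 0) (k := 0) hj D_pos
    (hc.trans_le (Nat.pow_le_pow_right (by norm_num) ν_le_L)) R_pos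
  simpa using this

theorem chash_congr {t t' : ℕ → ℕ} (h : ∀ v < P.block, t v = t' v) {j c : ℕ} (hj : j < P.D)
    (hc : c < 2 ^ P.ν) : P.chash t j c = P.chash t' j c := h _ (chash_row_lt hj hc)

/-- Each character has its own entry for each `j`, so every element is free in all components and `F
= 0`. -/
theorem prob_charGood (hP : P.Ok) (hflip : Flippable tab P.size P.S) :
    prob (fun ω => ¬ P.CharGood (tab ω)) ≤
      (P.κ + P.β + 2) * (2 * (1 / 2) ^ (3 * P.κ + 100)) := by
  classical
  have hlt : ∀ (c : Fin P.D) (k : Fin (2 ^ P.ν)), P.row 0 c 0 k < P.size := fun c k =>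
    (chash_row_lt c.2 k.2).trans_le ((Nat.le_mul_of_pos_left _ (by norm_num)).trans
      (block_le_size (h := 0) (by positivity)))
  have := prob_not_spread_le hP hflip (U := Fin (2 ^ P.ν)) (Key := Fin (2 ^ P.ν))
    (by simpa using Nat.pow_le_pow_right (by norm_num) (by omega)) Set.univ
    (fun c k => P.row 0 c 0 k)
    (by
      intro c k c' k' h
      have hpow : 2 ^ P.ν ≤ 2 ^ P.L := Nat.pow_le_pow_right (by norm_num) ν_le_L
      obtain ⟨_, h2, _, h4, _⟩ := row_inj (k := 0) (k' := 0) c.2 D_pos (k.2.trans_le hpow) R_pos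
        c'.2 D_pos (k'.2.trans_le hpow) R_pos (by simpa using h)
      exact ⟨Fin.ext h2, Fin.ext h4⟩)
    (fun c k => ⟨hlt c k, trivial⟩) (fun _ => True) (fun _ z _ => {z}) (fun _ _ _ _ => trivial)
    (fun _ _ _ => rfl) (F := 0)
    (by
      intro ω _ S hS _
      obtain ⟨z, hz⟩ := hS
      refine ⟨z, hz, fun V _ => ?_⟩
      rw [Nat.le_zero, Finset.card_eq_zero, Finset.filter_eq_empty_iff]
      intro c _
      rw [not_not]
      refine free_of_key (k := z) (by simp) ?_
      intro z' hz'
      simp at hz'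
      simpa [eq_comm] using hz'.2)
    (fun ω z c => P.chash (tab ω) c z) (by simp [chash])
  simpa [CharGood] using this

/-- The hash functions on pairs have few collisions with high probability. -/
theorem prob_phash_le (hP : P.Ok) (hflip : Flippable tab P.size P.S) {X : Type*} [Fintype X]
    (hX : Fintype.card X ≤ 2 ^ (2 * P.ν)) {m δ : ℕ} (hm : 1 ≤ m) (hm2 : m < 2 ^ (6 + P.lam))
    (hδ : 0 < δ)
    (f : (ℕ → ℕ) → X → Fin P.D → ℕ)
    (hf : ∀ t t' : ℕ → ℕ, (∀ v < m * P.block, t v = t' v) → f t = f t')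
    (Good : (ℕ → ℕ) → Prop)
    (hGood : ∀ t t' : ℕ → ℕ, (∀ v < m * P.block, t v = t' v) → Good t → Good t')
    (hs : ∀ t, Good t → Spread P.κ P.x (P.κ + P.β + 1) δ (f t) ∧ P.CharGood t) :
    prob (fun ω => Good (tab ω) ∧ ¬ Spread P.κ P.x (P.κ + P.β + 1) (4 * δ + 2 * P.G + P.G)
      (fun (z : X × Fin (2 ^ P.ν)) (j : Fin P.D) =>
        P.phash (tab ω) m j (f (tab ω) z.1 j) (P.chash (tab ω) j z.2))) ≤
      (P.κ + P.β + 2) * (2 * (1 / 2) ^ (3 * P.κ + 100)) := by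
  classical
  have hsz : (m + 1) * P.block ≤ P.size := block_le_size hm2
  have hblock : P.block ≤ m * P.block := Nat.le_mul_of_pos_left _ hm
  -- For fixed `j` a pair has one index for each split `g`; the indices depend only on blocks below
  -- `m`, while the entries are in block `m`.
  let key : Ω → X × Fin (2 ^ P.ν) → Fin P.D → Fin (P.Q + 1) → Fin (P.Q + 1) × Fin (2 ^ P.L) :=
    fun ω z j g => (g, ⟨P.idx g (f (tab ω) z.1 j) (P.chash (tab ω) j z.2),
      idx_lt hP (Nat.lt_succ_iff.1 g.2) _ _⟩)
  have hagree : ∀ ω ω', (∀ v < P.size, v ∉ {v | m * P.block ≤ v} → tab ω v = tab ω' v) →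
      ∀ v < m * P.block, tab ω v = tab ω' v := by
    intro ω ω' h v hv
    refine h v (hv.trans_le ((Nat.mul_le_mul_right _ (by omega)).trans hsz)) ?_
    simpa using hv
  refine prob_not_spread_le hP hflip (Key := Fin (P.Q + 1) × Fin (2 ^ P.L)) ?_
    {v | m * P.block ≤ v}
    (fun c k => P.row m c k.1 k.2) ?_ ?_ (fun ω => Good (tab ω))
    (fun ω z j => Finset.univ.image (key ω z j)) ?_ ?_ ?_ _ ?_
  · rw [Fintype.card_prod, Fintype.card_fin]
    calc _ ≤ 2 ^ (2 * P.ν) * 2 ^ P.ν := Nat.mul_le_mul_right _ hX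
      _ = 2 ^ (3 * P.ν) := by
        rw [← pow_add]
        congr 1
        omega
  · intro c k c' k' h
    have hQ := hP.Q_lt
    obtain ⟨_, h2, h3, h4, _⟩ := row_inj (k := 0) (k' := 0) c.2 (k.1.2.trans_le hQ) k.2.2 R_pos
      c'.2 (k'.1.2.trans_le hQ) k'.2.2 R_pos (by simpa using h)
    exact ⟨Fin.ext h2, Prod.ext (Fin.ext h3) (Fin.ext h4)⟩
  · intro c k
    refine ⟨lt_of_lt_of_le ?_ hsz, le_row⟩
    have := row_lt (h := m) (k := 0) c.2 (k.1.2.trans_le hP.Q_lt) k.2.2 R_pos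
    simpa using this
  · intro ω ω' h
    exact hGood _ _ (hagree ω ω' h)
  · intro ω ω' h
    have h1 := hagree ω ω' h
    funext z j
    have : key ω z j = key ω' z j := by
      funext g
      simp only [key]
      rw [hf _ _ h1, chash_congr (fun v hv => h1 v (hv.trans_le hblock)) j.2 z.2.2]
    rw [this]
  · intro ω hω S hS hc
    obtain ⟨hs1, hs2⟩ := hs _ hω
    -- For all but `4δ + 2G` of the functions `j`, the index for this `g` is private to `z`, so `z`
    -- is free there by `free_of_key`.
    obtain ⟨z, hz, g, hg, h⟩ := hs1.exists_unshared hs2 hδ hP.le_Qβ hP.Qβ_lt S hS hc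
    refine ⟨z, hz, fun V _ => le_trans (Finset.card_le_card ?_) h⟩
    intro c hcf
    simp only [Finset.mem_filter, Finset.mem_univ, true_and] at hcf ⊢
    by_contra hsh
    apply hcf
    refine free_of_key (k := key ω z c ⟨g, Nat.lt_succ_iff.2 hg⟩)
      (Finset.mem_image_of_mem _ (Finset.mem_univ _)) ?_
    intro z' hz' hk
    obtain ⟨g', _, hg'⟩ := Finset.mem_image.1 hk
    simp only [Finset.coe_erase, Set.mem_sdiff, Finset.mem_coe, Set.mem_singleton_iff] at hz'
    simp only [key, Prod.mk.injEq, Fin.mk.injEq] at hg'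
    obtain ⟨rfl, hidx⟩ := hg'
    exact hsh ⟨z', hz'.1, hz'.2, (idx_inj hP hg).1 hidx⟩
  · intro ω z c b
    rw [phash, testBit_xorSum, Finset.sum_image]
    intro g _ g' _ h
    simp only [key, Prod.mk.injEq] at h
    exact h.1

end Par

end WordRAM

/-! ### Characters, pairs, triples and components -/

namespace WordRAM

namespace Par
variable {P : Par} {Ω : Type*} [Fintype Ω] [AddCommGroup Ω] {tab : Ω → ℕ → ℕ}

/-- The hash functions on pairs of characters. -/
def pairHash (P : Par) (t : ℕ → ℕ) (z : Fin (2 ^ P.ν) × Fin (2 ^ P.ν)) (j : Fin P.D) : ℕ :=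
  P.phash t 1 j (P.chash t j z.1) (P.chash t j z.2)

/-- The hash functions on triples of characters. -/
def tripleHash (P : Par) (t : ℕ → ℕ)
    (z : (Fin (2 ^ P.ν) × Fin (2 ^ P.ν)) × Fin (2 ^ P.ν)) (j : Fin P.D) : ℕ :=
  P.phash t 2 j (P.pairHash t z.1 j) (P.chash t j z.2)

/-- A product turns the constants `δ` and `G` of its factors into `4δ + 2G + G`: at most `4δ + 2G`
components are not free, and the union bound adds `G`. From characters to triples the constants are
`G`, `7G` and `31G`. -/
def PairGood (P : Par) (t : ℕ → ℕ) : Prop :=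
  Spread P.κ P.x (P.κ + P.β + 1) (4 * P.G + 2 * P.G + P.G) (P.pairHash t)

def TripleGood (P : Par) (t : ℕ → ℕ) : Prop :=
  Spread P.κ P.x (P.κ + P.β + 1) (4 * (4 * P.G + 2 * P.G + P.G) + 2 * P.G + P.G) (P.tripleHash t)

/-- The auxiliary hash functions have few collisions. -/
def BaseGood (P : Par) (t : ℕ → ℕ) : Prop := P.CharGood t ∧ P.PairGood t ∧ P.TripleGood t

theorem charGood_congr {t t' : ℕ → ℕ} (h : ∀ v < P.block, t v = t' v) (hg : P.CharGood t) :
    P.CharGood t' := by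
  unfold CharGood at *
  convert hg using 3 with z j
  exact (chash_congr h j.2 z.2).symm

theorem phash_congr (hP : P.Ok) {t t' : ℕ → ℕ} {m : ℕ} (h : ∀ v < (m + 1) * P.block, t v = t' v)
    {j : ℕ} (hj : j < P.D) (s a : ℕ) : P.phash t m j s a = P.phash t' m j s a := by
  refine xorSum_congr fun g hg => h _ ?_
  have := row_lt (h := m) (k := 0) hj ((by omega : g ≤ P.Q).trans_lt hP.Q_lt)
    (idx_lt hP (by omega : g ≤ P.Q) s a) R_pos
  simpa using this

theorem pairHash_congr (hP : P.Ok) {t t' : ℕ → ℕ} (h : ∀ v < 2 * P.block, t v = t' v) :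
    P.pairHash t = P.pairHash t' := by
  have h1 : ∀ v < P.block, t v = t' v := fun v hv => h v (by omega)
  funext z j
  unfold pairHash
  rw [chash_congr h1 j.2 z.1.2, chash_congr h1 j.2 z.2.2, phash_congr hP h j.2]

theorem tripleHash_congr (hP : P.Ok) {t t' : ℕ → ℕ} (h : ∀ v < 3 * P.block, t v = t' v) :
    P.tripleHash t = P.tripleHash t' := by
  have h1 : ∀ v < P.block, t v = t' v := fun v hv => h v (by omega)
  funext z j
  unfold tripleHash
  rw [pairHash_congr hP (fun v hv => h v (by omega)), chash_congr h1 j.2 z.2.2,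
    phash_congr hP h j.2]

theorem baseGood_congr (hP : P.Ok) {t t' : ℕ → ℕ} (h : ∀ v < 3 * P.block, t v = t' v)
    (hg : P.BaseGood t) : P.BaseGood t' := by
  refine ⟨charGood_congr (fun v hv => h v (by omega)) hg.1, ?_, ?_⟩
  · unfold PairGood
    rw [← pairHash_congr hP (fun v hv => h v (by omega))]
    exact hg.2.1
  · unfold TripleGood
    rw [← tripleHash_congr hP h]
    exact hg.2.2

theorem G_pos (hP : P.Ok) : 0 < P.G := by
  have h1 := hP.D_eq
  have h2 : 0 < P.D := D_pos
  omega

/-- The functions on characters, pairs and triples read fresh entries in blocks `0`, `1` and `2`.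
Each is good with high probability given that the preceding ones are. -/
theorem prob_not_baseGood_le (hP : P.Ok) (hflip : Flippable tab P.size P.S) :
    prob (fun ω => ¬ P.BaseGood (tab ω)) ≤
      3 * ((P.κ + P.β + 2) * (2 * (1 / 2) ^ (3 * P.κ + 100))) := by
  have h64 : 2 ^ 6 ≤ 2 ^ (6 + P.lam) := Nat.pow_le_pow_right (by norm_num) (by omega)
  have hG := G_pos hP
  have h1 := prob_charGood hP hflip
  have h2 := prob_phash_le hP hflip (X := Fin (2 ^ P.ν)) (m := 1) (δ := P.G)
    (by simpa using Nat.pow_le_pow_right (by norm_num) (by omega)) le_rfl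
    (lt_of_lt_of_le (by norm_num) h64) hG
    (fun t z j => P.chash t j z)
    (by
      intro t t' h
      funext z j
      exact chash_congr (by simpa using h) j.2 z.2)
    P.CharGood (fun t t' h => charGood_congr (by simpa using h)) (fun t ht => ⟨ht, ht⟩)
  have h3 := prob_phash_le hP hflip (X := Fin (2 ^ P.ν) × Fin (2 ^ P.ν)) (m := 2)
    (δ := 4 * P.G + 2 * P.G + P.G)
    (by
      rw [Fintype.card_prod, Fintype.card_fin, ← pow_add, two_mul])
    (by norm_num) (lt_of_lt_of_le (by norm_num) h64) (by omega)
    P.pairHash (fun t t' h => pairHash_congr hP h) (fun t => P.CharGood t ∧ P.PairGood t)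
    (by
      rintro t t' h ⟨hc, hp⟩
      refine ⟨charGood_congr (fun v hv => h v (by omega)) hc, ?_⟩
      unfold PairGood
      rwa [← pairHash_congr hP h])
    (fun t ht => ⟨ht.2, ht.1⟩)
  have hsplit : ∀ ω, ¬ P.BaseGood (tab ω) → (¬ P.CharGood (tab ω)) ∨
      ((P.CharGood (tab ω) ∧ ¬ P.PairGood (tab ω)) ∨
        ((P.CharGood (tab ω) ∧ P.PairGood (tab ω)) ∧ ¬ P.TripleGood (tab ω))) := by
    intro ω h
    unfold BaseGood at h
    tauto
  refine (prob_mono hsplit).trans ((prob_or_le _ _).trans ?_)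
  have h4 := prob_or_le (fun ω => P.CharGood (tab ω) ∧ ¬ P.PairGood (tab ω))
    (fun ω => (P.CharGood (tab ω) ∧ P.PairGood (tab ω)) ∧ ¬ P.TripleGood (tab ω))
  change prob (fun ω => P.CharGood (tab ω) ∧ ¬ P.PairGood (tab ω)) ≤ _ at h2
  change prob (fun ω => (P.CharGood (tab ω) ∧ P.PairGood (tab ω)) ∧ ¬ P.TripleGood (tab ω)) ≤ _
    at h3
  linarith

/-- A character as an element of a finite type. -/
def charF (P : Par) (a : ℕ → ℕ) (c : ℕ) : Fin (2 ^ P.ν) := ⟨P.char a c, Nat.mod_lt _ (by positivity)⟩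

/-- The two characters of a component. -/
def comp (P : Par) (a : ℕ → ℕ) (i : ℕ) : Fin (2 ^ P.ν) × Fin (2 ^ P.ν) :=
  (P.charF a (2 * i), P.charF a (2 * i + 1))

/-- The four characters of a component of a pair of arrays. -/
def quad (P : Par) (a b : ℕ → ℕ) (i : ℕ) :
    ((Fin (2 ^ P.ν) × Fin (2 ^ P.ν)) × Fin (2 ^ P.ν)) × Fin (2 ^ P.ν) :=
  ((P.comp a i, P.charF b (2 * i)), P.charF b (2 * i + 1))

theorem quad_inj {a b a' b' : ℕ → ℕ} {i : ℕ} :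
    P.quad a b i = P.quad a' b' i ↔ P.comp a i = P.comp a' i ∧ P.comp b i = P.comp b' i := by
  simp only [quad, comp, Prod.mk.injEq]
  tauto

theorem term_eq (t : ℕ → ℕ) {h g : ℕ} (j : Fin P.D) (a b : ℕ → ℕ) (i k : ℕ) :
    P.term t h j g a b i k = t (P.row h j g (P.idx g (P.tripleHash t (P.quad a b i).1 j)
      (P.chash t j (P.quad a b i).2)) + k) := rfl

/-- The components of the arrays of words have few collisions. -/
def LevelGood (P : Par) (t : ℕ → ℕ) (n : ℕ) : Prop :=
  ∀ S : Finset (Tree P.κ n), S.card ≤ 2 ^ P.κ →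
    ∑ i : Fin (64 * 2 ^ n), coll (fun z => P.comp (P.node t n z) i) S ≤ 8 * 2 ^ n * S.card

theorem char_div_lt (hP : P.Ok) {n c : ℕ} (hn : n ≤ P.lam) (hc : c < 128 * 2 ^ n) :
    c / 2 ^ P.e < P.R := by
  rw [Nat.div_lt_iff_lt_mul (by positivity)]
  refine hc.trans_le ?_
  have h1 : P.R * 2 ^ P.e = 2 ^ (P.lam + 7) := by
    unfold R
    rw [← pow_add, add_comm, hP.e_add]
  rw [h1]
  calc 128 * 2 ^ n = 2 ^ (n + 7) := by rw [pow_add]; ring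
    _ ≤ _ := Nat.pow_le_pow_right (by norm_num) (by omega)

theorem comp_congr (hP : P.Ok) {n : ℕ} (hn : n ≤ P.lam) {a a' : ℕ → ℕ}
    (h : ∀ k < P.R, a k = a' k) {i : ℕ} (hi : i < 64 * 2 ^ n) : P.comp a i = P.comp a' i := by
  unfold comp charF char
  simp only [Prod.mk.injEq, Fin.mk.injEq]
  rw [h _ (char_div_lt hP hn (by omega)), h _ (char_div_lt hP hn (by omega))]
  exact ⟨rfl, rfl⟩

/-- Arrays of level `n` depend only on the blocks below `64 * 2^n`, which makes the blocks from
there on fresh for level `n + 1`. The restriction `k < R` keeps the access inside one row. -/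
theorem node_congr (hP : P.Ok) {t t' : ℕ → ℕ} : ∀ (n : ℕ), n ≤ P.lam →
    (∀ v < 64 * 2 ^ n * P.block, t v = t' v) → ∀ (z : Tree P.κ n), ∀ k < P.R,
      P.node t n z k = P.node t' n z k
  | 0, _, _, _, _, _ => rfl
  | n + 1, hn, h, z, k, hk => by
    have hb : 64 * 2 ^ (n + 1) * P.block = 128 * 2 ^ n * P.block := by rw [pow_succ]; ring
    have h' : ∀ v < 64 * 2 ^ n * P.block, t v = t' v := by
      intro v hv
      apply h v
      rw [hb]
      exact hv.trans_le (Nat.mul_le_mul_right _ (by omega))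
    have h3 : ∀ v < 3 * P.block, t v = t' v := by
      intro v hv
      refine h' v (hv.trans_le (Nat.mul_le_mul_right _ ?_))
      have : 0 < 2 ^ n := by positivity
      omega
    have ih1 := node_congr hP n (by omega) h' z.1
    have ih2 := node_congr hP n (by omega) h' z.2
    simp only [node, comb]
    refine xorSum_congr fun i hi => xorSum_congr fun j hj => xorSum_congr fun g hg => ?_
    have hq : P.quad (P.node t n z.1) (P.node t n z.2) i =
        P.quad (P.node t' n z.1) (P.node t' n z.2) i :=
      quad_inj.2 ⟨comp_congr hP (by omega) ih1 hi, comp_congr hP (by omega) ih2 hi⟩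
    have e1 := term_eq t (h := 64 * 2 ^ n + i) (g := g) ⟨j, hj⟩ (P.node t n z.1) (P.node t n z.2) i k
    have e2 := term_eq t' (h := 64 * 2 ^ n + i) (g := g) ⟨j, hj⟩ (P.node t' n z.1)
      (P.node t' n z.2) i k
    simp only at e1 e2
    rw [e1, e2, ← hq, tripleHash_congr hP h3, chash_congr (fun v hv => h3 v (by omega)) hj
      (P.quad (P.node t n z.1) (P.node t n z.2) i).2.2]
    apply h
    rw [hb]
    refine (row_lt hj ((by omega : g ≤ P.Q).trans_lt hP.Q_lt)
      (idx_lt hP (by omega : g ≤ P.Q) _ _) hk).trans_le (Nat.mul_le_mul_right _ (by omega))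

/-- Base of the recursion: the array of a single character contains this character, so component `0`
is injective. -/
theorem comp_node_zero (t : ℕ → ℕ) {z z' : Tree P.κ 0}
    (h : P.comp (P.node t 0 z) 0 = P.comp (P.node t 0 z') 0) : z = z' := by
  have hz : ∀ z : Tree P.κ 0, P.char (P.node t 0 z) 0 = Fin.val z := by
    intro z
    have : Fin.val z < 2 ^ P.ν :=
      lt_of_lt_of_le z.2 (Nat.pow_le_pow_right (by norm_num) (by unfold ν; omega))
    simp [char, node, Nat.mod_eq_of_lt this]
  simp only [comp, charF, Prod.mk.injEq, Fin.mk.injEq, mul_zero] at h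
  rw [hz, hz] at h
  exact Fin.ext h.1

open scoped Classical in
-- A left half `a` that shares few components is found first, then a right half `b` that shares few
-- components among those paired with `a`. A component shared by neither separates `(a, b)` from all
-- other pairs.
theorem exists_unshared_quad (t : ℕ → ℕ) (n : ℕ) (hn : n = 0 ∨ P.LevelGood t n)
    (S : Finset (Tree P.κ n × Tree P.κ n)) (hS : S.Nonempty) (hc : S.card ≤ 2 ^ P.κ) :
    ∃ z ∈ S, ∃ i < 64 * 2 ^ n,
      ¬ Shared (fun z : Tree P.κ n × Tree P.κ n => P.quad (P.node t n z.1) (P.node t n z.2) i) S z := by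
  rcases hn with rfl | hn
  · obtain ⟨z, hz⟩ := hS
    refine ⟨z, hz, 0, by norm_num, ?_⟩
    rintro ⟨z', hz', hne, he⟩
    obtain ⟨h1, h2⟩ := quad_inj.1 he
    exact hne (Prod.ext (comp_node_zero t h1) (comp_node_zero t h2))
  · set A := S.image Prod.fst with hA
    have hA0 : A.Nonempty := hS.image _
    have hAS : A.card ≤ S.card := Finset.card_image_le
    obtain ⟨a, ha, hab⟩ := exists_shared_le
      (fun z (i : Fin (64 * 2 ^ n)) => P.comp (P.node t n z) i) A hA0 (hn A (hAS.trans hc))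
    set B := (S.filter fun z => z.1 = a).image Prod.snd with hB
    have hB0 : B.Nonempty := by
      obtain ⟨z, hz, rfl⟩ := Finset.mem_image.1 ha
      exact ⟨z.2, Finset.mem_image.2 ⟨z, Finset.mem_filter.2 ⟨hz, rfl⟩, rfl⟩⟩
    have hBS : B.card ≤ S.card := Finset.card_image_le.trans (Finset.card_filter_le _ _)
    obtain ⟨b, hb, hbb⟩ := exists_shared_le
      (fun z (i : Fin (64 * 2 ^ n)) => P.comp (P.node t n z) i) B hB0 (hn B (hBS.trans hc))
    have hmem : ∀ b', b' ∈ B ↔ (a, b') ∈ S := by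
      intro b'
      simp [hB]
    -- Each of `a` and `b` shares at most `16 * 2^n` of the `64 * 2^n` components.
    have hex : ∃ i : Fin (64 * 2 ^ n), ¬ Shared (fun z => P.comp (P.node t n z) i) A a ∧
        ¬ Shared (fun z => P.comp (P.node t n z) i) B b := by
      by_contra hcon
      push Not at hcon
      have hsub : (Finset.univ : Finset (Fin (64 * 2 ^ n))) ⊆
          (Finset.univ.filter fun i : Fin (64 * 2 ^ n) =>
            Shared (fun z => P.comp (P.node t n z) i) A a) ∪
          (Finset.univ.filter fun i : Fin (64 * 2 ^ n) =>
            Shared (fun z => P.comp (P.node t n z) i) B b) := by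
        intro i _
        simp only [Finset.mem_union, Finset.mem_filter, Finset.mem_univ, true_and]
        by_contra h
        push Not at h
        exact h.2 (hcon i h.1)
      have h1 := (Finset.card_le_card hsub).trans (Finset.card_union_le _ _)
      rw [Finset.card_univ, Fintype.card_fin] at h1
      have : 0 < 2 ^ n := by positivity
      omega
    obtain ⟨i, h1, h2⟩ := hex
    refine ⟨(a, b), (hmem b).1 hb, i, i.2, ?_⟩
    rintro ⟨⟨a', b'⟩, hz', hne, he⟩
    obtain ⟨e1, e2⟩ := quad_inj.1 he
    by_cases haa : a' = a
    · subst haa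
      refine h2 ⟨b', (hmem b').2 hz', ?_, e2⟩
      rintro rfl
      exact hne rfl
    · exact h1 ⟨a', Finset.mem_image.2 ⟨_, hz', rfl⟩, haa, e1⟩

/-- The table indices used for a component of a pair of arrays. -/
def quadKey (hP : P.Ok) (t : ℕ → ℕ)
    (v : ((Fin (2 ^ P.ν) × Fin (2 ^ P.ν)) × Fin (2 ^ P.ν)) × Fin (2 ^ P.ν))
    (p : Fin P.D × Fin (P.Q + 1)) : Fin P.D × Fin (P.Q + 1) × Fin (2 ^ P.L) :=
  (p.1, p.2, ⟨P.idx p.2 (P.tripleHash t v.1 p.1) (P.chash t p.1 v.2),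
    idx_lt hP (Nat.lt_succ_iff.1 p.2.2) _ _⟩)

theorem quadKey_injective (hP : P.Ok) (t : ℕ → ℕ) (v) : (quadKey hP t v).Injective := by
  rintro ⟨j, g⟩ ⟨j', g'⟩ h
  simp only [quadKey, Prod.mk.injEq] at h
  rw [h.1, h.2.1]

open scoped Classical in
-- The point of `D = 128 G`: with `31G` for triples and `G` for characters, an element of the
-- product is shared for at most `4 * 31G + 2G = 126G` of the functions `j`. Some `j` yields a
-- private index, and `exists_table` then makes the lookups behave like a table indexed by the four
-- characters themselves.
theorem exists_table_quad (hP : P.Ok) (t : ℕ → ℕ) (ht : P.BaseGood t) {V : Type*}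
    [AddCommGroup V]
    (τ : ((Fin (2 ^ P.ν) × Fin (2 ^ P.ν)) × Fin (2 ^ P.ν)) × Fin (2 ^ P.ν) → V)
    (S : Finset (((Fin (2 ^ P.ν) × Fin (2 ^ P.ν)) × Fin (2 ^ P.ν)) × Fin (2 ^ P.ν)))
    (hc : S.card ≤ 2 ^ P.κ) :
    ∃ m : Fin P.D × Fin (P.Q + 1) × Fin (2 ^ P.L) → V,
      ∀ v ∈ S, ∑ p, m (quadKey hP t v p) = τ v := by
  obtain ⟨m, hm⟩ := exists_table (fun v => Finset.univ.image (quadKey hP t v)) (n₀ := 2 ^ P.κ) (by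
    intro S hS hc
    have hG := G_pos hP
    obtain ⟨z, hz, g, hg, h⟩ := ht.2.2.exists_unshared ht.1 (by omega) hP.le_Qβ hP.Qβ_lt S hS hc
    have hlt : (Finset.univ.filter fun j : Fin P.D =>
        Shared (fun z => (P.tripleHash t z.1 j % 2 ^ (g * P.β + P.x),
          P.chash t j z.2 % 2 ^ (P.κ + P.β + 1 - g * P.β + P.x))) S z).card < P.D := by
      have := hP.D_eq
      exact lt_of_le_of_lt h (by omega)
    have hex : ∃ j : Fin P.D, ¬ Shared (fun z => (P.tripleHash t z.1 j % 2 ^ (g * P.β + P.x),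
          P.chash t j z.2 % 2 ^ (P.κ + P.β + 1 - g * P.β + P.x))) S z := by
      by_contra hcon
      push Not at hcon
      rw [Finset.filter_true_of_mem (fun j _ => hcon j), Finset.card_univ, Fintype.card_fin] at hlt
      exact lt_irrefl _ hlt
    obtain ⟨j, hj⟩ := hex
    refine ⟨z, hz, quadKey hP t z (j, ⟨g, Nat.lt_succ_iff.2 hg⟩),
      Finset.mem_image_of_mem _ (Finset.mem_univ _), ?_⟩
    intro z' hz' hne hk
    obtain ⟨⟨j', g'⟩, _, h'⟩ := Finset.mem_image.1 hk
    simp only [quadKey, Prod.mk.injEq, Fin.mk.injEq] at h'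
    obtain ⟨rfl, rfl, hidx⟩ := h'
    exact hj ⟨z', hz', hne, (idx_inj hP hg).1 hidx⟩) τ S hc
  refine ⟨m, fun v hv => ?_⟩
  rw [← hm v hv, Finset.sum_image]
  intro p _ p' _ h
  exact quadKey_injective hP t v h

end Par

end WordRAM

/-! ### Few collisions of the arrays and of the output -/

namespace WordRAM

namespace Par
variable {P : Par} {Ω : Type*} [Fintype Ω] [AddCommGroup Ω] {tab : Ω → ℕ → ℕ}

theorem pow_lam_le {n : ℕ} (hn : n < P.lam) : 128 * 2 ^ n ≤ 2 ^ (6 + P.lam) := by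
  calc 128 * 2 ^ n = 2 ^ (7 + n) := by rw [pow_add]; norm_num
    _ ≤ _ := Nat.pow_le_pow_right (by norm_num) (by omega)

theorem testBit_node_succ (t : ℕ → ℕ) (n : ℕ) (z : Tree P.κ n × Tree P.κ n) (k b : ℕ) :
    (P.node t (n + 1) z k).testBit b = ∑ i : Fin (64 * 2 ^ n), ∑ j : Fin P.D,
      ∑ g : Fin (P.Q + 1), (t (P.row (64 * 2 ^ n + i) j g (P.idx g
        (P.tripleHash t (P.quad (P.node t n z.1) (P.node t n z.2) i).1 j)
        (P.chash t j (P.quad (P.node t n z.1) (P.node t n z.2) i).2)) + k)).testBit b := by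
  simp only [node, comb, testBit_xorSum]
  rfl

theorem quadKey_congr (hP : P.Ok) {t t' : ℕ → ℕ} (h : ∀ v < 3 * P.block, t v = t' v)
    (v) (p) : quadKey hP t v p = quadKey hP t' v p := by
  have hc : P.chash t p.1 v.2 = P.chash t' p.1 v.2 :=
    chash_congr (fun u hu => h u (hu.trans_le (Nat.le_mul_of_pos_left _ (by norm_num)))) p.1.2 v.2.2
  exact Prod.ext rfl (Prod.ext rfl (Fin.ext (congrArg₂ (P.idx p.2)
    (congrFun (congrFun (tripleHash_congr hP h) v.1) p.1) hc)))

open scoped Classical in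
/-- The arrays of words for the strings of `2^(n+1)` characters have few collisions. -/
theorem prob_node_le (hP : P.Ok) (hflip : Flippable tab P.size P.S) {n : ℕ} (hn : n < P.lam)
    {d l G : ℕ} (pos : Fin d → Fin l → ℕ × ℕ)
    (hinj : ∀ c b c' b', pos c b = pos c' b' → c = c' ∧ b = b')
    (hpos : ∀ c b, (pos c b).1 < P.R ∧ (pos c b).2 < P.S) (hl : P.κ ≤ l) {η : ℝ} (hη : η ≤ 1 / 2)
    (hle : (2 : ℝ) ^ (P.κ * 2 ^ (n + 1)) * 2 ^ d * ((2 ^ P.κ : ℝ) / 2 ^ l) ^ G ≤ η) :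
    prob (fun ω => (P.BaseGood (tab ω) ∧ (n = 0 ∨ P.LevelGood (tab ω) n)) ∧
      ∃ S : Finset (Tree P.κ (n + 1)), S.card ≤ 2 ^ P.κ ∧ G * S.card <
        ∑ c, coll (fun z => fun b : Fin l =>
          (P.node (tab ω) (n + 1) z (pos c b).1).testBit (pos c b).2) S) ≤ 2 * η := by
  set d₀ := 64 * 2 ^ n with hd₀
  have hpow : 0 < 2 ^ n := by positivity
  have h128 : d₀ + d₀ = 128 * 2 ^ n := by omega
  have hsize : ∀ i < d₀, (d₀ + i + 1) * P.block ≤ P.size := fun i hi =>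
    block_le_size (by have := pow_lam_le hn; omega)
  -- All table rows used for a pair: one for each component `i`, function `j` and split `g`.
  let key : Ω → Tree P.κ n × Tree P.κ n → Fin d₀ × Fin P.D × Fin (P.Q + 1) →
      Fin d₀ × Fin P.D × Fin (P.Q + 1) × Fin (2 ^ P.L) := fun ω z p =>
    (p.1, quadKey hP (tab ω) (P.quad (P.node (tab ω) n z.1) (P.node (tab ω) n z.2) p.1) p.2)
  have hkey : ∀ ω z, (key ω z).Injective := by
    rintro ω z ⟨i, p⟩ ⟨i', p'⟩ h
    simp only [key, Prod.mk.injEq] at h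
    obtain ⟨rfl, h⟩ := h
    rw [quadKey_injective hP _ _ h]
  have hagree : ∀ ω ω', (∀ v < P.size, v ∉ {v | d₀ * P.block ≤ v} → tab ω v = tab ω' v) →
      ∀ v < d₀ * P.block, tab ω v = tab ω' v := by
    intro ω ω' h v hv
    refine h v (hv.trans_le ((Nat.mul_le_mul_right _ (by omega)).trans (hsize 0 (by omega)))) ?_
    simpa using hv
  have hagree3 : ∀ ω ω', (∀ v < d₀ * P.block, tab ω v = tab ω' v) →
      ∀ v < 3 * P.block, tab ω v = tab ω' v := fun ω ω' h v hv =>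
    h v (hv.trans_le (Nat.mul_le_mul_right _ (by omega)))
  have hquad : ∀ ω ω', (∀ v < d₀ * P.block, tab ω v = tab ω' v) →
      ∀ (z : Tree P.κ n × Tree P.κ n) (i : Fin d₀),
      P.quad (P.node (tab ω) n z.1) (P.node (tab ω) n z.2) i =
        P.quad (P.node (tab ω') n z.1) (P.node (tab ω') n z.2) i := by
    intro ω ω' h z i
    exact quad_inj.2 ⟨comp_congr hP hn.le (node_congr hP n hn.le h z.1) i.2,
      comp_congr hP hn.le (node_congr hP n hn.le h z.2) i.2⟩
  have hfree : ∀ ω, P.BaseGood (tab ω) → ∀ S : Finset (Tree P.κ n × Tree P.κ n),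
      S.card ≤ 2 ^ P.κ → ∀ z ∈ S, ∀ i : Fin d₀,
      ¬ Shared (fun z : Tree P.κ n × Tree P.κ n =>
        P.quad (P.node (tab ω) n z.1) (P.node (tab ω) n z.2) i) S z →
      ∀ c : Fin d, Free (Fin l → Bool)
        (fun z (_ : Fin d) => Finset.univ.image (key ω z)) c z (S.erase z) := by
    intro ω hω S hS z hz i hi c u
    set E : Tree P.κ n × Tree P.κ n → _ := fun z =>
      P.quad (P.node (tab ω) n z.1) (P.node (tab ω) n z.2) i with hE
    -- Only the rows of the separating component `i` are changed, and so that the four characters of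
    -- `z` there receive `u` while the other occurring quadruples receive `0`.
    obtain ⟨m, hm⟩ := exists_table_quad hP (tab ω) hω (fun v => if v = E z then u else 0)
      (S.image E) (Finset.card_image_le.trans hS)
    have hsum : ∀ z', ∑ k ∈ Finset.univ.image (key ω z'), (if k.1 = i then m k.2 else 0) =
        ∑ p, m (quadKey hP (tab ω) (E z') p) := by
      intro z'
      rw [Finset.sum_image fun p _ p' _ h => hkey ω z' h, Fintype.sum_prod_type,
        Fintype.sum_eq_single i]
      · simp [key, hE]
      · intro i' hi'
        simp [key, hi']
    refine ⟨fun k => if k.1 = i then m k.2 else 0, ?_, ?_⟩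
    · rw [hsum, hm _ (Finset.mem_image_of_mem _ hz), if_pos rfl]
    · intro z' hz'
      simp only [Finset.coe_erase, Set.mem_sdiff, Finset.mem_coe, Set.mem_singleton_iff] at hz'
      rw [hsum, hm _ (Finset.mem_image_of_mem _ hz'.1), if_neg]
      intro he
      exact hi ⟨z', hz'.1, hz'.2, he⟩
  -- The positions `pos c b` within a row give each output component `c` its own bits and hence its
  -- own independent table over the same keys.
  have := prob_stage hflip (U := Tree P.κ n × Tree P.κ n) (C := Fin d)
    (Key := Fin d₀ × Fin P.D × Fin (P.Q + 1) × Fin (2 ^ P.L)) (l := l) {v | d₀ * P.block ≤ v}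
    (fun c k b => (P.row (d₀ + k.1) k.2.1 k.2.2.1 k.2.2.2 + (pos c b).1, (pos c b).2))
    (by
      intro c k b c' k' b' h
      rw [Prod.mk.injEq] at h
      obtain ⟨h1, h2⟩ := h
      obtain ⟨e1, e2, e3, e4, e5⟩ := row_inj k.2.1.2 (k.2.2.1.2.trans_le hP.Q_lt) k.2.2.2.2
        (hpos c b).1 k'.2.1.2 (k'.2.2.1.2.trans_le hP.Q_lt) k'.2.2.2.2 (hpos c' b').1 h1
      obtain ⟨e6, e7⟩ := hinj c b c' b' (Prod.ext e5 h2)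
      exact ⟨e6, Prod.ext (Fin.ext (by omega)) (Prod.ext (Fin.ext e2)
        (Prod.ext (Fin.ext e3) (Fin.ext e4))), e7⟩)
    (by
      intro c k b
      refine ⟨lt_of_lt_of_le (row_lt k.2.1.2 (k.2.2.1.2.trans_le hP.Q_lt) k.2.2.2.2 (hpos c b).1)
        (hsize k.1 k.1.2), ?_, (hpos c b).2⟩
      change d₀ * P.block ≤ _
      exact (Nat.mul_le_mul_right _ (Nat.le_add_right _ _)).trans (le_row.trans
        (Nat.le_add_right _ _)))
    (fun ω => P.BaseGood (tab ω) ∧ (n = 0 ∨ P.LevelGood (tab ω) n))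
    (fun ω z _ => Finset.univ.image (key ω z))
    (by
      rintro ω ω' h ⟨h1, h2⟩
      have ha := hagree ω ω' h
      refine ⟨baseGood_congr hP (hagree3 ω ω' ha) h1, h2.imp id fun h2 S hS => ?_⟩
      have : ∀ z : Tree P.κ n, ∀ i : Fin (64 * 2 ^ n), P.comp (P.node (tab ω') n z) i =
          P.comp (P.node (tab ω) n z) i := fun z i =>
        (comp_congr hP hn.le (node_congr hP n hn.le ha z) i.2).symm
      simp only [this]
      exact h2 S hS)
    (by
      intro ω ω' h
      have ha := hagree ω ω' h
      have ha3 := hagree3 ω ω' ha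
      funext z _
      have hkz : key ω z = key ω' z := by
        funext p
        exact Prod.ext rfl ((congrArg (fun v => quadKey hP (tab ω) v p.2)
          (hquad ω ω' ha z p.1)).trans (quadKey_congr hP ha3 _ _))
      exact congrArg (fun f => Finset.univ.image f) hkz)
    (n₀ := 2 ^ P.κ) (F := 0) (G := G)
    (by
      rintro ω ⟨hω1, hω2⟩ S hS hc
      -- One separating component makes `z` free for every output component at once, so `F = 0`.
      obtain ⟨z, hz, i, hi, hsh⟩ := exists_unshared_quad (tab ω) n hω2 S hS hc
      refine ⟨z, hz, ?_⟩
      rw [Nat.le_zero, Finset.card_eq_zero, Finset.filter_eq_empty_iff]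
      intro c _
      rw [not_not]
      convert hfree ω hω1 S hc z hz ⟨i, hi⟩ hsh c)
    (Nat.pow_le_pow_right (by norm_num) hl) hη
    (by
      have : Fintype.card (Tree P.κ n × Tree P.κ n) = 2 ^ (P.κ * 2 ^ (n + 1)) := card_tree P.κ (n + 1)
      rw [this, Fintype.card_fin]
      push_cast
      exact hle)
  refine (prob_mono ?_).trans this
  rintro ω ⟨h1, S, h2, h3⟩
  refine ⟨h1, S, h2, ?_⟩
  rw [zero_add]
  refine h3.trans_eq (Finset.sum_congr rfl fun c _ => ?_)
  congr 1
  funext z b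
  refine (testBit_node_succ (tab ω) n z _ _).trans ?_
  rw [Finset.sum_image fun p _ p' _ h => hkey ω z h, Fintype.sum_prod_type]
  refine Finset.sum_congr rfl fun i _ => ?_
  rw [Fintype.sum_prod_type]
  rfl

/-- The position of a bit of a component in the array of words. -/
def compPos (P : Par) (c b : ℕ) : ℕ × ℕ :=
  if b < P.ν then ((2 * c) / 2 ^ P.e, (2 * c) % 2 ^ P.e * 2 ^ P.lν + b)
  else ((2 * c + 1) / 2 ^ P.e, (2 * c + 1) % 2 ^ P.e * 2 ^ P.lν + (b - P.ν))

theorem charPos_inj (hP : P.Ok) {c b c' b' : ℕ} (hb : b < P.ν) (hb' : b' < P.ν)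
    (h : (c / 2 ^ P.e, c % 2 ^ P.e * 2 ^ P.lν + b) =
      (c' / 2 ^ P.e, c' % 2 ^ P.e * 2 ^ P.lν + b')) : c = c' ∧ b = b' := by
  rw [Prod.mk.injEq] at h
  obtain ⟨h1, h2⟩ := Nat.mul_add_inj_of_lt (hb.trans_le hP.ν_le) (hb'.trans_le hP.ν_le) h.2
  refine ⟨?_, h2⟩
  rw [← Nat.div_add_mod c (2 ^ P.e), ← Nat.div_add_mod c' (2 ^ P.e), h.1, h1]

theorem compPos_inj (hP : P.Ok) {c b c' b' : ℕ} (hb : b < 2 * P.ν) (hb' : b' < 2 * P.ν)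
    (h : P.compPos c b = P.compPos c' b') : c = c' ∧ b = b' := by
  unfold compPos at h
  split_ifs at h with h1 h2 h2
  · obtain ⟨h3, h4⟩ := charPos_inj hP h1 h2 h
    omega
  · obtain ⟨h3, h4⟩ := charPos_inj hP h1 (by omega) h
    omega
  · obtain ⟨h3, h4⟩ := charPos_inj hP (by omega) h2 h
    omega
  · obtain ⟨h3, h4⟩ := charPos_inj hP (by omega) (by omega) h
    omega

theorem charPos_lt (hP : P.Ok) {c b : ℕ} (hb : b < P.ν) :
    c % 2 ^ P.e * 2 ^ P.lν + b < P.S := by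
  refine lt_of_lt_of_le ?_ hP.char_le
  have : c % 2 ^ P.e ≤ 2 ^ P.e - 1 := Nat.le_sub_one_of_lt (Nat.mod_lt _ (by positivity))
  have := Nat.mul_le_mul_right (2 ^ P.lν) this
  unfold ν at hb
  omega

theorem compPos_lt (hP : P.Ok) {n c b : ℕ} (hn : n ≤ P.lam) (hc : c < 64 * 2 ^ n)
    (hb : b < 2 * P.ν) : (P.compPos c b).1 < P.R ∧ (P.compPos c b).2 < P.S := by
  unfold compPos
  split_ifs with h1
  · exact ⟨char_div_lt hP hn (by omega), charPos_lt hP h1⟩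
  · exact ⟨char_div_lt hP hn (by omega), charPos_lt hP (by omega)⟩

theorem testBit_char (a : ℕ → ℕ) (c b : ℕ) (hb : b < P.ν) : (P.char a c).testBit b =
    (a (c / 2 ^ P.e)).testBit (c % 2 ^ P.e * 2 ^ P.lν + b) := by
  rw [char, Nat.testBit_mod_two_pow, Nat.testBit_div_two_pow, add_comm]
  simp [hb]

theorem char_eq_iff (a a' : ℕ → ℕ) (c : ℕ) : P.char a c = P.char a' c ↔
    ∀ b < P.ν, (P.char a c).testBit b = (P.char a' c).testBit b := by
  constructor
  · intro h b _
    rw [h]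
  · intro h
    apply Nat.eq_of_testBit_eq
    intro b
    by_cases hb : b < P.ν
    · exact h b hb
    · unfold char
      rw [Nat.testBit_mod_two_pow, Nat.testBit_mod_two_pow]
      simp [hb]

theorem comp_eq_iff (a a' : ℕ → ℕ) (c : ℕ) : P.comp a c = P.comp a' c ↔
    (fun b : Fin (2 * P.ν) => (a (P.compPos c b).1).testBit (P.compPos c b).2) =
      fun b : Fin (2 * P.ν) => (a' (P.compPos c b).1).testBit (P.compPos c b).2 := by
  have hc : P.comp a c = P.comp a' c ↔ P.char a (2 * c) = P.char a' (2 * c) ∧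
      P.char a (2 * c + 1) = P.char a' (2 * c + 1) := by
    unfold comp
    rw [Prod.mk.injEq, Fin.ext_iff, Fin.ext_iff]
    rfl
  rw [hc, char_eq_iff a a', char_eq_iff a a']
  constructor
  · rintro ⟨h1, h2⟩
    funext b
    unfold compPos
    split_ifs with h
    · have := h1 b h
      rwa [testBit_char _ _ _ h, testBit_char _ _ _ h] at this
    · have hb : (b : ℕ) - P.ν < P.ν := by omega
      have := h2 (b - P.ν) hb
      rwa [testBit_char _ _ _ hb, testBit_char _ _ _ hb] at this
  · intro h
    constructor
    · intro b hb
      have := congrFun h ⟨b, by omega⟩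
      rw [testBit_char _ _ _ hb, testBit_char _ _ _ hb]
      simpa [compPos, hb] using this
    · intro b hb
      have := congrFun h ⟨b + P.ν, by omega⟩
      rw [testBit_char _ _ _ hb, testBit_char _ _ _ hb]
      simpa [compPos, hb] using this

/-- There are `2^(κ * 2^(n+1))` strings and `2^d` sets of components, and a coincidence has
probability at most `2^-(l-κ)`. The surplus `n` in the exponent makes the failure probabilities of
the levels summable. -/
theorem level_bound {κ n d l G : ℕ} (hl : κ ≤ l)
    (h : κ * 2 ^ (n + 1) + d + (3 * κ + 100 + n) ≤ (l - κ) * G) :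
    (2 : ℝ) ^ (κ * 2 ^ (n + 1)) * 2 ^ d * ((2 ^ κ : ℝ) / 2 ^ l) ^ G ≤
      (1 / 2) ^ (3 * κ + 100 + n) := by
  have h1 : (2 ^ κ : ℝ) / 2 ^ l = (1 / 2) ^ (l - κ) := by
    rw [div_eq_iff (by positivity), one_div, inv_pow, ← div_eq_inv_mul, eq_div_iff (by positivity),
      ← pow_add, Nat.add_sub_cancel' hl]
  rw [h1, ← pow_add, ← pow_mul]
  calc (2 : ℝ) ^ (κ * 2 ^ (n + 1) + d) * (1 / 2) ^ ((l - κ) * G)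
      ≤ 2 ^ (κ * 2 ^ (n + 1) + d) * (1 / 2) ^ (κ * 2 ^ (n + 1) + d + (3 * κ + 100 + n)) := by
        refine mul_le_mul_of_nonneg_left ?_ (by positivity)
        exact pow_le_pow_of_le_one (by norm_num) (by norm_num) h
    _ = _ := by
        rw [pow_add (1 / 2 : ℝ), ← mul_assoc, ← mul_pow]
        norm_num

theorem half_pow_le_half {m : ℕ} (hm : 1 ≤ m) : ((1 : ℝ) / 2) ^ m ≤ 1 / 2 := by
  calc ((1 : ℝ) / 2) ^ m ≤ (1 / 2) ^ 1 := pow_le_pow_of_le_one (by norm_num) (by norm_num) hm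
    _ = 1 / 2 := pow_one _

theorem prob_levelGood_succ (hP : P.Ok) (hflip : Flippable tab P.size P.S) {n : ℕ}
    (hn : n < P.lam) :
    prob (fun ω => (P.BaseGood (tab ω) ∧ (n = 0 ∨ P.LevelGood (tab ω) n)) ∧
      ¬ P.LevelGood (tab ω) (n + 1)) ≤ 2 * (1 / 2) ^ (3 * P.κ + 100 + n) := by
  classical
  have hpow : n + 1 ≤ 2 ^ n := Nat.lt_two_pow_self
  have := prob_node_le hP hflip hn (d := 64 * 2 ^ (n + 1)) (l := 2 * P.ν) (G := 8 * 2 ^ (n + 1))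
    (fun c b => P.compPos c b)
    (by
      intro c b c' b' h
      obtain ⟨h1, h2⟩ := compPos_inj hP b.2 b'.2 h
      exact ⟨Fin.ext h1, Fin.ext h2⟩)
    (fun c b => compPos_lt hP hn c.2 b.2) (by unfold ν; omega)
    (η := (1 / 2) ^ (3 * P.κ + 100 + n)) (half_pow_le_half (by omega))
    (level_bound (by unfold ν; omega) (by
      -- A coincidence costs `κ + 26` bits, and `8 * 2^(n+1)` of them outweigh the `κ * 2^(n+1)`
      -- bits of a string and the `64 * 2^(n+1)` bits of a set of components.
      have h1 : 2 * P.ν - P.κ = P.κ + 26 := by unfold ν; omega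
      rw [h1, pow_succ]
      nlinarith [Nat.zero_le (P.κ * 2 ^ n), Nat.mul_le_mul_left P.κ hpow]))
  refine (prob_mono ?_).trans this
  rintro ω ⟨h1, h2⟩
  refine ⟨h1, ?_⟩
  unfold LevelGood at h2
  push Not at h2
  obtain ⟨S, h3, h4⟩ := h2
  refine ⟨S, h3, h4.trans_eq (Finset.sum_congr rfl fun c _ => ?_)⟩
  exact coll_congr S fun z z' => comp_eq_iff _ _ _

/-- The position of a bit of the output. -/
def outPos (P : Par) (c b : ℕ) : ℕ × ℕ :=
  ((c * (2 * P.κ + 26) + b) / P.w, (c * (2 * P.κ + 26) + b) % P.w)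

/-- Consecutive bits of the output must lie in consecutive entries. Either a row is a single entry,
and the whole output lies in it, or every entry fills a word. -/
theorem outPos_lt (hP : P.Ok) {c b : ℕ} (hc : c < 48 * 2 ^ P.lam) (hb : b < 2 * P.κ + 26) :
    (P.outPos c b).1 < P.R ∧ (P.outPos c b).2 < P.S := by
  have h1 : c * (2 * P.κ + 26) + b < P.R * P.S := by
    refine lt_of_lt_of_le (Nat.mul_add_lt_mul hc hb) (le_trans (le_of_eq ?_) hP.out_le)
    ring
  unfold outPos
  rcases hP.S_eq with h | h
  · have hR : P.R = 1 := by simp [R, h]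
    rw [hR, one_mul] at h1
    have hSw : P.S ≤ P.w := by
      rcases hP.layout with h' | h'
      · exact h'.2.le
      · rw [h'.1]
        exact le_trans (Nat.pow_le_pow_right (by norm_num) (by omega)) h'.2
    rw [hR]
    simp only
    rw [Nat.div_eq_of_lt (by omega), Nat.mod_eq_of_lt (by omega)]
    exact ⟨by norm_num, h1⟩
  · rw [h] at h1
    have hw : 0 < P.w := by
      by_contra hcon
      have : P.w = 0 := by omega
      rw [this] at h1
      omega
    rw [h]
    exact ⟨(Nat.div_lt_iff_lt_mul hw).2 h1, Nat.mod_lt _ hw⟩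

theorem outPos_inj {c b c' b' : ℕ} (hb : b < 2 * P.κ + 26)
    (hb' : b' < 2 * P.κ + 26) (h : P.outPos c b = P.outPos c' b') : c = c' ∧ b = b' := by
  simp only [outPos, Prod.mk.injEq] at h
  apply Nat.mul_add_inj_of_lt hb hb'
  rw [← Nat.div_add_mod (c * (2 * P.κ + 26) + b) P.w, h.1, h.2, Nat.div_add_mod]

/-- The output for a string. -/
def out (P : Par) (t : ℕ → ℕ) (z : Tree P.κ P.lam) : BitStrings (2 * P.κ + 26) (48 * 2 ^ P.lam) :=
  fun c b => (P.node t P.lam z (P.outPos c b).1).testBit (P.outPos c b).2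

/-- The outputs have few collisions. -/
def OutGood (P : Par) (t : ℕ → ℕ) : Prop :=
  ∀ S : Finset (Tree P.κ P.lam), S.card ≤ 2 ^ P.κ →
    ∑ c, coll (fun z => P.out t z c) S ≤ 6 * 2 ^ P.lam * S.card

/-- The root array is read without gaps, as a packed bit string and not as spaced characters. The
collision count is therefore repeated for the output positions, with `48` and `6` in place of `64`
and `8`. -/
theorem prob_out_le (hP : P.Ok) (hflip : Flippable tab P.size P.S) {n : ℕ} (hn : P.lam = n + 1) :
    prob (fun ω => (P.BaseGood (tab ω) ∧ (n = 0 ∨ P.LevelGood (tab ω) n)) ∧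
      ¬ P.OutGood (tab ω)) ≤ 2 * (1 / 2) ^ (3 * P.κ + 100 + n) := by
  classical
  have hpow : n + 1 ≤ 2 ^ n := Nat.lt_two_pow_self
  have := prob_node_le hP hflip (n := n) (by omega) (d := 48 * 2 ^ (n + 1)) (l := 2 * P.κ + 26)
    (G := 6 * 2 ^ (n + 1)) (fun c b => P.outPos c b)
    (by
      intro c b c' b' h
      obtain ⟨h1, h2⟩ := outPos_inj b.2 b'.2 h
      exact ⟨Fin.ext h1, Fin.ext h2⟩)
    (fun c b => outPos_lt hP (by rw [hn]; exact c.2) b.2) (by omega)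
    (η := (1 / 2) ^ (3 * P.κ + 100 + n)) (half_pow_le_half (by omega))
    (level_bound (by omega) (by
      have h1 : 2 * P.κ + 26 - P.κ = P.κ + 26 := by omega
      rw [h1, pow_succ]
      nlinarith [Nat.zero_le (P.κ * 2 ^ n), Nat.mul_le_mul_left P.κ hpow]))
  refine (prob_mono ?_).trans this
  rintro ω ⟨h1, h2⟩
  refine ⟨h1, ?_⟩
  unfold OutGood out at h2
  push Not at h2
  rw [hn] at h2
  exact h2

/-- The summand `4 - 4 / 2^n` is the partial sum of the geometric series of the failure
probabilities of the single levels. -/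
theorem prob_not_levels_le (hP : P.Ok) (hflip : Flippable tab P.size P.S) : ∀ n < P.lam,
    prob (fun ω => ¬ (P.BaseGood (tab ω) ∧ (n = 0 ∨ P.LevelGood (tab ω) n))) ≤
      3 * ((P.κ + P.β + 2) * (2 * (1 / 2) ^ (3 * P.κ + 100))) +
        (4 - 4 * (1 / 2) ^ n) * (1 / 2) ^ (3 * P.κ + 100)
  | 0, _ => by
    simpa using prob_not_baseGood_le hP hflip
  | n + 1, hn => by
    have ih := prob_not_levels_le hP hflip n (by omega)
    have h1 := prob_levelGood_succ hP hflip (n := n) (by omega)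
    have hsplit : ∀ ω, ¬ (P.BaseGood (tab ω) ∧ (n + 1 = 0 ∨ P.LevelGood (tab ω) (n + 1))) →
        (¬ (P.BaseGood (tab ω) ∧ (n = 0 ∨ P.LevelGood (tab ω) n))) ∨
        ((P.BaseGood (tab ω) ∧ (n = 0 ∨ P.LevelGood (tab ω) n)) ∧
          ¬ P.LevelGood (tab ω) (n + 1)) := by
      intro ω h
      tauto
    refine (prob_mono hsplit).trans ((prob_or_le _ _).trans ?_)
    rw [pow_add (1 / 2 : ℝ) (3 * P.κ + 100) n] at h1
    rw [pow_succ (1 / 2 : ℝ) n]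
    linarith

/-- The number of stages is linear in `κ`, so the total is at most `2^(κ+100)` times the basic
failure probability `2^-(3κ+100)`. -/
theorem prob_not_outGood_le (hP : P.Ok) (hflip : Flippable tab P.size P.S) :
    prob (fun ω => ¬ P.OutGood (tab ω)) ≤ (1 / 2) ^ (2 * P.κ) := by
  obtain ⟨n, hn⟩ : ∃ n, P.lam = n + 1 := ⟨P.lam - 1, by have := hP.lam_pos; omega⟩
  have h1 := prob_not_levels_le hP hflip n (by omega)
  have h2 := prob_out_le hP hflip hn
  have hsplit : ∀ ω, ¬ P.OutGood (tab ω) →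
      (¬ (P.BaseGood (tab ω) ∧ (n = 0 ∨ P.LevelGood (tab ω) n))) ∨
      ((P.BaseGood (tab ω) ∧ (n = 0 ∨ P.LevelGood (tab ω) n)) ∧ ¬ P.OutGood (tab ω)) := by
    intro ω h
    tauto
  refine (prob_mono hsplit).trans ((prob_or_le _ _).trans ?_)
  rw [pow_add (1 / 2 : ℝ) (3 * P.κ + 100) n] at h2
  have h0 : (0 : ℝ) < (1 / 2) ^ n := by positivity
  set q : ℝ := (1 / 2) ^ (3 * P.κ + 100) with hq
  have hq0 : 0 < q := by positivity
  have hκ : ((P.κ : ℝ) + 1) ≤ 2 ^ P.κ := by exact_mod_cast Nat.lt_two_pow_self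
  have hβ : (P.β : ℝ) ≤ P.κ + 1 := by exact_mod_cast hP.β_le
  have hqe : q * 2 ^ P.κ * 2 ^ 100 = (1 / 2) ^ (2 * P.κ) := by
    have h3 : 3 * P.κ + 100 = 2 * P.κ + (P.κ + 100) := by ring
    rw [hq, h3, pow_add (1 / 2 : ℝ), mul_assoc, mul_assoc, ← pow_add 2 P.κ, ← mul_pow]
    norm_num
  have h5 : q * (P.κ + 1) ≤ q * 2 ^ P.κ := by gcongr
  have h6 : q * P.β ≤ q * (P.κ + 1) := by gcongr
  have h7 : 0 < q * 2 ^ P.κ := by positivity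
  nlinarith [mul_pos hq0 h0]

/-- Averaging gives an input that shares at most `12 * 2^lam` of its `48 * 2^lam` outputs; any other
output is a neighbour of its own. -/
theorem OutGood.isKUnique {t : ℕ → ℕ} (h : P.OutGood t) {n c : ℕ}
    (f : BitStrings n c → Tree P.κ P.lam) (hf : f.Injective) :
    IsKUnique (2 ^ P.κ) fun x => P.out t (f x) := by
  classical
  intro S hS hc
  have hcard : (S.image f).card = S.card := Finset.card_image_of_injective _ hf
  obtain ⟨z, hz, hle⟩ := exists_shared_le (fun z c => P.out t z c) (S.image f) (hS.image f)
    (h (S.image f) (by omega))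
  have hex : ∃ i : Fin (48 * 2 ^ P.lam), ¬ Shared (fun z => P.out t z i) (S.image f) z := by
    by_contra hcon
    push Not at hcon
    rw [Finset.filter_true_of_mem (fun j _ => hcon j), Finset.card_univ, Fintype.card_fin] at hle
    have : 0 < 2 ^ P.lam := by positivity
    omega
  obtain ⟨i, hi⟩ := hex
  obtain ⟨x, hx, rfl⟩ := Finset.mem_image.1 hz
  refine ⟨x, hx, Finset.card_pos.2 ⟨(i, P.out t (f x) i), ?_⟩⟩
  rw [Finset.mem_sdiff]
  constructor
  · simp [outputs]
  · intro hmem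
    simp only [outputs, Finset.mem_biUnion, Finset.mem_sdiff, Finset.mem_singleton,
      Finset.mem_image, Finset.mem_univ, true_and, Prod.mk.injEq] at hmem
    obtain ⟨y, ⟨hy, hne⟩, j, rfl, hj⟩ := hmem
    exact hi ⟨f y, Finset.mem_image_of_mem _ hy, fun e => hne (hf e), hj⟩

end Par

end WordRAM

/-! ### Evaluation rules for expressions -/

namespace WordRAM

namespace Expr

instance : Add Expr := ⟨bin .add⟩
instance : Sub Expr := ⟨bin .sub⟩
instance : AndOp Expr := ⟨bin .and⟩
instance : OrOp Expr := ⟨bin .or⟩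
instance : XorOp Expr := ⟨bin .xor⟩
instance : ShiftLeft Expr := ⟨bin .shl⟩
instance : ShiftRight Expr := ⟨bin .shr⟩
instance (n : ℕ) : OfNat Expr n := ⟨lit n⟩

/-- The content of a register. -/
abbrev rg (r : ℕ) : Expr := reg r

/-- The expression for `a % 2^n`. -/
def mask (a n : Expr) : Expr := a &&& ((1 <<< n) - 1)

/-- The expression `e` can be evaluated, and its value is `v`. -/
def Has (w N : ℕ) (σ : St) (e : Expr) (v : ℕ) : Prop := e.ok w N σ ∧ e.val w σ = v

namespace Has
variable {w N : ℕ} {σ : St} {a b : Expr} {x y : ℕ}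

theorem lit {n : ℕ} (h : (OfNat.ofNat n : ℕ) < 2 ^ w) : Has w N σ (OfNat.ofNat n) (OfNat.ofNat n : ℕ) :=
  ⟨h, rfl⟩
theorem reg {r : ℕ} (hr : r < 64) (h : σ.r r = x) : Has w N σ (rg r) x := ⟨hr, h⟩
theorem ones : Has w N σ .ones (2 ^ w - 1) := ⟨trivial, rfl⟩
theorem eq (ha : Has w N σ a x) (h : x = y) : Has w N σ a y := h ▸ ha

theorem bin {o : Op} (ha : Has w N σ a x) (hb : Has w N σ b y) (h : o.ok w x y) :
    Has w N σ (.bin o a b) (o.evalNat w x y) := by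
  obtain ⟨ha, rfl⟩ := ha
  obtain ⟨hb, rfl⟩ := hb
  exact ⟨⟨ha, hb, h⟩, rfl⟩

theorem add (ha : Has w N σ a x) (hb : Has w N σ b y) (h : x + y < 2 ^ w) :
    Has w N σ (a + b) (x + y) := ha.bin (o := .add) hb h
theorem sub (ha : Has w N σ a x) (hb : Has w N σ b y) (h : y ≤ x) :
    Has w N σ (a - b) (x - y) := ha.bin (o := .sub) hb h
theorem and (ha : Has w N σ a x) (hb : Has w N σ b y) : Has w N σ (a &&& b) (x &&& y) :=
  ha.bin (o := .and) hb trivial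
theorem or (ha : Has w N σ a x) (hb : Has w N σ b y) : Has w N σ (a ||| b) (x ||| y) :=
  ha.bin (o := .or) hb trivial
theorem xor (ha : Has w N σ a x) (hb : Has w N σ b y) : Has w N σ (a ^^^ b) (x ^^^ y) :=
  ha.bin (o := .xor) hb trivial
theorem shl_mod (ha : Has w N σ a x) (hb : Has w N σ b y) :
    Has w N σ (a <<< b) (x * 2 ^ y % 2 ^ w) := ha.bin (o := .shl) hb trivial
theorem shl (ha : Has w N σ a x) (hb : Has w N σ b y) (h : x * 2 ^ y < 2 ^ w) :
    Has w N σ (a <<< b) (x * 2 ^ y) := (ha.shl_mod hb).eq (Nat.mod_eq_of_lt h)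
theorem shr (ha : Has w N σ a x) (hb : Has w N σ b y) : Has w N σ (a >>> b) (x / 2 ^ y) :=
  ha.bin (o := .shr) hb trivial
theorem lt (ha : Has w N σ a x) (hb : Has w N σ b y) :
    Has w N σ (.bin .lt a b) (if x < y then 1 else 0) := ha.bin (o := .lt) hb trivial

theorem load (ha : Has w N σ a x) (h : x < N) : Has w N σ (.load a) (σ.m x) := by
  obtain ⟨ha, rfl⟩ := ha
  exact ⟨⟨ha, h⟩, rfl⟩

theorem pow_two (hw : 0 < w) (hb : Has w N σ b y) (h : y < w) :
    Has w N σ (1 <<< b) (2 ^ y) :=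
  ((lit (Nat.one_lt_two_pow hw.ne')).shl hb
    (by rw [one_mul]; exact Nat.pow_lt_pow_right (by norm_num) h)).eq (one_mul _)

theorem mask (ha : Has w N σ a x) (hb : Has w N σ b y) (h : y < w) :
    Has w N σ (mask a b) (x % 2 ^ y) :=
  (ha.and ((pow_two (by omega) hb h).sub (lit (Nat.one_lt_two_pow (by omega)))
    Nat.one_le_two_pow)).eq (Nat.and_two_pow_sub_one_eq_mod _ _)

end Has

end Expr

open WordRAM.Expr

section
variable {w N : ℕ} [NeZero w] {σ : St} {Q : St → Prop} {e a : Expr} {v u d T : ℕ} {q : Prog}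

theorem Ht.assign_has (hd : d < 64) (h : Has w N σ e v) (hQ : Q (σ.set d v)) :
    Ht w N (WordRAM.assign d e) σ (e.cost + 1) Q := by
  obtain ⟨h, rfl⟩ := h
  exact Ht.assign hd h hQ

theorem Ht.assign_seq_has (hd : d < 64) (h : Has w N σ e v) (hQ : Ht w N q (σ.set d v) T Q) :
    Ht w N (.seq (WordRAM.assign d e) q) σ (e.cost + 1 + T) Q := by
  obtain ⟨h, rfl⟩ := h
  exact Ht.assign_seq hd h hQ

theorem Ht.write_has (ha : Has w N σ a u) (h : Has w N σ e v) (hN : u < N)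
    (hQ : Q (σ.put u v)) : Ht w N (WordRAM.write a e) σ (a.cost + e.cost + 1) Q := by
  obtain ⟨h, rfl⟩ := h
  obtain ⟨ha, rfl⟩ := ha
  exact Ht.write ha h hN hQ

end

/-- Two states agree on the registers below `n`. -/
def St.Same (n : ℕ) (σ σ' : St) : Prop := ∀ r < n, σ'.r r = σ.r r

namespace St.Same
variable {n n' : ℕ} {σ σ' σ'' : St}

theorem refl : σ.Same n σ := fun _ _ => rfl
theorem trans (h : σ.Same n σ') (h' : σ'.Same n σ'') : σ.Same n σ'' :=
  fun r hr => (h' r hr).trans (h r hr)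
theorem mono (h : σ.Same n σ') (hn : n' ≤ n) : σ.Same n' σ' := fun r hr => h r (by omega)
theorem set {d v : ℕ} (h : σ.Same n σ') (hd : n ≤ d) : σ.Same n (σ'.set d v) := by
  intro r hr
  rw [St.set_r, if_neg (by omega)]
  exact h r hr
theorem agree {i : ℕ} (h : σ.Same n σ') (hi : n ≤ i) (ha : σ'.Agree i σ'') : σ.Same n σ'' :=
  fun r hr => (ha.1 r (by omega)).trans (h r hr)

end St.Same

/-! ### Memory layout and access to the virtual table -/

namespace Par
variable (P : Par)

/-- The number of memory cells. -/
def N : ℕ := 20 + 4 * P.words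

/-- The address of the input and of the output. -/
def B : ℕ := 16 + P.words

/-- The number of entries that fit into the memory. -/
def src : ℕ := (P.words + P.R + 1) * 2 ^ P.sr

/-- The entry of the virtual table with a given index. -/
def vget (m : ℕ → ℕ) (v : ℕ) : ℕ :=
  m (16 + v / 2 ^ P.sr) / 2 ^ (v % 2 ^ P.sr * 2 ^ (P.lν + P.e)) % 2 ^ P.S

/-- The parameters of the evaluation program. -/
def param : ℕ → ℕ
  | 0 => P.B
  | 1 => P.lam
  | 2 => P.κ
  | 3 => P.w
  | 4 => P.lD
  | 5 => P.β
  | 6 => P.Q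
  | 7 => P.sr
  | 8 => P.lν + P.e
  | 9 => 2 ^ P.S - 1
  | 10 => P.e
  | 11 => P.lν
  | 12 => P.lR
  | 13 => P.src
  | 14 => P.src + 2 ^ P.lam * P.R
  | 15 => P.L
  | _ => 0

/-- The first registers contain the parameters, and the table is `t`. -/
structure Env (t : ℕ → ℕ) (σ : St) : Prop where
  reg : ∀ r < 16, σ.r r = P.param r
  tab : ∀ v < P.size, P.vget σ.m v = t v

/-- An update of one entry of the virtual table. -/
def Upd (v y : ℕ) (m m' : ℕ → ℕ) : Prop :=
  (∀ v', P.vget m' v' = if v' = v then y else P.vget m v') ∧ ∀ a ≠ 16 + v / 2 ^ P.sr, m' a = m a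

variable {P} {t : ℕ → ℕ} {σ σ' : St}

/-- If entries are packed and yet `S = w`, then `2^(sr + lν + e) ≤ 2^(lν + e)` forces `sr = 0`. So
packed entries occur only with rows of a single entry. -/
theorem Ok.layout' (hP : P.Ok) : (P.sr = 0 ∧ P.S = P.w) ∨ (P.lR = 0 ∧ P.S = 2 ^ (P.lν + P.e) ∧
    2 ^ P.sr * 2 ^ (P.lν + P.e) ≤ P.w) := by
  rcases hP.layout with h | ⟨h1, h2⟩
  · exact .inl h
  · rcases hP.S_eq with h | h
    · exact .inr ⟨h, h1, by rwa [← pow_add]⟩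
    · left
      refine ⟨?_, h⟩
      rw [← h, h1] at h2
      have := (Nat.pow_le_pow_iff_right (by norm_num : 1 < 2)).1 h2
      omega

/-- The bits of an entry of the virtual table are in one word. -/
theorem off_add_le (hP : P.Ok) (v : ℕ) : v % 2 ^ P.sr * 2 ^ (P.lν + P.e) + P.S ≤ P.w := by
  rcases hP.layout' with ⟨h1, h2⟩ | ⟨-, h2, h3⟩
  · simp [h1, h2, Nat.mod_one]
  · have h4 : v % 2 ^ P.sr + 1 ≤ 2 ^ P.sr := Nat.mod_lt _ (by positivity)
    calc _ = (v % 2 ^ P.sr + 1) * 2 ^ (P.lν + P.e) := by rw [h2]; ring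
      _ ≤ _ := (Nat.mul_le_mul_right _ h4).trans h3

theorem S_le (hP : P.Ok) : P.S ≤ P.w := by
  have := off_add_le hP 0
  omega

theorem lt_w (hP : P.Ok) : P.L ≤ P.w ∧ 500 < P.L :=
  ⟨hP.L_le.trans (S_le hP), by unfold L; omega⟩

theorem lit_lt (hP : P.Ok) {n : ℕ} (hn : n ≤ 500) : n < 2 ^ P.w := by
  have := lt_w hP
  exact lt_trans (by omega) Nat.lt_two_pow_self

theorem sr_lt (hP : P.Ok) : P.sr < P.w := by
  have hw := lt_w hP
  rcases hP.layout' with ⟨h1, h2⟩ | ⟨-, h2, h3⟩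
  · omega
  · have h4 : 0 < 2 ^ (P.lν + P.e) := by positivity
    exact (Nat.lt_two_pow_self (n := P.sr)).trans_le ((Nat.le_mul_of_pos_right _ h4).trans h3)

theorem e_lt (hP : P.Ok) : P.e < P.w := by
  have h1 := hP.char_le
  have h2 := S_le hP
  have h3 : 2 ^ P.e - 1 ≤ (2 ^ P.e - 1) * 2 ^ P.lν := Nat.le_mul_of_pos_right _ (by positivity)
  have h4 : P.e < 2 ^ P.e := Nat.lt_two_pow_self
  omega

theorem pow_lam_mul_R_le (P : Par) : 2 ^ (6 + P.lam) * P.R ≤ P.size := by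
  unfold size block
  refine Nat.mul_le_mul_left _ (Nat.le_mul_of_pos_left _ ?_)
  have := P.D_pos
  positivity

theorem R_le_words (hP : P.Ok) : P.R ≤ P.words := by
  rcases hP.layout' with ⟨h1, -⟩ | ⟨h1, -⟩
  · have h2 := P.pow_lam_mul_R_le
    have h3 : P.R ≤ 2 ^ (6 + P.lam) * P.R := Nat.le_mul_of_pos_left _ (by positivity)
    unfold words
    rw [h1, pow_zero, Nat.div_one]
    omega
  · have : P.R = 1 := by simp [R, h1]
    rw [this]
    exact Nat.le_add_left _ _

/-- The addresses of the virtual table and of the scratch memory. -/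
theorem addr_lt (hP : P.Ok) {v : ℕ} (hv : v < P.src + P.size) : 16 + v / 2 ^ P.sr < P.N := by
  have h1 : v / 2 ^ P.sr ≤ (P.src + (P.size - 1)) / 2 ^ P.sr := Nat.div_le_div_right (by omega)
  have h2 : (P.src + (P.size - 1)) / 2 ^ P.sr = P.words + P.R + 1 + (P.size - 1) / 2 ^ P.sr := by
    unfold src
    rw [mul_comm, Nat.mul_add_div (by positivity)]
  have h3 := R_le_words hP
  have h4 : P.words = (P.size - 1) / 2 ^ P.sr + 1 := rfl
  unfold N
  omega

theorem size_le_src : P.size ≤ P.src := by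
  have h1 : P.size - 1 < P.words * 2 ^ P.sr := by
    unfold words
    exact Nat.lt_mul_of_div_lt (Nat.lt_succ_self _) (by positivity)
  have h2 : P.words * 2 ^ P.sr ≤ P.src := Nat.mul_le_mul_right _ (by omega)
  omega

theorem vaddr_lt (hP : P.Ok) {v : ℕ} (hv : v < P.src + P.size) : v < 2 ^ P.w := by
  have h1 := addr_lt hP hv
  refine lt_trans ?_ hP.space
  exact Nat.lt_mul_of_div_lt (by unfold N at h1; omega) (by positivity)

theorem N_lt (hP : P.Ok) : P.N < 2 ^ P.w :=
  lt_of_le_of_lt (Nat.le_mul_of_pos_right _ (by positivity)) hP.space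

/-- The scratch area is addressed through the same virtual indices as the table. From `src` on they
lie beyond the table and the `R + 1` words reserved at `B` for input and output. -/
theorem addr_ge {v : ℕ} (hv : P.src ≤ v) : P.B + P.R + 1 ≤ 16 + v / 2 ^ P.sr := by
  have : P.words + P.R + 1 ≤ v / 2 ^ P.sr := (Nat.le_div_iff_mul_le (by positivity)).2 hv
  unfold B
  omega

theorem vget_lt (m : ℕ → ℕ) (v : ℕ) : P.vget m v < 2 ^ P.S := Nat.mod_lt _ (by positivity)

theorem testBit_vget (m : ℕ → ℕ) (v b : ℕ) : (P.vget m v).testBit b = (decide (b < P.S) &&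
    (m (16 + v / 2 ^ P.sr)).testBit (v % 2 ^ P.sr * 2 ^ (P.lν + P.e) + b)) := by
  rw [vget, Nat.testBit_mod_two_pow, Nat.testBit_div_two_pow, add_comm b]

/-- The shifted `u` meets only the bits of entry `v`: it has at most `S` bits, and entries in one
word occupy disjoint bit intervals. -/
theorem upd_xor (hP : P.Ok) (m : ℕ → ℕ) (v u : ℕ) (hu : u < 2 ^ P.S) :
    P.Upd v (P.vget m v ^^^ u) m (Function.update m (16 + v / 2 ^ P.sr)
      (m (16 + v / 2 ^ P.sr) ^^^ u * 2 ^ (v % 2 ^ P.sr * 2 ^ (P.lν + P.e)))) := by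
  constructor
  · intro v'
    apply Nat.eq_of_testBit_eq
    intro b
    rw [testBit_vget, Function.update_apply]
    by_cases hb : b < P.S
    swap
    · have hub : u.testBit b = false := Nat.testBit_eq_false_of_lt (hu.trans_le
        (Nat.pow_le_pow_right (by norm_num) (by omega)))
      split_ifs <;> simp [hb, hub, testBit_vget]
    by_cases hq : v' / 2 ^ P.sr = v / 2 ^ P.sr
    · rw [if_pos (by rw [hq]), Nat.testBit_xor, Nat.testBit_mul_two_pow]
      by_cases hr : v' % 2 ^ P.sr = v % 2 ^ P.sr
      · have hv : v' = v := by rw [← Nat.div_add_mod v' (2 ^ P.sr), hq, hr, Nat.div_add_mod]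
        rw [if_pos hv, hv, Nat.testBit_xor, testBit_vget]
        simp [hb]
      · have hv : v' ≠ v := by
          rintro rfl
          exact hr rfl
        rw [if_neg hv, testBit_vget, hq]
        -- Two entries in the same word exist only in the packed layout, where the spacing equals
        -- `S`.
        have hS : P.S = 2 ^ (P.lν + P.e) := by
          rcases hP.layout' with ⟨h1, -⟩ | ⟨-, h2, -⟩
          · simp [h1, Nat.mod_one] at hr
          · exact h2
        rcases lt_or_gt_of_ne hr with h | h
        · have h2 : v' % 2 ^ P.sr * 2 ^ (P.lν + P.e) + b <
              v % 2 ^ P.sr * 2 ^ (P.lν + P.e) := Nat.mul_add_lt_mul h (by omega)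
          simp [hb, not_le.2 h2]
        · have h2 : (v % 2 ^ P.sr + 1) * 2 ^ (P.lν + P.e) ≤
              v' % 2 ^ P.sr * 2 ^ (P.lν + P.e) := Nat.mul_le_mul_right _ h
          rw [add_mul, one_mul] at h2
          rw [Nat.testBit_eq_false_of_lt (hu.trans_le
            (Nat.pow_le_pow_right (by norm_num) (by omega)))]
          simp [hb]
    · rw [if_neg (by omega), if_neg (fun h => hq (by rw [h])), testBit_vget]
  · intro a ha
    rw [Function.update_of_ne ha]

namespace Env

theorem has (hE : P.Env t σ) {i : ℕ} (hi : i < 16) : Has P.w P.N σ (rg i) (P.param i) :=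
  .reg (by omega) (hE.reg i hi)

theorem congr (hE : P.Env t σ) {n : ℕ} (hn : 16 ≤ n) (hs : σ.Same n σ')
    (hm : ∀ v < P.size, P.vget σ'.m v = P.vget σ.m v) : P.Env t σ' :=
  ⟨fun r hr => (hs r (by omega)).trans (hE.reg r hr), fun v hv => (hm v hv).trans (hE.tab v hv)⟩

theorem set (hE : P.Env t σ) {d v : ℕ} (hd : 16 ≤ d) : P.Env t (σ.set d v) :=
  hE.congr le_rfl (St.Same.refl.set hd) fun _ _ => rfl

end Env

end Par

/-- The address of the word for an entry of the virtual table. -/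
def addrE (a : Expr) : Expr := 16 + (a >>> rg 7)

/-- The position in the word of an entry of the virtual table. -/
def offE (a : Expr) : Expr := mask a (rg 7) <<< rg 8

/-- An entry of the virtual table. -/
def vld (a : Expr) : Expr := (.load (addrE a) >>> offE a) &&& rg 9

/-- Change an entry of the virtual table by exclusive or. -/
def vxor (a u : Expr) : Prog := write (addrE a) (.load (addrE a) ^^^ (u <<< offE a))

/-- Set an entry of the virtual table. -/
def vset (a u : Expr) : Prog := vxor a (vld a ^^^ u)

namespace Par
variable {P : Par} {t : ℕ → ℕ} {σ σ' : St} {a u : Expr} {v x : ℕ} {Q : St → Prop}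

theorem has_addrE (hP : P.Ok) (hE : P.Env t σ) (ha : Has P.w P.N σ a v) (hv : v < P.src + P.size) :
    Has P.w P.N σ (addrE a) (16 + v / 2 ^ P.sr) :=
  (Has.lit (lit_lt hP (by norm_num))).add (ha.shr (hE.has (i := 7) (by norm_num)))
    ((addr_lt hP hv).trans (N_lt hP))

theorem has_offE (hP : P.Ok) (hE : P.Env t σ) (ha : Has P.w P.N σ a v) :
    Has P.w P.N σ (offE a) (v % 2 ^ P.sr * 2 ^ (P.lν + P.e)) :=
  (ha.mask (hE.has (i := 7) (by norm_num)) (sr_lt hP)).shl (hE.has (i := 8) (by norm_num))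
    (lt_of_le_of_lt ((Nat.le_add_right _ _).trans (off_add_le hP v)) Nat.lt_two_pow_self)

theorem has_vld (hP : P.Ok) (hE : P.Env t σ) (ha : Has P.w P.N σ a v) (hv : v < P.src + P.size) :
    Has P.w P.N σ (vld a) (P.vget σ.m v) :=
  ((((has_addrE hP hE ha hv).load (addr_lt hP hv)).shr (has_offE hP hE ha)).and
    (hE.has (i := 9) (by norm_num))).eq (Nat.and_two_pow_sub_one_eq_mod _ _)

variable [NeZero P.w]

theorem ht_vxor (hP : P.Ok) (hE : P.Env t σ) (ha : Has P.w P.N σ a v) (hv : v < P.src + P.size)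
    (hu : Has P.w P.N σ u x) (hx : x < 2 ^ P.S)
    (hQ : ∀ m', P.Upd v (P.vget σ.m v ^^^ x) σ.m m' → Q ⟨σ.r, m'⟩) :
    Ht P.w P.N (vxor a u) σ (5 * a.cost + u.cost + 27) Q := by
  have ho := has_offE hP hE ha
  have hadd := has_addrE hP hE ha hv
  refine (Ht.write_has hadd ((hadd.load (addr_lt hP hv)).xor (hu.shl ho ?_)) (addr_lt hP hv)
    (hQ _ (upd_xor hP σ.m v x hx))).mono ?_ (fun _ h => h)
  · refine lt_of_lt_of_le ((Nat.mul_lt_mul_right (by positivity)).2 hx) ?_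
    rw [← pow_add]
    exact Nat.pow_le_pow_right (by norm_num) (by have := off_add_le hP v; omega)
  · change (1 + (a.cost + 1 + 1) + 1) + ((1 + (a.cost + 1 + 1) + 1) + 1 +
      (u.cost + ((a.cost + ((1 + 1 + 1) + 1 + 1) + 1) + 1 + 1) + 1) + 1) + 1 ≤ _
    omega

theorem ht_vset (hP : P.Ok) (hE : P.Env t σ) (ha : Has P.w P.N σ a v) (hv : v < P.src + P.size)
    (hu : Has P.w P.N σ u x) (hx : x < 2 ^ P.S)
    (hQ : ∀ m', P.Upd v x σ.m m' → Q ⟨σ.r, m'⟩) :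
    Ht P.w P.N (vset a u) σ (7 * a.cost + u.cost + 50) Q := by
  refine (ht_vxor hP hE ha hv ((has_vld hP hE ha hv).xor hu)
    (Nat.xor_lt_two_pow (vget_lt _ _) hx) (fun m' hm => hQ m' ?_)).mono ?_ (fun _ h => h)
  -- Adding the exclusive or of the old and the new value replaces the old one.
  · rwa [← Nat.xor_assoc, Nat.xor_self, Nat.zero_xor] at hm
  · change 5 * a.cost + (((1 + (a.cost + 1 + 1) + 1) + 1 +
      ((a.cost + ((1 + 1 + 1) + 1 + 1) + 1) + 1 + 1) + 1 + 1 + 1) + u.cost + 1) + 27 ≤ _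
    omega

end Par

end WordRAM

/-! ### Programs for hash values and table rows -/

namespace WordRAM

open WordRAM.Expr

/-- The index of a table row. -/
def rowE (h j g i : Expr) : Expr :=
  ((((((h <<< rg 4) + j) <<< rg 4) + g) <<< rg 15) + i) <<< rg 12

/-- The index for the hashed values `s` and `a`, where `b` is `g` times the step size. -/
def idxE (b s a : Expr) : Expr :=
  (mask s (b + (rg 5 + 256)) <<< (rg 15 - (b + (rg 5 + 256)))) + mask a (rg 15 - (b + (rg 5 + 256)))

/-- The hash value of a character. -/
def chashE (j c : Expr) : Expr := vld (rowE 0 j 0 c)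

/-- `R[34] :=` the hash value of the pair `R[32]`, `R[33]`. -/
def narrow (m : ℕ) : Prog :=
  .seq (assign 34 0) (.seq (assign 35 0) (forLoop 36 (rg 6 + 1) (.seq
    (assign 34 (rg 34 ^^^ vld (rowE (.lit m) (rg 31) (rg 36) (idxE (rg 35) (rg 32) (rg 33)))))
    (assign 35 (rg 35 + rg 5)))))

/-- `R[32] :=` the hash value of the characters `R[27]`, `R[28]`, `R[29]`, and
`R[33] :=` the hash value of the character `R[30]`. -/
def hashes : Prog :=
  .seq (assign 32 (chashE (rg 31) (rg 27))) (.seq (assign 33 (chashE (rg 31) (rg 28)))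
    (.seq (narrow 1) (.seq (assign 32 (rg 34)) (.seq (assign 33 (chashE (rg 31) (rg 29)))
      (.seq (narrow 2) (.seq (assign 32 (rg 34)) (assign 33 (chashE (rg 31) (rg 30)))))))))

/-- Add the table row at `R[37]` to the array at `R[23]`. -/
def xorRow : Prog := forLoop 38 (rg 20) (vxor (rg 23 + rg 38) (vld (rg 37 + rg 38)))

/-- Add the table rows for a component and the hash values `R[32]`, `R[33]`. -/
def xorRows : Prog :=
  .seq (assign 35 0) (forLoop 36 (rg 6 + 1) (.seq
    (assign 37 (rowE (rg 21 + rg 26) (rg 31) (rg 36) (idxE (rg 35) (rg 32) (rg 33))))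
    (.seq xorRow (assign 35 (rg 35 + rg 5)))))

/-- Add the table rows for a component with the characters `R[27]`, …, `R[30]`. -/
def xorComp : Prog := forLoop 31 (1 <<< rg 4) (.seq hashes xorRows)

theorem Has.of_same {w N n r x : ℕ} {σ σ' : St} (hs : σ.Same n σ') (hr : r < n) (hn : n ≤ 64)
    (h : σ.r r = x) : Has w N σ' (rg r) x := .reg (by omega) ((hs r hr).trans h)

namespace Par
variable {P : Par} {t : ℕ → ℕ} {σ σ' : St}

theorem row_lt_size {h j g i k : ℕ} (hh : h < 2 ^ (6 + P.lam)) (hj : j < P.D)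
    (hg : g < P.D) (hi : i < 2 ^ P.L) (hk : k < P.R) : P.row h j g i + k < P.size :=
  (row_lt hj hg hi hk).trans_le (block_le_size hh)

theorem size_lt (hP : P.Ok) {v : ℕ} (hv : v ≤ P.size) : v < 2 ^ P.w := by
  refine vaddr_lt hP ?_
  have h1 : 0 < P.size := lt_of_lt_of_le (by have := P.R_pos; positivity) P.pow_lam_mul_R_le
  have h2 : 0 < P.src := by unfold src; positivity
  omega

theorem has_rowE (hP : P.Ok) (hE : P.Env t σ) {h j g i : Expr} {xh xj xg xi : ℕ}
    (hh : Has P.w P.N σ h xh) (hj : Has P.w P.N σ j xj) (hg : Has P.w P.N σ g xg)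
    (hi : Has P.w P.N σ i xi) (hh' : xh < 2 ^ (6 + P.lam)) (hj' : xj < P.D) (hg' : xg < P.D)
    (hi' : xi < 2 ^ P.L) : Has P.w P.N σ (rowE h j g i) (P.row xh xj xg xi) := by
  have h0 := size_lt hP (row_lt_size hh' hj' hg' hi' P.R_pos).le
  rw [add_zero] at h0
  have h1 : ((xh * P.D + xj) * P.D + xg) * 2 ^ P.L + xi < 2 ^ P.w :=
    lt_of_le_of_lt (Nat.le_mul_of_pos_right _ P.R_pos) h0
  have h2 : ((xh * P.D + xj) * P.D + xg) * 2 ^ P.L < 2 ^ P.w :=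
    lt_of_le_of_lt (Nat.le_add_right _ _) h1
  have h3 : (xh * P.D + xj) * P.D + xg < 2 ^ P.w :=
    lt_of_le_of_lt (Nat.le_mul_of_pos_right _ (by positivity)) h2
  have h4 : (xh * P.D + xj) * P.D < 2 ^ P.w := lt_of_le_of_lt (Nat.le_add_right _ _) h3
  have h5 : xh * P.D + xj < 2 ^ P.w := lt_of_le_of_lt (Nat.le_mul_of_pos_right _ P.D_pos) h4
  have h6 : xh * P.D < 2 ^ P.w := lt_of_le_of_lt (Nat.le_add_right _ _) h5
  exact ((((((hh.shl (hE.has (i := 4) (by norm_num)) h6).add hj h5).shl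
    (hE.has (i := 4) (by norm_num)) h4).add hg h3).shl (hE.has (i := 15) (by norm_num)) h2).add
    hi h1).shl (hE.has (i := 12) (by norm_num)) h0

theorem has_idxE (hP : P.Ok) (hE : P.Env t σ) {b s a : Expr} {g xs xa : ℕ} (hg : g ≤ P.Q)
    (hb : Has P.w P.N σ b (g * P.β)) (hs : Has P.w P.N σ s xs) (ha : Has P.w P.N σ a xa) :
    Has P.w P.N σ (idxE b s a) (P.idx g xs xa) := by
  have h1 := len_le hP hg
  have h2 := lt_w hP
  have h3 := Nat.lt_two_pow_self (n := P.w)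
  have h4 := idx_lt hP hg xs xa
  have h5 : P.idx g xs xa < 2 ^ P.w := h4.trans_le (Nat.pow_le_pow_right (by norm_num) h2.1)
  have hx : P.x = P.β + 256 := rfl
  have hl : Has P.w P.N σ (b + (rg 5 + 256)) (g * P.β + P.x) :=
    hb.add ((hE.has (i := 5) (by norm_num)).add (.lit (lit_lt hP (by norm_num)))
      (by change P.β + 256 < _; omega)) (by omega)
  have hr := (hE.has (i := 15) (by norm_num)).sub hl h1.2
  change Has P.w P.N σ _ (P.L - (g * P.β + P.x)) at hr
  refine ((hs.mask hl (by omega)).shl hr ?_).add (ha.mask hr (by omega)) h5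
  exact lt_of_le_of_lt (Nat.le_add_right _ _) h5

theorem has_entry (hP : P.Ok) (hE : P.Env t σ) {h j g i : Expr} {xh xj xg xi : ℕ}
    (hh : Has P.w P.N σ h xh) (hj : Has P.w P.N σ j xj) (hg : Has P.w P.N σ g xg)
    (hi : Has P.w P.N σ i xi) (hh' : xh < 2 ^ (6 + P.lam)) (hj' : xj < P.D) (hg' : xg < P.D)
    (hi' : xi < 2 ^ P.L) : Has P.w P.N σ (vld (rowE h j g i)) (t (P.row xh xj xg xi)) := by
  have h1 := row_lt_size hh' hj' hg' hi' P.R_pos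
  rw [add_zero] at h1
  have := has_vld hP hE (has_rowE hP hE hh hj hg hi hh' hj' hg' hi') (by omega)
  rwa [hE.tab _ h1] at this

theorem has_chashE (hP : P.Ok) (hE : P.Env t σ) {j c : Expr} {xj xc : ℕ}
    (hj : Has P.w P.N σ j xj) (hc : Has P.w P.N σ c xc) (hj' : xj < P.D) (hc' : xc < 2 ^ P.ν) :
    Has P.w P.N σ (chashE j c) (P.chash t xj xc) :=
  has_entry hP hE (.lit (lit_lt hP (by norm_num))) hj (.lit (lit_lt hP (by norm_num))) hc
    (by positivity) hj' P.D_pos (hc'.trans_le (Nat.pow_le_pow_right (by norm_num) (ν_le_L)))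

theorem tab_lt (hE : P.Env t σ) {v : ℕ} (hv : v < P.size) : t v < 2 ^ P.S := by
  rw [← hE.tab v hv]
  exact vget_lt _ _

theorem Q_mul_lt (hP : P.Ok) {k : ℕ} (hk : k ≤ P.Q + 1) : k * P.β < 2 ^ P.w := by
  have h1 := lt_w hP
  have h2 := Nat.lt_two_pow_self (n := P.w)
  have h3 := hP.Qβ_lt
  have h4 : k * P.β ≤ (P.Q + 1) * P.β := Nat.mul_le_mul_right _ hk
  have h5 : P.L = P.κ + 3 * P.β + 513 := rfl
  rw [add_mul, one_mul] at h4
  omega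

theorem Q_add_one_lt (hP : P.Ok) : P.Q + 1 < 2 ^ P.w := by
  have h1 := Q_mul_lt hP le_rfl
  have h2 : P.Q + 1 ≤ (P.Q + 1) * P.β := Nat.le_mul_of_pos_right _ hP.β_pos
  omega

theorem has_Q_add_one (hP : P.Ok) (hE : P.Env t σ) : Has P.w P.N σ (rg 6 + 1) (P.Q + 1) :=
  (hE.has (i := 6) (by norm_num)).add (.lit (lit_lt hP (by norm_num))) (Q_add_one_lt hP)

theorem D_lt (hP : P.Ok) : P.D < 2 ^ P.w := by
  refine size_lt hP ?_
  unfold size block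
  have : 0 < 2 ^ (6 + P.lam) * (P.D * 2 ^ P.L * P.R) := by
    have := P.R_pos
    have := P.D_pos
    positivity
  calc P.D ≤ P.D * (2 ^ (6 + P.lam) * (P.D * 2 ^ P.L * P.R)) := Nat.le_mul_of_pos_right _ this
    _ = _ := by ring

variable (P) in
/-- The memory agrees with `m₀`, except that the entries from `b` to `b + n - 1` are given
by `f`. -/
def Acc (m₀ : ℕ → ℕ) (b n : ℕ) (f m : ℕ → ℕ) : Prop :=
  (∀ v, P.vget m v = if b ≤ v ∧ v < b + n then f (v - b) else P.vget m₀ v) ∧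
    ∀ a ≤ P.B + P.R, m a = m₀ a

namespace Acc
variable {m₀ f m m' : ℕ → ℕ} {b n : ℕ}

theorem get_low (h : P.Acc m₀ b n f m) {v : ℕ} (hv : v < b) : P.vget m v = P.vget m₀ v := by
  rw [h.1, if_neg (by omega)]

theorem get (h : P.Acc m₀ b n f m) {k : ℕ} (hk : k < n) : P.vget m (b + k) = f k := by
  rw [h.1, if_pos (by omega), Nat.add_sub_cancel_left]

theorem congr (h : P.Acc m₀ b n f m) {f' : ℕ → ℕ} (hf : ∀ k < n, f k = f' k) :
    P.Acc m₀ b n f' m := by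
  refine ⟨fun _ => ?_, h.2⟩
  rw [h.1]
  split_ifs
  · exact hf _ (by omega)
  · rfl

theorem upd (h : P.Acc m₀ b n f m) (hb : P.src ≤ b) {k y : ℕ} (hk : k < n)
    (hm : P.Upd (b + k) y m m') : P.Acc m₀ b n (fun k' => if k' = k then y else f k') m' := by
  constructor
  · intro v
    rw [hm.1, h.1]
    beta_reduce
    split_ifs <;> first | rfl | omega
  · intro a ha
    rw [hm.2, h.2 a ha]
    have := addr_ge (P := P) (v := b + k) (by omega)
    omega

theorem env (h : P.Acc σ.m b n f σ'.m) (hb : P.src ≤ b) (hE : P.Env t σ) {l : ℕ} (hl : 16 ≤ l)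
    (hs : σ.Same l σ') : P.Env t σ' :=
  hE.congr hl hs fun _ hv => h.get_low (hv.trans_le (P.size_le_src.trans hb))

theorem trans {f' : ℕ → ℕ} (h : P.Acc m₀ b n f m) (h' : P.Acc m b n f' m') :
    P.Acc m₀ b n f' m' := by
  constructor
  · intro v
    rw [h'.1, h.1]
    split_ifs <;> rfl
  · intro a ha
    rw [h'.2 a ha, h.2 a ha]

theorem refl : P.Acc m b n (fun k => P.vget m (b + k)) m := by
  refine ⟨fun _ => ?_, fun _ _ => rfl⟩
  split_ifs with h
  · simp only [Nat.add_sub_cancel' h.1]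
  · rfl

end Acc

theorem has_D (hP : P.Ok) (hE : P.Env t σ) : Has P.w P.N σ (1 <<< rg 4) P.D := by
  refine ((Has.lit (lit_lt hP (by norm_num))).shl (hE.has (i := 4) (by norm_num)) ?_).eq (one_mul _)
  exact lt_of_eq_of_lt (one_mul _) (D_lt hP)

variable [NeZero P.w]

/-- Without multiplication, the product `g * β` is kept in register `35` and increased by `β` in
each round. -/
theorem ht_narrow (hP : P.Ok) (hE : P.Env t σ) {m j : ℕ}
    (hm : m ≤ 2) (hj : σ.r 31 = j)
    (hj' : j < P.D) : Ht P.w P.N (narrow m) σ (300 * (P.Q + 1)) fun σ' => σ.Same 34 σ' ∧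
      σ'.m = σ.m ∧ σ'.r 34 = P.phash t m j (σ.r 32) (σ.r 33) := by
  have h2 : (2 : ℕ) < 2 ^ (6 + P.lam) := lt_of_lt_of_le (by norm_num : 2 < 2 ^ 6)
    (Nat.pow_le_pow_right (by norm_num) (by omega))
  refine Ht.mono (Ht.assign_seq_has (by norm_num) (.lit (lit_lt hP (by norm_num)))
    (Ht.assign_seq_has (by norm_num) (.lit (lit_lt hP (by norm_num))) (Ht.forLoop
    (n := P.Q + 1) (T := 250) (fun k σ' => σ.Same 34 σ' ∧ σ'.m = σ.m ∧ σ'.r 34 =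
      xorSum k (fun g => t (P.row m j g (P.idx g (σ.r 32) (σ.r 33)))) ∧ σ'.r 35 = k * P.β)
    (by norm_num) (Q_add_one_lt hP) ?_ ?_ ?_ ?_))) ?_ (fun σ' h => ⟨h.1, h.2.1, h.2.2.1⟩)
  · rintro k σ₁ σ₂ ha ⟨h1, h2, h3, h4⟩
    exact ⟨h1.agree (by norm_num) ha, ha.2.trans h2, (ha.1 _ (by norm_num)).trans h3,
      (ha.1 _ (by norm_num)).trans h4⟩
  · rintro k - σ₁ ⟨h1, h2, -⟩
    exact has_Q_add_one hP (hE.congr (by norm_num) h1 (by rw [h2]; exact fun _ _ => rfl))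
  · rintro k hk σ₁ ⟨h1, h3, h4, h5⟩ h6
    have hE₁ : P.Env t σ₁ := hE.congr (by norm_num) h1 (by rw [h3]; exact fun _ _ => rfl)
    have hkQ : k ≤ P.Q := by omega
    have hi := has_idxE hP hE₁ hkQ (.reg (by norm_num) h5)
      (Has.of_same h1 (r := 32) (by norm_num) (by norm_num) rfl)
      (Has.of_same h1 (r := 33) (by norm_num) (by norm_num) rfl)
    have hml : Has P.w P.N σ₁ (.lit m) m := ⟨lit_lt hP (by omega), rfl⟩
    have he := has_entry hP hE₁ hml (Has.of_same h1 (r := 31) (by norm_num) (by norm_num) hj)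
      (.reg (by norm_num) h6) hi (by omega) hj' (hkQ.trans_lt hP.Q_lt) (idx_lt hP hkQ _ _)
    refine Ht.mono (Ht.assign_seq_has (by norm_num) ((Has.reg (by norm_num) h4).xor he)
      (Ht.assign_has (by norm_num) ((Has.reg (x := k * P.β) (by norm_num) (by simpa using h5)).add
        ((hE₁.set (by norm_num)).has (i := 5) (by norm_num)) ?_) ?_)) ?_ (fun _ h => h)
    · change k * P.β + P.β < _
      rw [← Nat.succ_mul]
      exact Q_mul_lt hP hk
    · refine ⟨⟨(h1.set (by norm_num)).set (by norm_num), h3, by simp [xorSum], ?_⟩, by simpa using h6⟩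
      simp only [St.set_r, if_true, param]
      ring
    · exact Nat.le_of_ble_eq_true rfl
  · refine ⟨(St.Same.refl.set (by norm_num)).set (by norm_num), rfl, by simp [xorSum], by simp⟩
  · change (_ + 1) + ((_ + 1) + ((P.Q + 1) * (250 + (1 + 1 + 1) + 8) + (1 + 1 + 1) + 6)) ≤ _
    simp only [show ∀ n, (OfNat.ofNat n : Expr).cost = 1 from fun _ => rfl]
    omega

theorem ht_hashes (hP : P.Ok) (hE : P.Env t σ) {j c₀ c₁ c₂ c₃ : ℕ} (hj : σ.r 31 = j)
    (hj' : j < P.D) (h₀ : σ.r 27 = c₀) (h₁ : σ.r 28 = c₁) (h₂ : σ.r 29 = c₂) (h₃ : σ.r 30 = c₃)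
    (hc₀ : c₀ < 2 ^ P.ν) (hc₁ : c₁ < 2 ^ P.ν) (hc₂ : c₂ < 2 ^ P.ν) (hc₃ : c₃ < 2 ^ P.ν) :
    Ht P.w P.N hashes σ (1000 * (P.Q + 1)) fun σ' => σ.Same 32 σ' ∧ σ'.m = σ.m ∧
      σ'.r 32 = P.thash t j c₀ c₁ c₂ ∧ σ'.r 33 = P.chash t j c₃ := by
  refine Ht.mono (Ht.assign_seq_has (by norm_num) (has_chashE hP hE (.reg (by norm_num) hj)
    (.reg (by norm_num) h₀) hj' hc₀) (Ht.assign_seq_has (by norm_num) (has_chashE hP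
    (hE.set (by norm_num)) (.reg (by norm_num) (by simpa using hj))
    (.reg (by norm_num) (by simpa using h₁)) hj' hc₁) (Ht.seq (ht_narrow hP
    ((hE.set (by norm_num)).set (by norm_num)) (by norm_num) (by simpa using hj) hj')
    (T₂ := 300 * (P.Q + 1) + 150) ?_))) ?_ (fun _ h => h)
  · rintro σ₁ ⟨s₁, m₁, e₁⟩
    have s₁' : σ.Same 32 σ₁ :=
      ((St.Same.refl.set le_rfl).set (by norm_num)).trans (s₁.mono (by norm_num))
    have hE₁ : P.Env t σ₁ := hE.congr (by norm_num) s₁' (by rw [m₁]; exact fun _ _ => rfl)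
    refine Ht.mono (Ht.assign_seq_has (by norm_num) (.reg (by norm_num) e₁)
      (Ht.assign_seq_has (by norm_num) (has_chashE hP (hE₁.set (by norm_num))
      (Has.of_same (s₁'.set (by norm_num)) (by norm_num) (by norm_num) hj)
      (Has.of_same (s₁'.set (by norm_num)) (by norm_num) (by norm_num) h₂) hj' hc₂)
      (Ht.seq (ht_narrow hP ((hE₁.set (by norm_num)).set (by norm_num)) (by norm_num)
      (((s₁'.set (by norm_num)).set (by norm_num) _ (by norm_num)).trans hj) hj')
      (T₂ := 70) ?_))) ?_ (fun _ h => h)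
    · rintro σ₂ ⟨s₂, m₂, e₂⟩
      have s₂' : σ.Same 32 σ₂ :=
        ((s₁'.set (by norm_num)).set (by norm_num)).trans (s₂.mono (by norm_num))
      have m₂' : σ₂.m = σ.m := m₂.trans m₁
      have hE₂ : P.Env t σ₂ := hE.congr (by norm_num) s₂' (by rw [m₂']; exact fun _ _ => rfl)
      refine Ht.mono (Ht.assign_seq_has (by norm_num) (.reg (by norm_num) e₂)
        (Ht.assign_has (by norm_num) (has_chashE hP (hE₂.set (by norm_num))
        (Has.of_same (s₂'.set (by norm_num)) (by norm_num) (by norm_num) hj)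
        (Has.of_same (s₂'.set (by norm_num)) (by norm_num) (by norm_num) h₃) hj' hc₃)
        ⟨(s₂'.set (by norm_num)).set (by norm_num), m₂', ?_, by simp⟩))
        (Nat.le_of_ble_eq_true rfl) (fun _ h => h)
      simp [thash]
    · have h5 : (rg 34).cost = 1 := rfl
      have h6 : (chashE (rg 31) (rg 29)).cost ≤ 70 := Nat.le_of_ble_eq_true rfl
      omega
  · have h5 : (chashE (rg 31) (rg 27)).cost ≤ 70 := Nat.le_of_ble_eq_true rfl
    have h6 : (chashE (rg 31) (rg 28)).cost ≤ 70 := Nat.le_of_ble_eq_true rfl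
    omega

theorem ht_xorRow (hP : P.Ok) (hE : P.Env t σ) {b n v : ℕ} {f : ℕ → ℕ} (hb : σ.r 23 = b)
    (hn : σ.r 20 = n) (hv : σ.r 37 = v) (hb₁ : P.src ≤ b) (hb₂ : b + n ≤ P.src + P.size)
    (hv' : v + n ≤ P.size) (hf : ∀ k < n, P.vget σ.m (b + k) = f k) :
    Ht P.w P.N xorRow σ (120 * n + 10) fun σ' => σ.Same 38 σ' ∧
      P.Acc σ.m b n (fun k => f k ^^^ t (v + k)) σ'.m := by
  have hlt : ∀ {x}, x < P.src + P.size → x < 2 ^ P.w := vaddr_lt hP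
  have hsz := P.size_le_src
  have hsrc : 0 < P.src := by unfold src; positivity
  refine Ht.mono (Ht.forLoop (n := n) (T := 105) (fun k σ' => σ.Same 38 σ' ∧
    P.Acc σ.m b n (fun k' => if k' < k then f k' ^^^ t (v + k') else f k') σ'.m)
    (by norm_num) (hlt (by omega)) ?_ ?_ ?_ ⟨St.Same.refl, ?_⟩) ?_ ?_
  · rintro k σ₁ σ₂ ha ⟨h1, h2⟩
    exact ⟨h1.agree le_rfl ha, by rwa [ha.2]⟩
  · rintro k hk σ₁ ⟨h1, h2⟩
    exact Has.of_same h1 (by norm_num) (by norm_num) hn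
  · rintro k hk σ₁ ⟨h1, h2⟩ h3
    have hE₁ := h2.env hb₁ hE (by norm_num) h1
    have hk₁ : Has P.w P.N σ₁ (rg 38) k := .reg (by norm_num) h3
    have hr := has_vld hP hE₁ ((Has.of_same h1 (by norm_num) (by norm_num) hv).add hk₁
      (hlt (by omega))) (by omega)
    rw [hE₁.tab _ (by omega)] at hr
    refine Ht.mono (ht_vxor hP hE₁ ((Has.of_same h1 (by norm_num) (by norm_num) hb).add hk₁
      (hlt (by omega))) (by omega) hr (tab_lt hE (by omega)) ?_) (Nat.le_of_ble_eq_true rfl)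
      (fun _ h => h)
    intro m' hm
    refine ⟨⟨h1, (h2.upd hb₁ hk hm).congr fun k' hk' => ?_⟩, h3⟩
    rw [h2.get hk]
    by_cases he : k' = k
    · subst he
      simp
    · simp only [he, if_false]
      split_ifs <;> first | rfl | omega
  · exact Acc.refl.congr fun k hk => by simpa using hf k hk
  · change n * (105 + 1 + 8) + 1 + 6 ≤ _
    omega
  · rintro σ' ⟨h1, h2⟩
    exact ⟨h1, h2.congr fun k hk => by simp [hk]⟩

theorem ht_xorRows (hP : P.Ok) (hE : P.Env t σ) {b n h j d i : ℕ} {f : ℕ → ℕ} (hb : σ.r 23 = b)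
    (hn : σ.r 20 = n) (hd : σ.r 21 = d) (hi : σ.r 26 = i) (hj : σ.r 31 = j) (hj' : j < P.D)
    (hh : d + i = h) (hh' : h < 2 ^ (6 + P.lam)) (hb₁ : P.src ≤ b) (hb₂ : b + n ≤ P.src + P.size)
    (hn₀ : 0 < n) (hn' : n ≤ P.R) (hf : ∀ k < n, P.vget σ.m (b + k) = f k) :
    Ht P.w P.N xorRows σ (300 * ((P.Q + 1) * n)) fun σ' => σ.Same 32 σ' ∧
      P.Acc σ.m b n (fun k => f k ^^^ xorSum (P.Q + 1) fun g =>
        t (P.row h j g (P.idx g (σ.r 32) (σ.r 33)) + k)) σ'.m := by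
  refine Ht.mono (Ht.assign_seq_has (by norm_num) (.lit (lit_lt hP (by norm_num))) (Ht.forLoop
    (n := P.Q + 1) (T := 120 * n + 90) (fun k σ' => σ.Same 34 σ' ∧ σ'.r 35 = k * P.β ∧
    P.Acc σ.m b n (fun k' => f k' ^^^ xorSum k fun g =>
      t (P.row h j g (P.idx g (σ.r 32) (σ.r 33)) + k')) σ'.m)
    (by norm_num) (Q_add_one_lt hP) ?_ ?_ ?_ ⟨St.Same.refl.set (by norm_num), by simp, ?_⟩)) ?_
    (fun σ' h => ⟨h.1.mono (by norm_num), h.2.2⟩)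
  · rintro k σ₁ σ₂ ha ⟨h1, h2, h3⟩
    exact ⟨h1.agree (by norm_num) ha, (ha.1 _ (by norm_num)).trans h2, by rwa [ha.2]⟩
  · rintro k - σ₁ ⟨h1, h2, h3⟩
    exact has_Q_add_one hP (h3.env hb₁ hE (by norm_num) h1)
  · rintro k hk σ₁ ⟨h1, h2, h3⟩ h4
    have hE₁ := h3.env hb₁ hE (by norm_num) h1
    have hkQ : k ≤ P.Q := by omega
    have hs : ∀ r < 34, Has P.w P.N σ₁ (rg r) (σ.r r) := fun r hr =>
      Has.of_same h1 hr (by norm_num) rfl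
    have hx := has_idxE hP hE₁ hkQ (.reg (by norm_num) h2) (hs 32 (by norm_num))
      (hs 33 (by norm_num))
    have hsum := (hs 21 (by norm_num)).add (hs 26 (by norm_num)) (by
      rw [hd, hi, hh]
      refine size_lt hP (le_trans hh'.le ((Nat.le_mul_of_pos_right _ P.R_pos).trans
        P.pow_lam_mul_R_le)))
    rw [hd, hi, hh] at hsum
    have hrow := has_rowE hP hE₁ hsum (hs 31 (by norm_num)) (.reg (by norm_num) h4) hx hh'
      (by rwa [hj]) (hkQ.trans_lt hP.Q_lt) (idx_lt hP hkQ _ _)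
    rw [hj] at hrow
    -- The last entry that is read, at offset `n - 1`, still belongs to the table.
    have hlt := row_lt_size (k := n - 1) hh' hj' (hkQ.trans_lt hP.Q_lt)
      (idx_lt hP hkQ (σ.r 32) (σ.r 33)) (by omega)
    refine Ht.mono (Ht.assign_seq_has (by norm_num) hrow (Ht.seq (ht_xorRow hP
      (hE₁.set (by norm_num)) (b := b) (n := n)
      (v := P.row h j k (P.idx k (σ.r 32) (σ.r 33))) ?_ ?_ (by simp) hb₁ hb₂ (by omega)
      (fun k' hk' => h3.get hk')) (T₂ := 4) ?_)) ?_ (fun _ h => h)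
    · simpa using (h1 23 (by norm_num)).trans hb
    · simpa using (h1 20 (by norm_num)).trans hn
    · rintro σ₂ ⟨h5, h6⟩
      have h5' : (σ₁.set 37 (P.row h j k (P.idx k (σ.r 32) (σ.r 33)))).Same 37 σ₂ :=
        h5.mono (by norm_num)
      have h7 : σ₁.Same 37 σ₂ := (St.Same.refl.set le_rfl).trans h5'
      have hE₂ : P.Env t σ₂ :=
        (h3.trans h6).env hb₁ hE (by norm_num) (h1.trans (h7.mono (by norm_num)))
      refine Ht.assign_has (by norm_num) ((Has.reg (by norm_num)
        ((h7 35 (by norm_num)).trans h2)).add (hE₂.has (i := 5) (by norm_num)) ?_) ⟨⟨?_, ?_, ?_⟩, ?_⟩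
      · change k * P.β + P.β < _
        rw [← Nat.succ_mul]
        exact Q_mul_lt hP hk
      · exact (h1.trans (h7.mono (by norm_num))).set (by norm_num)
      · simp only [St.set_r, if_true, param]
        ring
      · refine (h3.trans h6).congr fun k' hk' => ?_
        rw [xorSum, Nat.xor_assoc]
      · simpa using (h7 36 (by norm_num)).trans h4
    · have : ∀ e : Expr, e.cost ≤ 70 → e.cost + 1 + (120 * n + 10 + 4) ≤ 120 * n + 90 := by
        intro e he
        omega
      exact this _ (Nat.le_of_ble_eq_true rfl)
  · exact Acc.refl.congr fun k hk => by simpa [xorSum] using hf k hk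
  · change 1 + 1 + ((P.Q + 1) * (120 * n + 90 + (1 + 1 + 1) + 8) + (1 + 1 + 1) + 6) ≤ _
    nlinarith

theorem ht_xorComp (hP : P.Ok) (hE : P.Env t σ) {b n h d i c₀ c₁ c₂ c₃ : ℕ} {f : ℕ → ℕ}
    (hb : σ.r 23 = b) (hn : σ.r 20 = n) (hd : σ.r 21 = d) (hi : σ.r 26 = i)
    (h₀ : σ.r 27 = c₀) (h₁ : σ.r 28 = c₁) (h₂ : σ.r 29 = c₂) (h₃ : σ.r 30 = c₃)
    (hc₀ : c₀ < 2 ^ P.ν) (hc₁ : c₁ < 2 ^ P.ν) (hc₂ : c₂ < 2 ^ P.ν) (hc₃ : c₃ < 2 ^ P.ν)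
    (hh : d + i = h) (hh' : h < 2 ^ (6 + P.lam)) (hb₁ : P.src ≤ b) (hb₂ : b + n ≤ P.src + P.size)
    (hn₀ : 0 < n) (hn' : n ≤ P.R) (hf : ∀ k < n, P.vget σ.m (b + k) = f k) :
    Ht P.w P.N xorComp σ (1400 * (P.D * ((P.Q + 1) * n))) fun σ' => σ.Same 31 σ' ∧
      P.Acc σ.m b n (fun k => f k ^^^ xorSum P.D fun j => xorSum (P.Q + 1) fun g =>
        t (P.row h j g (P.idx g (P.thash t j c₀ c₁ c₂) (P.chash t j c₃)) + k)) σ'.m := by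
  refine Ht.mono (Ht.forLoop (n := P.D) (T := 1000 * (P.Q + 1) + 300 * ((P.Q + 1) * n))
    (fun k σ' => σ.Same 31 σ' ∧ P.Acc σ.m b n (fun k' => f k' ^^^ xorSum k fun j =>
      xorSum (P.Q + 1) fun g =>
        t (P.row h j g (P.idx g (P.thash t j c₀ c₁ c₂) (P.chash t j c₃)) + k')) σ'.m)
    (by norm_num) (D_lt hP) ?_ ?_ ?_ ⟨St.Same.refl, ?_⟩) ?_ (fun _ h => h)
  · rintro k σ₁ σ₂ ha ⟨h1, h2⟩
    exact ⟨h1.agree (by norm_num) ha, by rwa [ha.2]⟩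
  · rintro k - σ₁ ⟨h1, h2⟩
    exact has_D hP (h2.env hb₁ hE (by norm_num) h1)
  · rintro j hj σ₁ ⟨h1, h2⟩ h3
    have hs : ∀ r < 31, σ₁.r r = σ.r r := h1
    have hE₁ := h2.env hb₁ hE (by norm_num) h1
    refine Ht.seq (ht_hashes hP hE₁ h3 hj ((hs 27 (by norm_num)).trans h₀)
      ((hs 28 (by norm_num)).trans h₁) ((hs 29 (by norm_num)).trans h₂)
      ((hs 30 (by norm_num)).trans h₃) hc₀ hc₁ hc₂ hc₃) ?_
    rintro σ₂ ⟨h4, h5, h6, h7⟩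
    have hE₂ : P.Env t σ₂ := hE₁.congr (by norm_num) h4 (by rw [h5]; exact fun _ _ => rfl)
    have hs₂ : ∀ r < 31, σ₂.r r = σ.r r := fun r hr => (h4 r (by omega)).trans (hs r hr)
    have hf₂ : ∀ k < n, P.vget σ₂.m (b + k) = f k ^^^ xorSum j fun j => xorSum (P.Q + 1) fun g =>
        t (P.row h j g (P.idx g (P.thash t j c₀ c₁ c₂) (P.chash t j c₃)) + k) := by
      rw [h5]
      exact fun k hk => h2.get hk
    refine (ht_xorRows hP hE₂ ((hs₂ 23 (by norm_num)).trans hb) ((hs₂ 20 (by norm_num)).trans hn)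
      ((hs₂ 21 (by norm_num)).trans hd) ((hs₂ 26 (by norm_num)).trans hi)
      ((h4 31 (by norm_num)).trans h3) hj hh hh' hb₁ hb₂ hn₀ hn'
      hf₂).mono le_rfl ?_
    rintro σ₃ ⟨h8, h9⟩
    rw [h5, h6, h7] at h9
    refine ⟨⟨h1.trans ((h4.trans h8).mono (by norm_num)), ?_⟩, ?_⟩
    · refine (h2.trans h9).congr fun k' hk' => ?_
      rw [Nat.xor_assoc]
      rfl
    · rw [h8 31 (by norm_num), h4 31 (by norm_num), h3]
  · exact Acc.refl.congr fun k hk => by simpa [xorSum] using hf k hk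
  · change P.D * (1000 * (P.Q + 1) + 300 * ((P.Q + 1) * n) + (1 + 1 + 1) + 8) + (1 + 1 + 1) + 6 ≤ _
    have h5 : P.Q + 1 ≤ (P.Q + 1) * n := Nat.le_mul_of_pos_right _ hn₀
    have h6 : 0 < P.D := P.D_pos
    nlinarith

end Par

end WordRAM

/-! ### Combining two arrays -/

namespace WordRAM

open WordRAM.Expr

/-- A character of the array at `b`. -/
def charE (b c : Expr) : Expr :=
  mask (vld (b + (c >>> rg 10)) >>> (mask c (rg 10) <<< rg 11)) (rg 2 + 13)

/-- Compute the array with number `R[22]` of the next level. -/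
def combNode : Prog :=
  .seq (assign 23 (rg 17 + (rg 22 <<< rg 12))) (.seq (assign 24 (rg 16 + ((rg 22 <<< 1) <<< rg 12)))
    (.seq (assign 25 (rg 24 + (1 <<< rg 12))) (.seq (forLoop 26 (rg 20) (vset (rg 23 + rg 26) 0))
      (forLoop 26 (rg 21) (.seq (assign 27 (charE (rg 24) (rg 26 + rg 26)))
        (.seq (assign 28 (charE (rg 24) (rg 26 + rg 26 + 1)))
          (.seq (assign 29 (charE (rg 25) (rg 26 + rg 26)))
            (.seq (assign 30 (charE (rg 25) (rg 26 + rg 26 + 1))) xorComp))))))))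

/-- Compute the arrays of all levels. -/
def combLevels : Prog :=
  forLoop 18 (rg 1) (.seq (assign 19 (1 <<< (rg 1 - (rg 18 + 1))))
    (.seq (assign 20 ((((1 <<< rg 12) - 1) >>> (rg 1 - (rg 18 + 1))) + 1))
      (.seq (assign 21 (64 <<< rg 18)) (.seq (forLoop 22 (rg 19) combNode)
        (.seq (assign 22 (rg 16)) (.seq (assign 16 (rg 17)) (assign 17 (rg 22))))))))

/-- The next character of the input. -/
def keyE : Expr :=
  mask ((.load (rg 18) >>> rg 19) ||| (.load (rg 18 + 1) <<< (rg 3 - rg 19))) (rg 2)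

/-- Compute the arrays for the characters of the input. -/
def leaves : Prog :=
  .seq (assign 18 (rg 0)) (.seq (assign 19 0) (forLoop 20 (1 <<< rg 1)
    (.seq (assign 22 (rg 16 + (rg 20 <<< rg 12)))
      (.seq (forLoop 23 ((((1 <<< rg 12) - 1) >>> rg 1) + 1) (vset (rg 22 + rg 23) 0))
        (.seq (vset (rg 22) keyE) (cond (.bin .lt (rg 2) (rg 3 - rg 19))
          (assign 19 (rg 19 + rg 2))
          (.seq (assign 19 (rg 2 - (rg 3 - rg 19))) (assign 18 (rg 18 + 1)))))))))

/-- Load the first `n` registers from the first `n` memory cells. -/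
def loadParams : ℕ → Prog
  | 0 => .skip
  | n + 1 => .seq (loadParams n) (assign n (.load (.lit n)))

/-- The evaluation program. -/
def evalProg : Prog :=
  .seq (loadParams 16) (.seq (assign 16 (rg 13)) (.seq (assign 17 (rg 14)) (.seq leaves
    (.seq combLevels (forLoop 18 (1 <<< rg 12) (write (rg 0 + rg 18) (vld (rg 16 + rg 18))))))))

namespace Par
variable {P : Par} {t : ℕ → ℕ} {σ σ' : St}

theorem has_charE (hP : P.Ok) (hE : P.Env t σ) {b c : Expr} {xb xc : ℕ} (hb : Has P.w P.N σ b xb)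
    (hc : Has P.w P.N σ c xc) (hlt : xb + xc / 2 ^ P.e < P.src + P.size) :
    Has P.w P.N σ (charE b c) (P.char (fun k => P.vget σ.m (xb + k)) xc) := by
  have h1 := has_vld hP hE (hb.add (hc.shr (hE.has (i := 10) (by norm_num)))
    (vaddr_lt hP hlt)) hlt
  have hw := lt_w hP
  have hκ : P.κ + 13 < P.w := by
    have : P.L = P.κ + 3 * P.β + 513 := rfl
    omega
  refine (h1.shr ((hc.mask (hE.has (i := 10) (by norm_num)) (e_lt hP)).shl
    (hE.has (i := 11) (by norm_num)) ?_)).mask ((hE.has (i := 2) (by norm_num)).add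
      (.lit (lit_lt hP (by norm_num))) (hκ.trans Nat.lt_two_pow_self)) hκ
  refine lt_of_le_of_lt ?_ (Nat.lt_two_pow_self (n := P.w))
  have h2 : xc % 2 ^ P.e ≤ 2 ^ P.e - 1 := Nat.le_sub_one_of_lt (Nat.mod_lt _ (by positivity))
  have h3 := Nat.mul_le_mul_right (2 ^ P.lν) h2
  have h4 := hP.char_le
  have h5 := S_le hP
  change xc % 2 ^ P.e * 2 ^ P.lν ≤ _
  omega

variable (P) in
/-- The number of words that are used in the arrays of level `n`. -/
def len (n : ℕ) : ℕ := (P.R - 1) / 2 ^ (P.lam - n) + 1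

theorem len_le_R (n : ℕ) : P.len n ≤ P.R := by
  have h1 := P.R_pos
  have h2 : (P.R - 1) / 2 ^ (P.lam - n) ≤ P.R - 1 := Nat.div_le_self _ _
  unfold len
  omega

/-- The `R` entries hold `128 * 2^lam` characters; the `128 * 2^n` characters of level `n` need a
fraction `2^(n-lam)` of them, rounded up. -/
theorem char_div_lt_len (hP : P.Ok) {n c : ℕ} (hn : n ≤ P.lam) (hc : c < 128 * 2 ^ n) :
    c / 2 ^ P.e < P.len n := by
  unfold len
  rw [Nat.lt_succ_iff, Nat.le_div_iff_mul_le (by positivity)]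
  refine Nat.le_sub_one_of_lt (lt_of_mul_lt_mul_right (a := 2 ^ P.e) ?_ (Nat.zero_le _))
  have h1 : P.R * 2 ^ P.e = 2 ^ (P.lam + 7) := by
    unfold R
    rw [← pow_add, add_comm, hP.e_add]
  have h2 : 128 * 2 ^ n * 2 ^ (P.lam - n) = 2 ^ (P.lam + 7) := by
    rw [mul_assoc, ← pow_add, Nat.add_sub_cancel' hn, pow_add]
    ring
  calc _ = c / 2 ^ P.e * 2 ^ P.e * 2 ^ (P.lam - n) := by ring
    _ ≤ c * 2 ^ (P.lam - n) := Nat.mul_le_mul_right _ (Nat.div_mul_le_self _ _)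
    _ < 128 * 2 ^ n * 2 ^ (P.lam - n) := (Nat.mul_lt_mul_right (by positivity)).2 hc
    _ = _ := by rw [h2, h1]

/-- Only the first `len n` entries of the children are read, so those beyond may contain anything.
This is what makes low levels cheap. -/
theorem comb_congr_len (hP : P.Ok) (t : ℕ → ℕ) {n : ℕ} (hn : n ≤ P.lam) {a a' b b' : ℕ → ℕ}
    (ha : ∀ k < P.len n, a k = a' k) (hb : ∀ k < P.len n, b k = b' k) (k : ℕ) :
    P.comb t n a b k = P.comb t n a' b' k := by
  refine xorSum_congr fun i hi => xorSum_congr fun j _ => xorSum_congr fun g _ => ?_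
  have h1 : ∀ c < 128 * 2 ^ n, P.char a c = P.char a' c := fun c hc => by
    unfold char
    rw [ha _ (char_div_lt_len hP hn hc)]
  have h2 : ∀ c < 128 * 2 ^ n, P.char b c = P.char b' c := fun c hc => by
    unfold char
    rw [hb _ (char_div_lt_len hP hn hc)]
  unfold term
  rw [h1 _ (by omega), h1 _ (by omega), h2 _ (by omega), h2 _ (by omega)]

theorem char_lt (a : ℕ → ℕ) (c : ℕ) : P.char a c < 2 ^ P.ν := Nat.mod_lt _ (by positivity)

variable [NeZero P.w]

theorem ht_clear (hP : P.Ok) (hE : P.Env t σ) {i j b n : ℕ} {e : Expr} (hi : 16 ≤ i) (hi' : i < 63)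
    (hj : j < i) (hb : σ.r j = b) (hb₁ : P.src ≤ b) (hb₂ : b + n ≤ P.src + P.size)
    (he : ∀ σ', σ.Same i σ' → P.Env t σ' → Has P.w P.N σ' e n) :
    Ht P.w P.N (forLoop i e (vset (rg j + rg i) 0)) σ (n * (e.cost + 100) + e.cost + 6) fun σ' =>
      σ.Same i σ' ∧ P.Acc σ.m b n (fun _ => 0) σ'.m := by
  have hlt : ∀ {x}, x < P.src + P.size → x < 2 ^ P.w := vaddr_lt hP
  have hsz := P.size_le_src
  have hR := R_le_words hP
  have hsrc : P.R < P.src := by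
    have : (P.words + P.R + 1) ≤ P.src := Nat.le_mul_of_pos_right _ (by positivity)
    omega
  refine Ht.mono (Ht.forLoop (n := n) (T := 85) (fun k σ' => σ.Same i σ' ∧
    P.Acc σ.m b n (fun k' => if k' < k then 0 else P.vget σ.m (b + k')) σ'.m)
    hi' (hlt (by omega)) ?_ ?_ ?_ ⟨St.Same.refl, ?_⟩) ?_ ?_
  · rintro k σ₁ σ₂ ha ⟨h1, h2⟩
    exact ⟨h1.agree le_rfl ha, by rwa [ha.2]⟩
  · rintro k hk σ₁ ⟨h1, h2⟩
    exact he _ h1 (h2.env hb₁ hE hi h1)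
  · rintro k hk σ₁ ⟨h1, h2⟩ h3
    have hE₁ := h2.env hb₁ hE hi h1
    refine Ht.mono (ht_vset hP hE₁ ((Has.of_same h1 hj (by omega) hb).add
      (.reg (by omega) h3) (hlt (by omega))) (by omega) (.lit (lit_lt hP (by norm_num)))
      (by positivity) ?_) (Nat.le_of_ble_eq_true rfl) (fun _ h => h)
    intro m' hm
    refine ⟨⟨h1, (h2.upd hb₁ hk hm).congr fun k' hk' => ?_⟩, h3⟩
    split_ifs <;> first | rfl | omega
  · exact Acc.refl.congr fun k hk => by simp
  · have : n * (85 + e.cost + 8) ≤ n * (e.cost + 100) := Nat.mul_le_mul_left _ (by omega)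
    omega
  · rintro σ' ⟨h1, h2⟩
    exact ⟨h1, h2.congr fun k hk => by simp [hk]⟩

omit [NeZero P.w] in
theorem R_lt (hP : P.Ok) : P.R < 2 ^ P.w := size_lt hP ((Nat.le_mul_of_pos_left _
  (by positivity)).trans P.pow_lam_mul_R_le)

omit [NeZero P.w] in
theorem has_R (hP : P.Ok) (hE : P.Env t σ) : Has P.w P.N σ (1 <<< rg 12) P.R :=
  ((Has.lit (lit_lt hP (by norm_num))).shl (hE.has (i := 12) (by norm_num))
    (lt_of_eq_of_lt (one_mul _) (R_lt hP))).eq (one_mul _)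

/-- The children are read from the region at `a` while the sum accumulates in the disjoint region at
`b`, so the characters of the children stay intact during the computation. -/
theorem ht_combNode (hP : P.Ok) (hE : P.Env t σ) {a b n p lev : ℕ} (ha : σ.r 16 = a)
    (hb : σ.r 17 = b) (hp : σ.r 22 = p) (hn : σ.r 20 = n) (hd : σ.r 21 = 64 * 2 ^ lev)
    (hlev : lev < P.lam) (hp' : 2 * p + 2 ≤ 2 ^ P.lam)
    (ha₂ : a + 2 ^ P.lam * P.R ≤ P.src + P.size)
    (hb₁ : P.src ≤ b) (hb₂ : b + 2 ^ P.lam * P.R ≤ P.src + P.size)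
    (hab : a + 2 ^ P.lam * P.R ≤ b ∨ b + 2 ^ P.lam * P.R ≤ a) (hn₀ : 0 < n) (hn' : n ≤ P.R) :
    Ht P.w P.N combNode σ (2000 * (64 * 2 ^ lev * (P.D * ((P.Q + 1) * n)))) fun σ' =>
      σ.Same 23 σ' ∧ P.Acc σ.m (b + p * P.R) n (P.comb t lev
        (fun k => P.vget σ.m (a + 2 * p * P.R + k))
        (fun k => P.vget σ.m (a + (2 * p + 1) * P.R + k))) σ'.m := by
  have hlt : ∀ {x}, x < P.src + P.size → x < 2 ^ P.w := vaddr_lt hP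
  have hR := P.R_pos
  have hpR := Nat.mul_le_mul_right P.R hp'
  have e1 : (2 * p + 2) * P.R = 2 * (p * P.R) + 2 * P.R := by ring
  have e2 : 2 * p * P.R = 2 * (p * P.R) := by ring
  have e3 : (2 * p + 1) * P.R = 2 * (p * P.R) + P.R := by ring
  have hpow := pow_lam_le hlev
  have hd2 : 128 * 2 ^ lev < 2 ^ P.w := size_lt hP (hpow.trans
    ((Nat.le_mul_of_pos_right _ hR).trans P.pow_lam_mul_R_le))
  have hX : 0 < P.D * ((P.Q + 1) * n) := by have := P.D_pos; positivity
  set A : ℕ → ℕ := fun k => P.vget σ.m (a + 2 * p * P.R + k) with hA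
  set A' : ℕ → ℕ := fun k => P.vget σ.m (a + (2 * p + 1) * P.R + k) with hA'
  have h2p : p * 2 ^ 1 * 2 ^ P.lR = 2 * p * P.R := by unfold R; ring
  have h23 : Has P.w P.N σ (rg 17 + (rg 22 <<< rg 12)) (b + p * P.R) :=
    (Has.reg (by norm_num) hb).add ((Has.reg (by norm_num) hp).shl (hE.has (i := 12) (by norm_num))
      (by change p * P.R < _; exact hlt (by omega))) (hlt (by omega))
  have hE₁ := hE.set (d := 23) (v := b + p * P.R) (by norm_num)
  have h24 : Has P.w P.N (σ.set 23 (b + p * P.R)) (rg 16 + ((rg 22 <<< 1) <<< rg 12))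
      (a + 2 * p * P.R) :=
    ((Has.reg (x := a) (by norm_num) (by simpa using ha)).add (((Has.reg (x := p) (by norm_num)
      (by simpa using hp)).shl (.lit (lit_lt hP (by norm_num))) (hlt (by nlinarith))).shl
      (hE₁.has (i := 12) (by norm_num)) (by change p * 2 ^ 1 * 2 ^ P.lR < _; rw [h2p]; exact hlt (by omega)))
      (by change a + p * 2 ^ 1 * 2 ^ P.lR < _; rw [h2p]; exact hlt (by omega))).eq
      (by change a + p * 2 ^ 1 * 2 ^ P.lR = _; rw [h2p])
  have hE₂ := hE₁.set (d := 24) (v := a + 2 * p * P.R) (by norm_num)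
  have h25 : Has P.w P.N ((σ.set 23 (b + p * P.R)).set 24 (a + 2 * p * P.R))
      (rg 24 + (1 <<< rg 12)) (a + (2 * p + 1) * P.R) :=
    ((Has.reg (x := a + 2 * p * P.R) (by norm_num) (by simp)).add (has_R hP hE₂)
      (hlt (by omega))).eq (by ring)
  have hE₃ := hE₂.set (d := 25) (v := a + (2 * p + 1) * P.R) (by norm_num)
  set σ₁ := ((σ.set 23 (b + p * P.R)).set 24 (a + 2 * p * P.R)).set 25 (a + (2 * p + 1) * P.R)
    with hσ₁
  have hs₁ : σ.Same 23 σ₁ := ((St.Same.refl.set le_rfl).set (by norm_num)).set (by norm_num)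
  have r23 : σ₁.r 23 = b + p * P.R := by simp [hσ₁]
  have r24 : σ₁.r 24 = a + 2 * p * P.R := by simp [hσ₁]
  have r25 : σ₁.r 25 = a + (2 * p + 1) * P.R := by simp [hσ₁]
  have r20 : σ₁.r 20 = n := (hs₁ 20 (by norm_num)).trans hn
  have r21 : σ₁.r 21 = 64 * 2 ^ lev := (hs₁ 21 (by norm_num)).trans hd
  refine Ht.mono (Ht.assign_seq_has (by norm_num) h23 (Ht.assign_seq_has (by norm_num) h24
    (Ht.assign_seq_has (by norm_num) h25 (Ht.seq (ht_clear hP hE₃ (n := n) (by norm_num)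
      (by norm_num) (by norm_num) r23 (by omega) (by omega)
      (fun σ' h _ => Has.of_same h (by norm_num) (by norm_num) r20))
    (T₂ := 64 * 2 ^ lev * (1800 * (P.D * ((P.Q + 1) * n))) + 10) ?_)))) ?_ (fun _ h => h)
  · rintro σ₂ ⟨h1, h2⟩
    refine Ht.mono (Ht.forLoop (n := 64 * 2 ^ lev) (T := 350 + 1400 * (P.D * ((P.Q + 1) * n)))
      (fun i σ' => σ₁.Same 26 σ' ∧ P.Acc σ.m (b + p * P.R) n
        (fun k => xorSum i fun i => xorSum P.D fun j => xorSum (P.Q + 1) fun g =>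
          P.term t (64 * 2 ^ lev + i) j g A A' i k) σ'.m)
      (by norm_num) (by omega) ?_ ?_ ?_ ⟨h1, h2⟩) ?_
      (fun σ' h => ⟨hs₁.trans (h.1.mono (by norm_num)), h.2⟩)
    · rintro k τ τ' ha ⟨h3, h4⟩
      exact ⟨h3.agree (by norm_num) ha, by rwa [ha.2]⟩
    · rintro k - τ ⟨h3, h4⟩
      exact Has.of_same h3 (by norm_num) (by norm_num) r21
    · rintro i hi τ ⟨h3, h4⟩ h5
      have hEτ : P.Env t τ := h4.env (by omega) hE (by norm_num) (hs₁.trans (h3.mono (by norm_num)))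
      have hdiv : ∀ c < 128 * 2 ^ lev, c / 2 ^ P.e < P.R := fun c hc => char_div_lt hP hlev.le hc
      have hch : ∀ c < 128 * 2 ^ lev,
          P.char (fun k => P.vget τ.m (a + 2 * p * P.R + k)) c = P.char A c := by
        intro c hc
        have := hdiv c hc
        unfold char
        beta_reduce
        rw [h4.1, if_neg (by rintro ⟨q1, q2⟩; rcases hab with h | h <;>
          linarith [Nat.zero_le (p * P.R), Nat.zero_le (c / 2 ^ P.e)])]
      have hch' : ∀ c < 128 * 2 ^ lev,
          P.char (fun k => P.vget τ.m (a + (2 * p + 1) * P.R + k)) c = P.char A' c := by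
        intro c hc
        have := hdiv c hc
        unfold char
        beta_reduce
        rw [h4.1, if_neg (by rintro ⟨q1, q2⟩; rcases hab with h | h <;>
          linarith [Nat.zero_le (p * P.R), Nat.zero_le (c / 2 ^ P.e)])]
      have hi1 := hdiv (2 * i) (by omega)
      have hi2 := hdiv (2 * i + 1) (by omega)
      have hτ : ∀ {τ'}, τ.Same 27 τ' → Has P.w P.N τ' (rg 26 + rg 26) (2 * i) := fun h =>
        have h' := Has.of_same h (r := 26) (by norm_num) (by norm_num) h5
        (h'.add h' (by omega)).eq (by ring)
      have hτ' : ∀ {τ'}, τ.Same 27 τ' → Has P.w P.N τ' (rg 26 + rg 26 + 1) (2 * i + 1) := fun h =>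
        (hτ h).add (.lit (lit_lt hP (by norm_num))) (by omega)
      have h24' : ∀ {τ'}, τ.Same 27 τ' → Has P.w P.N τ' (rg 24) (a + 2 * p * P.R) := fun h =>
        Has.of_same h (by norm_num) (by norm_num) ((h3 24 (by norm_num)).trans r24)
      have h25' : ∀ {τ'}, τ.Same 27 τ' → Has P.w P.N τ' (rg 25) (a + (2 * p + 1) * P.R) := fun h =>
        Has.of_same h (by norm_num) (by norm_num) ((h3 25 (by norm_num)).trans r25)
      have s1 : τ.Same 27 (τ.set 27 (P.char A (2 * i))) := St.Same.refl.set le_rfl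
      have s2 := s1.set (d := 28) (v := P.char A (2 * i + 1)) (by norm_num)
      have s3 := s2.set (d := 29) (v := P.char A' (2 * i)) (by norm_num)
      have s4 := s3.set (d := 30) (v := P.char A' (2 * i + 1)) (by norm_num)
      have hEs : ∀ {τ' : St}, τ.Same 27 τ' → τ'.m = τ.m → P.Env t τ' := fun h hm =>
        hEτ.congr (by norm_num) h (by rw [hm]; exact fun _ _ => rfl)
      have c1 := (has_charE hP hEτ (h24' .refl) (hτ .refl) (by omega)).eq (hch _ (by omega))
      have c2 := (has_charE hP (hEs s1 rfl) (h24' s1) (hτ' s1) (by omega)).eq (hch _ (by omega))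
      have c3 := (has_charE hP (hEs s2 rfl) (h25' s2) (hτ s2) (by omega)).eq (hch' _ (by omega))
      have c4 := (has_charE hP (hEs s3 rfl) (h25' s3) (hτ' s3) (by omega)).eq (hch' _ (by omega))
      refine Ht.mono (Ht.assign_seq_has (by norm_num) c1 (Ht.assign_seq_has (by norm_num) c2
        (Ht.assign_seq_has (by norm_num) c3 (Ht.assign_seq_has (by norm_num) c4
        (ht_xorComp hP (hEs s4 rfl) (b := b + p * P.R) (n := n) (d := 64 * 2 ^ lev) (i := i)
          (c₀ := P.char A (2 * i)) (c₁ := P.char A (2 * i + 1)) (c₂ := P.char A' (2 * i))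
          (c₃ := P.char A' (2 * i + 1)) ?_ ?_ ?_ ?_ (by simp) (by simp) (by simp) (by simp)
          (char_lt _ _) (char_lt _ _) (char_lt _ _) (char_lt _ _) rfl (by omega) (by omega)
          (by omega) hn₀ hn' (fun k hk => h4.get hk)))))) ?_ ?_
      · rw [s4 23 (by norm_num), h3 23 (by norm_num), r23]
      · rw [s4 20 (by norm_num), h3 20 (by norm_num), r20]
      · rw [s4 21 (by norm_num), h3 21 (by norm_num), r21]
      · rw [s4 26 (by norm_num), h5]
      · have q1 : (charE (rg 24) (rg 26 + rg 26)).cost ≤ 80 := Nat.le_of_ble_eq_true rfl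
        have q2 : (charE (rg 24) (rg 26 + rg 26 + 1)).cost ≤ 80 := Nat.le_of_ble_eq_true rfl
        have q3 : (charE (rg 25) (rg 26 + rg 26)).cost ≤ 80 := Nat.le_of_ble_eq_true rfl
        have q4 : (charE (rg 25) (rg 26 + rg 26 + 1)).cost ≤ 80 := Nat.le_of_ble_eq_true rfl
        omega
      · rintro τ' ⟨h6, h7⟩
        refine ⟨⟨h3.trans ((s4.mono (by norm_num)).trans (h6.mono (by norm_num))), ?_⟩, ?_⟩
        · exact h4.trans h7
        · rw [h6 26 (by norm_num), s4 26 (by norm_num), h5]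
    · have q : (rg 21).cost = 1 := rfl
      rw [q]
      have : 64 * 2 ^ lev * (350 + 1400 * (P.D * ((P.Q + 1) * n)) + 1 + 8) ≤
          64 * 2 ^ lev * (1800 * (P.D * ((P.Q + 1) * n))) := Nat.mul_le_mul_left _ (by omega)
      omega
  · have q1 : (rg 17 + (rg 22 <<< rg 12)).cost = 5 := rfl
    have q2 : (rg 16 + ((rg 22 <<< 1) <<< rg 12)).cost = 7 := rfl
    have q3 : (rg 24 + (1 <<< rg 12)).cost = 5 := rfl
    have q4 : (rg 20).cost = 1 := rfl
    rw [q1, q2, q3, q4]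
    have q5 : n ≤ P.D * ((P.Q + 1) * n) := by
      calc n = 1 * (1 * n) := by ring
        _ ≤ _ := Nat.mul_le_mul P.D_pos (Nat.mul_le_mul_right _ (by omega))
    have q6 : P.D * ((P.Q + 1) * n) ≤ 2 ^ lev * (P.D * ((P.Q + 1) * n)) :=
      Nat.le_mul_of_pos_left _ (by positivity)
    have q7 : 64 * 2 ^ lev * (1800 * (P.D * ((P.Q + 1) * n))) =
      115200 * (2 ^ lev * (P.D * ((P.Q + 1) * n))) := by ring
    have q8 : 2000 * (64 * 2 ^ lev * (P.D * ((P.Q + 1) * n))) =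
      128000 * (2 ^ lev * (P.D * ((P.Q + 1) * n))) := by ring
    rw [q7, q8]
    omega

end Par

end WordRAM

/-! ### All levels of the tree -/

namespace WordRAM

open WordRAM.Expr

/-- The strings of `2^n` consecutive characters. -/
def treeOf {κ : ℕ} (f : ℕ → Fin (2 ^ κ)) : (n : ℕ) → ℕ → Tree κ n
  | 0, p => f p
  | n + 1, p => (treeOf f n (2 * p), treeOf f n (2 * p + 1))

theorem treeOf_inj {κ : ℕ} {f f' : ℕ → Fin (2 ^ κ)} : ∀ (n p : ℕ), treeOf f n p = treeOf f' n p →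
    ∀ i < 2 ^ n, f (p * 2 ^ n + i) = f' (p * 2 ^ n + i)
  | 0, p, h, i, hi => by
    obtain rfl : i = 0 := by simpa using hi
    simp only [pow_zero, mul_one, add_zero]
    exact h
  | n + 1, p, h, i, hi => by
    have h' : treeOf f n (2 * p) = treeOf f' n (2 * p) ∧
        treeOf f n (2 * p + 1) = treeOf f' n (2 * p + 1) := Prod.mk.inj h
    rw [pow_succ] at hi
    by_cases hin : i < 2 ^ n
    · have := treeOf_inj n (2 * p) h'.1 i hin
      have e : p * 2 ^ (n + 1) + i = 2 * p * 2 ^ n + i := by rw [pow_succ]; ring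
      rwa [e]
    · have := treeOf_inj n (2 * p + 1) h'.2 (i - 2 ^ n) (by omega)
      have e : p * 2 ^ (n + 1) + i = (2 * p + 1) * 2 ^ n + (i - 2 ^ n) := by
        rw [pow_succ, add_mul, one_mul, add_assoc, Nat.add_sub_cancel' (by omega)]
        ring
      rwa [e]

namespace Par
variable {P : Par} {t : ℕ → ℕ} {σ σ' : St}

variable (P) in
/-- The arrays from the entry `a` on are those of the strings of `2^n` characters. -/
def Arr (t : ℕ → ℕ) (f : ℕ → Fin (2 ^ P.κ)) (m : ℕ → ℕ) (a n : ℕ) : Prop :=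
  ∀ p < 2 ^ (P.lam - n), ∀ k < P.len n, P.vget m (a + p * P.R + k) = P.node t n (treeOf f n p) k

variable (P) in
/-- The memory agrees with `m₀` outside of the scratch region at `b`. -/
def Outside (m₀ : ℕ → ℕ) (b : ℕ) (m : ℕ → ℕ) : Prop :=
  (∀ v, v < b ∨ b + 2 ^ P.lam * P.R ≤ v → P.vget m v = P.vget m₀ v) ∧ ∀ a ≤ P.B + P.R, m a = m₀ a

theorem Acc.outside {m₀ m₁ m f : ℕ → ℕ} {b p n : ℕ} (h : P.Acc m₁ (b + p * P.R) n f m)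
    (hp : p < 2 ^ P.lam) (hn : n ≤ P.R) (h₀ : P.Outside m₀ b m₁) : P.Outside m₀ b m := by
  have h1 := Nat.mul_le_mul_right P.R hp
  rw [Nat.succ_mul] at h1
  refine ⟨fun v hv => ?_, fun a ha => (h.2 a ha).trans (h₀.2 a ha)⟩
  rw [h.1, if_neg (by omega), h₀.1 v hv]

variable (P) in
/-- The two scratch regions. -/
def Bases (a b : ℕ) : Prop :=
  (a = P.src ∧ b = P.src + 2 ^ P.lam * P.R) ∨ (a = P.src + 2 ^ P.lam * P.R ∧ b = P.src)

theorem two_regions_le (P : Par) : 2 * (2 ^ P.lam * P.R) ≤ P.size := by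
  refine le_trans ?_ P.pow_lam_mul_R_le
  rw [pow_add, mul_assoc]
  exact Nat.mul_le_mul_right _ (by norm_num)

theorem Bases.prop {a b : ℕ} (h : P.Bases a b) : P.src ≤ a ∧ P.src ≤ b ∧
    a + 2 ^ P.lam * P.R ≤ P.src + P.size ∧ b + 2 ^ P.lam * P.R ≤ P.src + P.size ∧
    (a + 2 ^ P.lam * P.R ≤ b ∨ b + 2 ^ P.lam * P.R ≤ a) := by
  have := P.two_regions_le
  rcases h with ⟨rfl, rfl⟩ | ⟨rfl, rfl⟩ <;> omega

theorem lam_lt (hP : P.Ok) : P.lam < P.w := by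
  have h1 : 2 ^ P.lam < 2 ^ P.w := size_lt hP (le_trans (by
    calc 2 ^ P.lam ≤ 2 ^ P.lam * P.R := Nat.le_mul_of_pos_right _ P.R_pos
      _ ≤ _ := Nat.le_mul_of_pos_left _ (by norm_num : 0 < 2)) P.two_regions_le)
  exact (Nat.pow_lt_pow_iff_right (by norm_num)).1 h1

theorem has_len (hP : P.Ok) (hE : P.Env t σ) {e : Expr} {n x : ℕ} (he : Has P.w P.N σ e x)
    (hx : x = P.lam - n) :
    Has P.w P.N σ ((((1 <<< rg 12) - 1) >>> e) + 1) (P.len n) := by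
  subst hx
  exact ((((has_R hP hE).sub (.lit (lit_lt hP (by norm_num))) P.R_pos).shr he).add
    (.lit (lit_lt hP (by norm_num))) ((len_le_R n).trans_lt (R_lt hP)))

variable [NeZero P.w]

/-- The number of nodes times the number of components is the same for all levels, namely `32 *
2^lam`, so the costs of two levels differ only through the array length `len (n + 1)`. -/
theorem ht_combLevel (hP : P.Ok) (hE : P.Env t σ) {f : ℕ → Fin (2 ^ P.κ)} {a b n : ℕ}
    (ha : σ.r 16 = a) (hb : σ.r 17 = b) (hl : σ.r 18 = n) (hn : n < P.lam) (hab : P.Bases a b)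
    (hA : P.Arr t f σ.m a n) :
    Ht P.w P.N (.seq (assign 19 (1 <<< (rg 1 - (rg 18 + 1))))
    (.seq (assign 20 ((((1 <<< rg 12) - 1) >>> (rg 1 - (rg 18 + 1))) + 1))
      (.seq (assign 21 (64 <<< rg 18)) (.seq (forLoop 22 (rg 19) combNode)
        (.seq (assign 22 (rg 16)) (.seq (assign 16 (rg 17)) (assign 17 (rg 22)))))))) σ
      (70000 * (2 ^ P.lam * (P.D * ((P.Q + 1) * P.len (n + 1))))) fun σ' => σ.Same 16 σ' ∧
        σ'.r 16 = b ∧ σ'.r 17 = a ∧ σ'.r 18 = n ∧ P.Arr t f σ'.m b (n + 1) ∧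
        P.Outside σ.m b σ'.m := by
  obtain ⟨ha₁, hb₁, ha₂, hb₂, hd⟩ := hab.prop
  have hw := lam_lt hP
  have hw' := Nat.lt_two_pow_self (n := P.w)
  have hX : 0 < P.D * ((P.Q + 1) * P.len (n + 1)) := by
    have := P.D_pos
    have : 0 < P.len (n + 1) := Nat.succ_pos _
    positivity
  have hpow := pow_lam_le hn
  have hd2 : 128 * 2 ^ n < 2 ^ P.w := size_lt hP (hpow.trans
    ((Nat.le_mul_of_pos_right _ P.R_pos).trans P.pow_lam_mul_R_le))
  have hexp : ∀ {τ}, σ.Same 19 τ → P.Env t τ →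
      Has P.w P.N τ (rg 1 - (rg 18 + 1)) (P.lam - (n + 1)) := fun h hE' =>
    (hE'.has (i := 1) (by norm_num)).sub ((Has.of_same h (by norm_num) (by norm_num) hl).add
      (.lit (lit_lt hP (by norm_num))) (by omega)) (by change n + 1 ≤ P.lam; omega)
  have e1 := Has.pow_two (by omega) (hexp .refl hE) (by omega)
  have hE₁ := hE.set (d := 19) (v := 2 ^ (P.lam - (n + 1))) (by norm_num)
  have s1 : σ.Same 19 (σ.set 19 (2 ^ (P.lam - (n + 1)))) := St.Same.refl.set le_rfl
  have e2 := has_len hP hE₁ (n := n + 1) (hexp s1 hE₁) rfl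
  have hE₂ := hE₁.set (d := 20) (v := P.len (n + 1)) (by norm_num)
  have s2 := s1.set (d := 20) (v := P.len (n + 1)) (by norm_num)
  have e3 : Has P.w P.N ((σ.set 19 (2 ^ (P.lam - (n + 1)))).set 20 (P.len (n + 1)))
      (64 <<< rg 18) (64 * 2 ^ n) := (Has.lit (lit_lt hP (by norm_num))).shl
    (Has.of_same s2 (by norm_num) (by norm_num) hl)
    (lt_of_le_of_lt (Nat.mul_le_mul_right _ (by norm_num)) hd2)
  have hE₃ := hE₂.set (d := 21) (v := 64 * 2 ^ n) (by norm_num)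
  have s3 := s2.set (d := 21) (v := 64 * 2 ^ n) (by norm_num)
  set σ₁ := ((σ.set 19 (2 ^ (P.lam - (n + 1)))).set 20 (P.len (n + 1))).set 21 (64 * 2 ^ n)
    with hσ₁
  have r19 : σ₁.r 19 = 2 ^ (P.lam - (n + 1)) := by simp [hσ₁]
  have r20 : σ₁.r 20 = P.len (n + 1) := by simp [hσ₁]
  have r21 : σ₁.r 21 = 64 * 2 ^ n := by simp [hσ₁]
  have hlen : 0 < P.len (n + 1) := Nat.succ_pos _
  have h2 : 2 * 2 ^ (P.lam - (n + 1)) = 2 ^ (P.lam - n) := by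
    rw [← pow_succ']
    congr 1
    omega
  have h3 : 2 ^ (P.lam - n) ≤ 2 ^ P.lam := Nat.pow_le_pow_right (by norm_num) (by omega)
  have hM : ∀ {p}, p < 2 ^ P.lam → p * P.R + P.R ≤ 2 ^ P.lam * P.R := fun {p} hp => by
    rw [← Nat.succ_mul]
    exact Nat.mul_le_mul_right _ hp
  refine Ht.mono (Ht.assign_seq_has (by norm_num) e1 (Ht.assign_seq_has (by norm_num) e2
    (Ht.assign_seq_has (by norm_num) e3 (Ht.seq (Ht.forLoop (n := 2 ^ (P.lam - (n + 1)))
    (T := 2000 * (64 * 2 ^ n * (P.D * ((P.Q + 1) * P.len (n + 1)))))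
    (fun p τ => σ₁.Same 22 τ ∧ P.Outside σ.m b τ.m ∧ ∀ p' < p, ∀ k < P.len (n + 1),
      P.vget τ.m (b + p' * P.R + k) = P.node t (n + 1) (treeOf f (n + 1) p') k)
    (by norm_num) (Nat.pow_lt_pow_right (by norm_num) (by omega)) ?_ ?_ ?_
    ⟨St.Same.refl, ⟨fun _ _ => rfl, fun _ _ => rfl⟩, by simp⟩) (T₂ := 6) ?_)))) ?_ (fun _ h => h)
  · rintro k τ τ' ha ⟨h4, h5⟩
    exact ⟨h4.agree (by norm_num) ha, by rwa [ha.2]⟩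
  · rintro k - τ ⟨h4, h5⟩
    exact Has.of_same h4 (by norm_num) (by norm_num) r19
  · rintro p hp τ ⟨h4, h5, h6⟩ h7
    have hsame : σ.Same 19 τ := s3.trans (h4.mono (by norm_num))
    have hEτ : P.Env t τ := hE.congr (by norm_num) hsame fun v hv =>
      h5.1 v (.inl (hv.trans_le (P.size_le_src.trans hb₁)))
    refine (ht_combNode hP hEτ ((hsame 16 (by norm_num)).trans ha) ((hsame 17 (by norm_num)).trans hb)
      h7 ((h4 20 (by norm_num)).trans r20) ((h4 21 (by norm_num)).trans r21) hn (by omega) ha₂ hb₁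
      hb₂ hd hlen (len_le_R _)).mono le_rfl ?_
    rintro τ' ⟨h8, h9⟩
    refine ⟨⟨h4.trans (h8.mono (by norm_num)), h9.outside (by omega) (len_le_R _) h5, ?_⟩, ?_⟩
    · intro p' hp' k hk
      by_cases hpp : p' = p
      · subst hpp
        rw [h9.get hk]
        refine comb_congr_len hP t hn.le ?_ ?_ k
        · intro k' hk'
          have := len_le_R (P := P) n
          have := hM (p := 2 * p') (by omega)
          rw [h5.1 _ (by omega)]
          exact hA (2 * p') (by omega) k' hk'
        · intro k' hk'
          have := len_le_R (P := P) n
          have := hM (p := 2 * p' + 1) (by omega)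
          rw [h5.1 _ (by omega)]
          exact hA (2 * p' + 1) (by omega) k' hk'
      · have h10 : (p' + 1) * P.R ≤ p * P.R := Nat.mul_le_mul_right _ (by omega)
        have := len_le_R (P := P) (n + 1)
        rw [Nat.succ_mul] at h10
        rw [h9.get_low (by omega)]
        exact h6 p' (by omega) k hk
    · rw [h8 22 (by norm_num), h7]
  · rintro τ ⟨h4, h5, h6⟩
    have hsame : σ.Same 19 τ := s3.trans (h4.mono (by norm_num))
    refine Ht.assign_seq_has (by norm_num) (Has.of_same hsame (by norm_num) (by norm_num) ha)
      (Ht.assign_seq_has (by norm_num) (Has.reg (x := b) (by norm_num)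
        (by simpa using (hsame 17 (by norm_num)).trans hb)) (Ht.assign_has (by norm_num)
        (Has.reg (x := a) (by norm_num) (by simp)) ⟨?_, by simp, by simp, ?_, h6, h5⟩))
    · exact (((hsame.mono (by norm_num)).set (by norm_num)).set (by norm_num)).set (by norm_num)
    · simpa using (hsame 18 (by norm_num)).trans hl
  · have q1 : (1 <<< (rg 1 - (rg 18 + 1))).cost = 7 := rfl
    have q2 : ((((1 <<< rg 12) - 1) >>> (rg 1 - (rg 18 + 1))) + 1).cost = 13 := rfl
    have q3 : (64 <<< rg 18).cost = 3 := rfl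
    have q4 : (rg 19).cost = 1 := rfl
    rw [q1, q2, q3, q4]
    set X := P.D * ((P.Q + 1) * P.len (n + 1)) with hXdef
    have q5 : 2 ^ (P.lam - (n + 1)) * 2 ^ n * 2 = 2 ^ P.lam := by
      rw [← pow_add, ← pow_succ]
      congr 1
      omega
    have q6 : 2 ^ (P.lam - (n + 1)) * (2000 * (64 * 2 ^ n * X) + 1 + 8) =
        64000 * (2 ^ P.lam * X) + 9 * 2 ^ (P.lam - (n + 1)) := by
      rw [← q5]
      ring
    have q7 : 2 ^ P.lam ≤ 2 ^ P.lam * X := Nat.le_mul_of_pos_right _ hX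
    have q8 : 1 ≤ 2 ^ (P.lam - (n + 1)) := Nat.one_le_two_pow
    rw [q6]
    omega

/-- A geometric series: split off the largest term `x` and apply induction to `x / 2`. With `x = R -
1` it bounds the sum of all array lengths by `lam + 2R`. -/
theorem sum_div_two_pow_le (x : ℕ) : ∀ n, ∑ k ∈ Finset.range n, x / 2 ^ (n - (k + 1)) + x / 2 ^ n ≤ 2 * x
  | 0 => by simp; omega
  | n + 1 => by
    have ih := sum_div_two_pow_le (x / 2) n
    rw [Finset.sum_range_succ]
    have h1 : ∀ k ∈ Finset.range n, x / 2 ^ (n + 1 - (k + 1)) = x / 2 / 2 ^ (n - (k + 1)) := by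
      intro k hk
      rw [Finset.mem_range] at hk
      rw [Nat.div_div_eq_div_mul, ← pow_succ']
      congr 2
      omega
    have h2 : x / 2 ^ (n + 1) = x / 2 / 2 ^ n := by rw [Nat.div_div_eq_div_mul, ← pow_succ']
    rw [Finset.sum_congr rfl h1, h2]
    simp only [Nat.sub_self, pow_zero, Nat.div_one]
    omega

/-- The two scratch regions exchange their roles after each level. -/
theorem ht_combLevels (hP : P.Ok) (hE : P.Env t σ) {f : ℕ → Fin (2 ^ P.κ)}
    (ha : σ.r 16 = P.src) (hb : σ.r 17 = P.src + 2 ^ P.lam * P.R) (hA : P.Arr t f σ.m P.src 0) :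
    Ht P.w P.N combLevels σ (70020 * (2 ^ P.lam * (P.D * ((P.Q + 1) * (P.lam + 2 * P.R))))) fun σ' =>
      σ.Same 16 σ' ∧ (∀ a ≤ P.B + P.R, σ'.m a = σ.m a) ∧
      (∀ v < P.src, P.vget σ'.m v = P.vget σ.m v) ∧ ∃ a b, P.Bases a b ∧ σ'.r 16 = a ∧
      σ'.r 17 = b ∧ P.Arr t f σ'.m a P.lam := by
  refine Ht.mono (Ht.forLoop_sum (n := P.lam)
    (T := fun n => 70000 * (2 ^ P.lam * (P.D * ((P.Q + 1) * P.len (n + 1)))))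
    (fun n τ => σ.Same 16 τ ∧ (∀ a ≤ P.B + P.R, τ.m a = σ.m a) ∧
      (∀ v < P.src, P.vget τ.m v = P.vget σ.m v) ∧ ∃ a b, P.Bases a b ∧ τ.r 16 = a ∧
      τ.r 17 = b ∧ P.Arr t f τ.m a n) (by norm_num) ((lam_lt hP).trans Nat.lt_two_pow_self) ?_ ?_ ?_
    ⟨.refl, fun _ _ => rfl, fun _ _ => rfl, _, _, .inl ⟨rfl, rfl⟩, ha, hb, hA⟩) ?_ (fun _ h => h)
  · rintro k τ τ' hag ⟨h1, h2, h3, a, b, h4, h5, h6, h7⟩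
    refine ⟨h1.agree (by norm_num) hag, by rwa [hag.2], by rwa [hag.2], a, b, h4,
      (hag.1 _ (by norm_num)).trans h5, (hag.1 _ (by norm_num)).trans h6, by rwa [hag.2]⟩
  · rintro k - τ ⟨h1, h2, h3, -⟩
    exact (hE.congr le_rfl h1 fun v hv => h3 v (hv.trans_le P.size_le_src)).has (i := 1) (by norm_num)
  · rintro n hn τ ⟨h1, h2, h3, a, b, h4, h5, h6, h7⟩ h8
    have hEτ := hE.congr le_rfl h1 fun v hv => h3 v (hv.trans_le P.size_le_src)
    refine (ht_combLevel hP hEτ h5 h6 h8 hn h4 h7).mono le_rfl ?_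
    rintro τ' ⟨g1, g2, g3, g4, g5, g6⟩
    refine ⟨⟨h1.trans g1, fun a ha => (g6.2 a ha).trans (h2 a ha), fun v hv => ?_, b, a, ?_, g2, g3,
      g5⟩, g4⟩
    · rw [g6.1 v (.inl (hv.trans_le h4.prop.2.1)), h3 v hv]
    · rcases h4 with h | h
      · exact .inr ⟨h.2, h.1⟩
      · exact .inl ⟨h.2, h.1⟩
  · have q : (rg 1).cost = 1 := rfl
    have h1 : ∑ k ∈ Finset.range P.lam, P.len (k + 1) ≤ P.lam + 2 * P.R := by
      simp only [len]
      rw [Finset.sum_add_distrib, Finset.sum_const, Finset.card_range]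
      have := sum_div_two_pow_le (P.R - 1) P.lam
      have := Nat.zero_le ((P.R - 1) / 2 ^ P.lam)
      simp only [smul_eq_mul, mul_one]
      omega
    have h2 : ∑ k ∈ Finset.range P.lam,
        (70000 * (2 ^ P.lam * (P.D * ((P.Q + 1) * P.len (k + 1)))) + 1 + 8) =
        70000 * (2 ^ P.lam * (P.D * ((P.Q + 1) * ∑ k ∈ Finset.range P.lam, P.len (k + 1)))) +
          9 * P.lam := by
      simp only [Finset.mul_sum, add_assoc, Finset.sum_add_distrib, Finset.sum_const,
        Finset.card_range, smul_eq_mul]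
      ring
    rw [q, h2]
    have h3 : P.D * ((P.Q + 1) * ∑ k ∈ Finset.range P.lam, P.len (k + 1)) ≤
        P.D * ((P.Q + 1) * (P.lam + 2 * P.R)) :=
      Nat.mul_le_mul_left _ (Nat.mul_le_mul_left _ h1)
    have h4 := Nat.mul_le_mul_left (2 ^ P.lam) h3
    have h5 : P.lam + 2 * P.R ≤ 2 ^ P.lam * (P.D * ((P.Q + 1) * (P.lam + 2 * P.R))) := by
      calc _ = 1 * (1 * (1 * (P.lam + 2 * P.R))) := by ring
        _ ≤ _ := Nat.mul_le_mul Nat.one_le_two_pow (Nat.mul_le_mul P.D_pos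
          (Nat.mul_le_mul_right _ (by omega)))
    have := P.R_pos
    omega

end Par

end WordRAM

/-! ### Reading the input, writing the output, and the evaluation time -/

namespace WordRAM

open WordRAM.Expr

theorem Ht.cond_lt {w N : ℕ} [NeZero w] {a b : Expr} {p q : Prog} {σ : St} {T x y : ℕ}
    {Q : St → Prop} (ha : Has w N σ a x) (hb : Has w N σ b y)
    (hp : x < y → ∀ v, Ht w N p (σ.set 63 v) T Q) (hq : y ≤ x → ∀ v, Ht w N q (σ.set 63 v) T Q) :
    Ht w N (WordRAM.cond (.bin .lt a b) p q) σ (a.cost + b.cost + 2 + (T + 1)) Q := by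
  have h := ha.lt hb
  refine Ht.cond h.1 (fun h1 => hp ?_ _) (fun h1 => hq ?_ _)
  · rw [h.2] at h1
    by_contra hcon
    simp [hcon] at h1
  · rw [h.2] at h1
    by_contra hcon
    simp [not_le.1 hcon] at h1

/-- A bit string that is split between two words. -/
theorem word_pair_eq {w κ x y o v : ℕ} (hκ : κ ≤ w) (ho : o < w) (hx : x < 2 ^ w) (hv : v < 2 ^ κ)
    (h : ∀ j < κ, v.testBit j = if o + j < w then x.testBit (o + j) else y.testBit (o + j - w)) :
    (x / 2 ^ o ||| y * 2 ^ (w - o) % 2 ^ w) % 2 ^ κ = v := by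
  apply Nat.eq_of_testBit_eq
  intro j
  rw [Nat.testBit_mod_two_pow]
  by_cases hj : j < κ
  · rw [h j hj, Nat.testBit_or, Nat.testBit_div_two_pow, Nat.testBit_mod_two_pow,
      Nat.testBit_mul_two_pow, add_comm j o]
    split_ifs with hlt
    · simp [hj, show ¬ (w - o ≤ j) by omega]
    · have h1 : x.testBit (o + j) = false := Nat.testBit_eq_false_of_lt
        (hx.trans_le (Nat.pow_le_pow_right (by norm_num) (by omega)))
      simp [hj, h1, show w - o ≤ j by omega, show j < w by omega,
        show j - (w - o) = o + j - w by omega]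
  · rw [Nat.testBit_eq_false_of_lt
      (hv.trans_le (Nat.pow_le_pow_right (by norm_num) (by omega : κ ≤ j)))]
    simp [hj]

namespace Par
variable {P : Par} {t : ℕ → ℕ} {σ σ' : St}

theorem κ_lt (hP : P.Ok) : P.κ < P.S ∧ P.κ < P.w := by
  have h1 := hP.L_le
  have h2 := lt_w hP
  have h3 : P.L = P.κ + 3 * P.β + 513 := rfl
  omega

/-- The input is shorter than the output and so fits into the same `R` words. -/
theorem key_div_lt (hP : P.Ok) {p : ℕ} (hp : p < 2 ^ P.lam) : p * P.κ / P.w < P.R := by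
  have hw := κ_lt hP
  rw [Nat.div_lt_iff_lt_mul (by omega)]
  have h1 := Nat.mul_lt_mul_of_pos_right hp hP.κ_pos
  have h2 := hP.out_le
  have h3 := Nat.mul_le_mul_left P.R (S_le hP)
  have h4 : 96 * 2 ^ P.lam * (P.κ + 13) = 2 ^ P.lam * P.κ + (95 * (2 ^ P.lam * P.κ) +
    1248 * 2 ^ P.lam) := by ring
  omega

theorem key_step {w κ p : ℕ} (hw : 0 < w) (j : ℕ) (hj : j ≤ w) :
    (p * κ % w + j < w → (p * κ + j) / w = p * κ / w ∧ (p * κ + j) % w = p * κ % w + j) ∧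
    (w ≤ p * κ % w + j → (p * κ + j) / w = p * κ / w + 1 ∧
      (p * κ + j) % w = p * κ % w + j - w) := by
  have h := Nat.div_add_mod (p * κ) w
  have ho := Nat.mod_lt (p * κ) hw
  set q := p * κ / w
  set o := p * κ % w
  constructor
  · intro hlt
    have e : p * κ + j = w * q + (o + j) := by omega
    rw [e, Nat.mul_add_div hw, Nat.mul_add_mod, Nat.div_eq_of_lt hlt, Nat.mod_eq_of_lt hlt]
    exact ⟨rfl, rfl⟩
  · intro hle
    have e : p * κ + j = w * (q + 1) + (o + j - w) := by rw [mul_add, mul_one]; omega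
    rw [e, Nat.mul_add_div hw, Nat.mul_add_mod, Nat.div_eq_of_lt (by omega),
      Nat.mod_eq_of_lt (by omega)]
    exact ⟨rfl, rfl⟩

theorem B_add_R_lt (hP : P.Ok) : P.B + P.R < P.N := by
  have := R_le_words hP
  unfold B N
  omega

/-- A character is shorter than a word and meets at most two words. The next word is always loaded,
even if it is not needed, which explains the extra reserved word; at offset `0` it is shifted by `w`
and vanishes. -/
theorem has_keyE (hP : P.Ok) (hE : P.Env t σ) {p v : ℕ} (hp : p < 2 ^ P.lam)
    (hm : ∀ a ≤ P.B + P.R, σ.m a < 2 ^ P.w) (h18 : σ.r 18 = P.B + p * P.κ / P.w) (h19 : σ.r 19 = p * P.κ % P.w)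
    (hv : v < 2 ^ P.κ) (hkey : ∀ j < P.κ, (σ.m (P.B + (p * P.κ + j) / P.w)).testBit
      ((p * P.κ + j) % P.w) = v.testBit j) : Has P.w P.N σ keyE v := by
  have hw := κ_lt hP
  have hq := key_div_lt hP hp
  have hN := B_add_R_lt hP
  have hN' := N_lt hP
  have ho : p * P.κ % P.w < P.w := Nat.mod_lt _ (by omega)
  have h1 : Has P.w P.N σ (rg 18) (P.B + p * P.κ / P.w) := .reg (by norm_num) h18
  have h2 : Has P.w P.N σ (rg 19) (p * P.κ % P.w) := .reg (by norm_num) h19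
  have h3 : Has P.w P.N σ (rg 3) P.w := hE.has (i := 3) (by norm_num)
  have h4 : Has P.w P.N σ (rg 2) P.κ := hE.has (i := 2) (by norm_num)
  refine ((((h1.load (by omega)).shr h2).or (((h1.add (.lit (lit_lt hP (by norm_num)))
    (by omega)).load (by omega)).shl_mod (h3.sub h2 ho.le))).mask h4 hw.2).eq ?_
  refine word_pair_eq hw.2.le ho (hm _ (by omega)) hv fun j hj => ?_
  rw [← hkey j hj]
  have hs := key_step (p := p) (κ := P.κ) (w := P.w) (by omega) j (by omega)
  split_ifs with h
  · rw [(hs.1 h).1, (hs.1 h).2]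
  · rw [(hs.2 (by omega)).1, (hs.2 (by omega)).2]
    rfl

variable [NeZero P.w]

/-- Registers `18` and `19` follow the quotient and the remainder of the bit position `p * κ` by
`w`. As `κ < w`, each step passes at most one word boundary, and no division is needed. -/
theorem ht_leaves (hP : P.Ok) (hE : P.Env t σ) {f : ℕ → Fin (2 ^ P.κ)} (ha : σ.r 16 = P.src)
    (hm : ∀ a ≤ P.B + P.R, σ.m a < 2 ^ P.w)
    (hkey : ∀ p < 2 ^ P.lam, ∀ j < P.κ, (σ.m (P.B + (p * P.κ + j) / P.w)).testBit
      ((p * P.κ + j) % P.w) = (f p).val.testBit j) :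
    Ht P.w P.N leaves σ (600 * (2 ^ P.lam * P.R)) fun σ' => σ.Same 18 σ' ∧
      P.Outside σ.m P.src σ'.m ∧ P.Arr t f σ'.m P.src 0 := by
  have hw := κ_lt hP
  have hlt : ∀ {x}, x < P.src + P.size → x < 2 ^ P.w := vaddr_lt hP
  have h2r := P.two_regions_le
  have hN := B_add_R_lt hP
  have hN' := N_lt hP
  have hR := P.R_pos
  have hM : ∀ {p}, p < 2 ^ P.lam → p * P.R + P.R ≤ 2 ^ P.lam * P.R := fun {p} hp => by
    rw [← Nat.succ_mul]
    exact Nat.mul_le_mul_right _ hp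
  have hlen := len_le_R (P := P) 0
  have hlen0 : 0 < P.len 0 := Nat.succ_pos _
  refine Ht.mono (Ht.assign_seq_has (by norm_num) (hE.has (i := 0) (by norm_num))
    (Ht.assign_seq_has (by norm_num) (.lit (lit_lt hP (by norm_num))) (Ht.forLoop (n := 2 ^ P.lam)
    (T := 500 * P.R) (fun p τ => σ.Same 18 τ ∧ τ.r 18 = P.B + p * P.κ / P.w ∧
      τ.r 19 = p * P.κ % P.w ∧ P.Outside σ.m P.src τ.m ∧ ∀ p' < p, ∀ k < P.len 0,
      P.vget τ.m (P.src + p' * P.R + k) = P.node t 0 (f p') k)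
    (by norm_num) (Nat.pow_lt_pow_right (by norm_num) (lam_lt hP)) ?_ ?_ ?_
    ⟨(St.Same.refl.set le_rfl).set (by norm_num), by simp [param], by simp,
      ⟨fun _ _ => rfl, fun _ _ => rfl⟩, by simp⟩))) ?_
    (fun σ' h => ⟨h.1, h.2.2.2.1, h.2.2.2.2⟩)
  · rintro k τ τ' hag ⟨h1, h2, h3, h4⟩
    exact ⟨h1.agree (by norm_num) hag, (hag.1 _ (by norm_num)).trans h2,
      (hag.1 _ (by norm_num)).trans h3, by rwa [hag.2]⟩
  · rintro k - τ ⟨h1, -, -, h4, -⟩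
    exact Has.pow_two (by omega) ((hE.congr (by norm_num) h1 fun v hv =>
      h4.1 v (.inl (hv.trans_le P.size_le_src))).has (i := 1) (by norm_num)) (lam_lt hP)
  · rintro p hp τ ⟨h1, h2, h3, h4, h5⟩ h6
    have hMp := hM hp
    have hEτ := hE.congr (by norm_num) h1 fun v hv => h4.1 v (.inl (hv.trans_le P.size_le_src))
    have e1 : Has P.w P.N τ (rg 16 + (rg 20 <<< rg 12)) (P.src + p * P.R) :=
      (Has.of_same h1 (by norm_num) (by norm_num) ha).add ((Has.reg (by norm_num) h6).shl
        (hEτ.has (i := 12) (by norm_num)) (by change p * P.R < _; exact hlt (by omega)))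
        (hlt (by omega))
    have hE₁ := hEτ.set (d := 22) (v := P.src + p * P.R) (by norm_num)
    refine Ht.mono (Ht.assign_seq_has (by norm_num) e1 (Ht.seq (ht_clear hP hE₁ (n := P.len 0)
      (b := P.src + p * P.R) (by norm_num) (by norm_num) (by norm_num) (by simp) (by omega)
      (by omega) (fun τ' _ hE' => has_len hP hE' (hE'.has (i := 1) (by norm_num)) rfl))
      (T₂ := 150) ?_)) ?_ (fun _ h => h)
    · rintro τ₁ ⟨h7, h8⟩
      have hs : τ.Same 22 τ₁ := (St.Same.refl.set le_rfl).trans (h7.mono (by norm_num))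
      have ho₁ := h8.outside hp hlen h4
      have hE₂ := hE.congr (by norm_num) (h1.trans (hs.mono (by norm_num))) fun v hv =>
        ho₁.1 v (.inl (hv.trans_le P.size_le_src))
      have hkE : Has P.w P.N τ₁ keyE (f p) := by
        refine has_keyE hP hE₂ hp (fun a ha => ?_) ((hs 18 (by norm_num)).trans h2)
          ((hs 19 (by norm_num)).trans h3) (f p).2 fun j hj => ?_
        · rw [ho₁.2 a ha]
          exact hm a ha
        · have h11 := key_step (p := p) (κ := P.κ) (w := P.w) (by omega) j (by omega)
          have hq := key_div_lt hP hp
          rw [ho₁.2, hkey p hp j hj]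
          rcases lt_or_ge (p * P.κ % P.w + j) P.w with h | h
          · rw [(h11.1 h).1]
            omega
          · rw [(h11.2 h).1]
            omega
      have hb : Has P.w P.N τ₁ (rg 22) (P.src + p * P.R) :=
        .reg (by norm_num) ((h7 22 (by norm_num)).trans (by simp))
      refine Ht.mono (Ht.seq (ht_vset hP hE₂ hb (by omega) hkE ((f p).2.trans
        (Nat.pow_lt_pow_right (by norm_num) hw.1)) (Q := fun τ₂ => τ₁.Same 64 τ₂ ∧
          P.Acc τ.m (P.src + p * P.R) (P.len 0) (P.node t 0 (f p)) τ₂.m) ?_) (T₂ := 30) ?_)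
        (by exact Nat.le_of_ble_eq_true rfl) (fun _ h => h)
      · intro m' hm'
        exact ⟨.refl, (h8.upd (by omega) (k := 0) hlen0 hm').congr fun k hk => rfl⟩
      · rintro τ₂ ⟨h9, h10⟩
        have ho₂ := h10.outside hp hlen h4
        have hs₂ : τ.Same 22 τ₂ := hs.trans (h9.mono (by norm_num))
        have hE₃ := hE.congr (by norm_num) (h1.trans (hs₂.mono (by norm_num))) fun v hv =>
          ho₂.1 v (.inl (hv.trans_le P.size_le_src))
        have hst := key_step (p := p) (κ := P.κ) (w := P.w) (by omega) P.κ hw.2.le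
        have ho : p * P.κ % P.w < P.w := Nat.mod_lt _ (by omega)
        have hww := Nat.lt_two_pow_self (n := P.w)
        have hq := key_div_lt hP hp
        have hnode : ∀ p' < p + 1, ∀ k < P.len 0,
            P.vget τ₂.m (P.src + p' * P.R + k) = P.node t 0 (f p') k := by
          intro p' hp' k hk
          by_cases hpp : p' = p
          · subst hpp
            exact h10.get hk
          · have h11 : (p' + 1) * P.R ≤ p * P.R := Nat.mul_le_mul_right _ (by omega)
            rw [Nat.succ_mul] at h11
            rw [h10.get_low (by omega)]
            exact h5 p' (by omega) k hk
        have r19 : ∀ {τ'}, τ₂.Same 63 τ' → Has P.w P.N τ' (rg 19) (p * P.κ % P.w) := fun h =>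
          Has.of_same h (by norm_num) (by norm_num) ((hs₂ 19 (by norm_num)).trans h3)
        have r3 : ∀ {τ'}, τ₂.Same 63 τ' → Has P.w P.N τ' (rg 3) P.w := fun h =>
          Has.of_same h (by norm_num) (by norm_num) (hE₃.reg 3 (by norm_num))
        have r2 : ∀ {τ'}, τ₂.Same 63 τ' → Has P.w P.N τ' (rg 2) P.κ := fun h =>
          Has.of_same h (by norm_num) (by norm_num) (hE₃.reg 2 (by norm_num))
        refine Ht.mono (Ht.cond_lt (r2 .refl) ((r3 .refl).sub (r19 .refl) ho.le) (T := 20)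
          (fun hc v => ?_) (fun hc v => ?_)) (Nat.le_of_ble_eq_true rfl) (fun _ h => h)
        · have hs₃ : τ₂.Same 63 (τ₂.set 63 v) := St.Same.refl.set le_rfl
          refine Ht.mono (Ht.assign_has (by norm_num) ((r19 hs₃).add (r2 hs₃) (by omega))
            ⟨⟨((h1.trans (hs₂.mono (by norm_num))).trans (hs₃.mono (by norm_num))).set
              (by norm_num), ?_, ?_, ho₂, hnode⟩, ?_⟩) (Nat.le_of_ble_eq_true rfl) (fun _ h => h)
          · rw [Nat.succ_mul, (hst.1 (by omega)).1]
            simpa using (hs₂ 18 (by norm_num)).trans h2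
          · rw [Nat.succ_mul, (hst.1 (by omega)).2]
            simp
          · simpa using (hs₂ 20 (by norm_num)).trans h6
        · have hs₃ : τ₂.Same 63 (τ₂.set 63 v) := St.Same.refl.set le_rfl
          have hs₄ : τ₂.Same 19 ((τ₂.set 63 v).set 19 (P.κ - (P.w - p * P.κ % P.w))) :=
            (hs₃.mono (by norm_num)).set le_rfl
          refine Ht.mono (Ht.assign_seq_has (by norm_num) ((r2 hs₃).sub ((r3 hs₃).sub (r19 hs₃)
            ho.le) hc) (Ht.assign_has (by norm_num) ((Has.of_same hs₄ (by norm_num) (by norm_num)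
            ((hs₂ 18 (by norm_num)).trans h2)).add (.lit (lit_lt hP (by norm_num))) (by omega))
            ⟨⟨((h1.trans (hs₂.mono (by norm_num))).trans (hs₄.mono (by norm_num))).set
              (by norm_num), ?_, ?_, ho₂, hnode⟩, ?_⟩)) (Nat.le_of_ble_eq_true rfl) (fun _ h => h)
          · rw [Nat.succ_mul, (hst.2 (by omega)).1]
            simp [add_assoc]
          · rw [Nat.succ_mul, (hst.2 (by omega)).2]
            simp
            omega
          · simpa using (hs₂ 20 (by norm_num)).trans h6
    · have q1 : (rg 16 + (rg 20 <<< rg 12)).cost = 5 := rfl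
      have q2 : (((1 <<< rg 12) - 1) >>> rg 1 + 1).cost = 9 := rfl
      rw [q1, q2]
      omega
  · have q1 : (rg 0).cost = 1 := rfl
    have q2 : (0 : Expr).cost = 1 := rfl
    have q3 : (1 <<< rg 1).cost = 3 := rfl
    rw [q1, q2, q3]
    have : 2 ^ P.lam ≤ 2 ^ P.lam * P.R := Nat.le_mul_of_pos_right _ hR
    have : 1 ≤ 2 ^ P.lam := Nat.one_le_two_pow
    have : 2 ^ P.lam * (500 * P.R + 3 + 8) = 500 * (2 ^ P.lam * P.R) + 11 * 2 ^ P.lam := by ring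
    omega

omit [NeZero P.w] in
theorem addr_lt_B {v : ℕ} (hv : v < P.size) : 16 + v / 2 ^ P.sr < P.B := by
  have : v / 2 ^ P.sr ≤ (P.size - 1) / 2 ^ P.sr := Nat.div_le_div_right (by omega)
  unfold B words
  omega

omit [NeZero P.w] in
theorem vget_congr {m m' : ℕ → ℕ} {v : ℕ} (h : m (16 + v / 2 ^ P.sr) = m' (16 + v / 2 ^ P.sr)) :
    P.vget m v = P.vget m' v := by
  unfold vget
  rw [h]

theorem ht_output (hP : P.Ok) (hE : P.Env t σ) {a : ℕ} (ha : σ.r 16 = a) (ha₁ : P.src ≤ a)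
    (ha₂ : a + P.R ≤ P.src + P.size) :
    Ht P.w P.N (forLoop 18 (1 <<< rg 12) (write (rg 0 + rg 18) (vld (rg 16 + rg 18)))) σ
      (100 * P.R) fun σ' => (∀ x < P.B, σ'.m x = σ.m x) ∧
        ∀ k < P.R, σ'.m (P.B + k) = P.vget σ.m (a + k) := by
  have hlt : ∀ {x}, x < P.src + P.size → x < 2 ^ P.w := vaddr_lt hP
  have hN := B_add_R_lt hP
  have hN' := N_lt hP
  refine Ht.mono (Ht.forLoop (n := P.R) (T := 60) (fun k τ => σ.Same 18 τ ∧
    (∀ v ≥ P.src, P.vget τ.m v = P.vget σ.m v) ∧ (∀ x < P.B, τ.m x = σ.m x) ∧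
    ∀ k' < k, τ.m (P.B + k') = P.vget σ.m (a + k')) (by norm_num) (R_lt hP) ?_ ?_ ?_
    ⟨.refl, fun _ _ => rfl, fun _ _ => rfl, by simp⟩) ?_ (fun _ h => h.2.2)
  · rintro k τ τ' hag ⟨h1, h2⟩
    exact ⟨h1.agree (by norm_num) hag, by rwa [hag.2]⟩
  · rintro k - τ ⟨h1, h2, h3, -⟩
    exact has_R hP (hE.congr (by norm_num) h1 fun v hv => vget_congr (h3 _ (addr_lt_B hv)))
  · rintro k hk τ ⟨h1, h2, h3, h4⟩ h5
    have hEτ := hE.congr (by norm_num) h1 fun v hv => vget_congr (h3 _ (addr_lt_B hv))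
    have hk' : Has P.w P.N τ (rg 18) k := .reg (by norm_num) h5
    have h0 : Has P.w P.N τ (rg 0) P.B := hEτ.has (i := 0) (by norm_num)
    have hv := has_vld hP hEτ ((Has.of_same h1 (by norm_num) (by norm_num) ha).add hk'
      (hlt (by omega))) (by omega)
    rw [h2 _ (by omega)] at hv
    refine Ht.mono (Ht.write_has (h0.add hk' (by omega)) hv (by omega)
      ⟨⟨h1, fun v hv => ?_, fun x hx => ?_, fun k' hk' => ?_⟩, h5⟩) (Nat.le_of_ble_eq_true rfl)
      (fun _ h => h)
    · rw [← h2 v hv]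
      have := addr_ge hv
      exact vget_congr (by rw [St.put_m, if_neg (by omega)])
    · rw [St.put_m, if_neg (by omega), h3 x hx]
    · rw [St.put_m]
      split_ifs with h
      · rw [show k' = k by omega]
      · exact h4 k' (by omega)
  · have q : (1 <<< rg 12).cost = 3 := rfl
    have := P.R_pos
    rw [q]
    omega

omit [NeZero P.w] in
theorem ht_loadParams {w N : ℕ} [NeZero w] (hN : N < 2 ^ w) : ∀ n ≤ 16, n ≤ N → ∀ {σ : St},
    Ht w N (loadParams n) σ (3 * n + 1) fun σ' => σ'.m = σ.m ∧ ∀ r < n, σ'.r r = σ.m r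
  | 0, _, _, σ => Ht.skip ⟨rfl, by simp⟩
  | n + 1, h, hnN, σ => by
    refine Ht.mono (Ht.seq (ht_loadParams hN n (by omega) (by omega)) (T₂ := 3) ?_) (by omega)
      (fun _ h => h)
    rintro τ ⟨h1, h2⟩
    refine Ht.assign_has (by omega) (Has.load (x := n) ⟨by simp only [ok]; omega, rfl⟩ (by omega)) ⟨h1, ?_⟩
    intro r hr
    rw [St.set_r]
    split_ifs with h3
    · rw [h3, h1]
    · exact h2 r (by omega)

variable (P) in
/-- A bound for the evaluation time. -/
def evalTime : ℕ := 71000 * (2 ^ P.lam * (P.D * ((P.Q + 1) * (P.lam + 2 * P.R))))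

theorem ht_evalProg (hP : P.Ok) {f : ℕ → Fin (2 ^ P.κ)} (hpar : ∀ r < 16, σ.m r = P.param r)
    (ht : ∀ v < P.size, P.vget σ.m v = t v) (hm : ∀ a ≤ P.B + P.R, σ.m a < 2 ^ P.w)
    (hkey : ∀ p < 2 ^ P.lam, ∀ j < P.κ, (σ.m (P.B + (p * P.κ + j) / P.w)).testBit
      ((p * P.κ + j) % P.w) = (f p).val.testBit j) :
    Ht P.w P.N evalProg σ P.evalTime fun σ' => (∀ x < P.B, σ'.m x = σ.m x) ∧
      ∀ k < P.R, σ'.m (P.B + k) = P.node t P.lam (treeOf f P.lam 0) k := by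
  have h2r := P.two_regions_le
  have hN : 16 ≤ P.N := by unfold N; omega
  have hX : 2 ^ P.lam * (2 * P.R) ≤ 2 ^ P.lam * (P.D * ((P.Q + 1) * (P.lam + 2 * P.R))) := by
    refine Nat.mul_le_mul_left _ ?_
    calc 2 * P.R = 1 * (1 * (2 * P.R)) := by ring
      _ ≤ _ := Nat.mul_le_mul P.D_pos (Nat.mul_le_mul (by omega) (by omega))
  have hRM : P.R ≤ 2 ^ P.lam * P.R := Nat.le_mul_of_pos_left _ (by positivity)
  have hR := P.R_pos
  refine Ht.mono (Ht.seq (ht_loadParams (N_lt hP) 16 le_rfl hN) (T₂ := 700 * (2 ^ P.lam * P.R) +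
    70020 * (2 ^ P.lam * (P.D * ((P.Q + 1) * (P.lam + 2 * P.R)))) + 4) ?_) ?_ (fun _ h => h)
  · rintro τ ⟨h1, h2⟩
    have hE : P.Env t τ := ⟨fun r hr => (h2 r hr).trans (hpar r hr), fun v hv => by
      rw [h1]; exact ht v hv⟩
    have hE₁ := hE.set (d := 16) (v := P.src) (by norm_num)
    have hE₂ := hE₁.set (d := 17) (v := P.src + 2 ^ P.lam * P.R) (by norm_num)
    refine Ht.mono (Ht.assign_seq_has (by norm_num) (hE.has (i := 13) (by norm_num))
      (Ht.assign_seq_has (by norm_num) (hE₁.has (i := 14) (by norm_num)) (Ht.seq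
      (ht_leaves hP hE₂ (f := f) (by simp) (by simpa [h1] using hm) (by simpa [h1] using hkey))
      (T₂ := 100 * (2 ^ P.lam * P.R) +
        70020 * (2 ^ P.lam * (P.D * ((P.Q + 1) * (P.lam + 2 * P.R))))) ?_))) ?_ (fun _ h => h)
    · rintro τ₁ ⟨h3, h4, h5⟩
      have hE₃ := hE₂.congr (by norm_num) h3 fun v hv => h4.1 v (.inl (hv.trans_le P.size_le_src))
      refine Ht.mono (Ht.seq (ht_combLevels hP hE₃ ((h3 16 (by norm_num)).trans (by simp))
        ((h3 17 (by norm_num)).trans (by simp)) h5) (T₂ := 100 * P.R) ?_) (by omega) (fun _ h => h)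
      rintro τ₂ ⟨h6, h7, h8, a, b, h9, h10, h11, h12⟩
      have hE₄ := hE₃.congr (by norm_num) h6 fun v hv => h8 v (hv.trans_le P.size_le_src)
      have hb := h9.prop
      refine (ht_output hP hE₄ h10 hb.1 (by omega)).mono le_rfl ?_
      rintro τ₃ ⟨h13, h14⟩
      constructor
      · intro x hx
        rw [h13 x hx, h7 x (by omega), h4.2 x (by omega)]
        exact congrFun h1 x
      · intro k hk
        rw [h14 k hk]
        have hlen : P.len P.lam = P.R := by
          unfold len
          rw [Nat.sub_self, pow_zero, Nat.div_one]
          omega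
        simpa using h12 0 (by positivity) k (by rwa [hlen])
    · have q1 : (rg 13).cost = 1 := rfl
      have q2 : (rg 14).cost = 1 := rfl
      rw [q1, q2]
      omega
  · unfold evalTime
    have : 2 ^ P.lam * (2 * P.R) = 2 * (2 ^ P.lam * P.R) := by ring
    omega

variable (P) in
/-- The characters of a string, as numbers. -/
def keyNum (x : BitStrings P.κ (2 ^ P.lam)) (p : ℕ) : Fin (2 ^ P.κ) :=
  if h : p < 2 ^ P.lam then ⟨Nat.ofBits (x ⟨p, h⟩), Nat.ofBits_lt_two_pow _⟩ else ⟨0, by positivity⟩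

variable (P) in
/-- A string as a tree. -/
def toTree (x : BitStrings P.κ (2 ^ P.lam)) : Tree P.κ P.lam := treeOf (P.keyNum x) P.lam 0

omit [NeZero P.w] in
theorem toTree_injective : P.toTree.Injective := by
  intro x y h
  funext ⟨p, hp⟩ j
  have := treeOf_inj P.lam 0 h p hp
  rw [zero_mul, zero_add, keyNum, keyNum, dif_pos hp, dif_pos hp, Fin.mk.injEq] at this
  have h2 := congrArg (fun n => n.testBit j) this
  simpa using h2

/-- The represented function depends only on the table stored in the first `B` cells, which the
evaluation leaves unchanged. -/
theorem represents (hP : P.Ok) (M : ℕ → BitVec P.w) (hpar : ∀ r < 16, (M r).toNat = P.param r) :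
    Represents evalProg P.N P.B P.evalTime M
      fun x => P.out (P.vget fun a => (M a).toNat) (P.toTree x) := by
  intro x s hs hB hx
  have hp16 : 16 ≤ P.B := by unfold B; omega
  obtain ⟨s', h1, ⟨h2, h3⟩, h4⟩ := ht_evalProg (σ := s.view) (t := P.vget fun a => (M a).toNat)
    (f := P.keyNum x) hP (fun r hr => by
      rw [← hpar r hr, ← hs r (by omega)]
      rfl)
    (fun v hv => vget_congr (by
      rw [← hs _ (addr_lt_B hv)]
      rfl))
    (fun a _ => view_lt_m a)
    (fun p hp j hj => by
      have h := hx ⟨p, hp⟩ ⟨j, hj⟩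
      rw [keyNum, dif_pos hp]
      simp only [Nat.testBit_ofBits_lt _ _ hj]
      exact h) s rfl
  refine ⟨s', h1, fun a ha => ?_, fun c b => ?_, ?_⟩
  · rw [← hs a ha]
    exact BitVec.eq_of_toNat_eq (h2 a ha)
  · have h := outPos_lt hP c.2 b.2
    have h5 := h3 _ h.1
    change ((s'.mem _).toNat).testBit _ = _
    exact congrArg (fun n => n.testBit ((c * (2 * P.κ + 26) + b) % P.w)) h5
  · exact_mod_cast h4

end Par

end WordRAM

/-! ### Random filling of the table -/

section uniform
variable {A B C : Type*} [Fintype A] [Nonempty A] [Fintype B] [Nonempty B]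

theorem PMF.map_uniformOfFintype_of_bijective {f : A → B} (hf : f.Bijective) :
    (PMF.uniformOfFintype A).map f = PMF.uniformOfFintype B := by
  classical
  ext b
  obtain ⟨a, rfl⟩ := hf.2 b
  rw [PMF.map_apply, tsum_eq_single a]
  · simp [Fintype.card_of_bijective hf]
  · intro a' ha'
    rw [if_neg fun h => ha' (hf.1 h.symm)]

theorem PMF.bind_uniformOfFintype_map (f : A → B → C) :
    ((PMF.uniformOfFintype A).bind fun a => (PMF.uniformOfFintype B).map (f a)) =
      (PMF.uniformOfFintype (A × B)).map fun p => f p.1 p.2 := by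
  have h : ((PMF.uniformOfFintype A).bind fun a => (PMF.uniformOfFintype B).map (Prod.mk a)) =
      PMF.uniformOfFintype (A × B) := by
    classical
    ext ⟨a, b⟩
    rw [PMF.bind_apply, tsum_eq_single a]
    · rw [PMF.map_apply, tsum_eq_single b]
      · simp only [PMF.uniformOfFintype_apply, if_true, Fintype.card_prod, Nat.cast_mul]
        rw [ENNReal.mul_inv] <;> simp
      · intro b' hb'
        rw [if_neg fun h => hb' (by simpa using h.symm)]
    · intro a' ha'
      rw [PMF.map_apply]
      simp [ha'.symm]
  rw [← h, PMF.map_bind]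
  simp only [PMF.map_comp]
  rfl

end uniform

namespace WordRAM

section exec
variable {w N : ℕ} {A B : Type*} [Fintype A] [Nonempty A] [Fintype B] [Nonempty B]
  {p q : Prog} {s : State w} {F : A → State w}

theorem mem_support_map_uniform {t : State w}
    (h : t ∈ ((PMF.uniformOfFintype A).map F).support) : ∃ a, F a = t := by
  simpa [PMF.support_map] using h

/-- A random program followed by a deterministic one. -/
theorem exec_seq_map {Q : State w → State w → Prop}
    (hp : Exec N p s ((PMF.uniformOfFintype A).map F))
    (hq : ∀ a, ∃ t, Run N q (F a) t ∧ Q (F a) t) :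
    ∃ F' : A → State w, Exec N (.seq p q) s ((PMF.uniformOfFintype A).map F') ∧
      ∀ a, Q (F a) (F' a) := by
  have h : ∀ u, ∃ t, (∃ a, F a = u) → Run N q u t ∧ Q u t := by
    intro u
    by_cases hu : ∃ a, F a = u
    · obtain ⟨a, rfl⟩ := hu
      obtain ⟨t, ht⟩ := hq a
      exact ⟨t, fun _ => ht⟩
    · exact ⟨u, fun h => absurd h hu⟩
  choose g hg using h
  refine ⟨fun a => g (F a), ?_, fun a => (hg _ ⟨a, rfl⟩).2⟩
  have := Exec.seq s p q _ (fun u => PMF.pure (g u)) hp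
    fun t ht => (hg t (mem_support_map_uniform ht)).1
  rwa [PMF.bind_map] at this

/-- The first pass through a loop with a random body. -/
theorem exec_while_map {r : ℕ} {Q : State w → B → State w → Prop} (hr : s.regs r ≠ 0)
    (hp : Exec N p s.tick ((PMF.uniformOfFintype A).map F))
    (hq : ∀ a, ∃ G : B → State w, Exec N (.while r p) (F a) ((PMF.uniformOfFintype B).map G) ∧
      ∀ b, Q (F a) b (G b)) :
    ∃ F' : A × B → State w, Exec N (.while r p) s ((PMF.uniformOfFintype (A × B)).map F') ∧
      ∀ a b, Q (F a) b (F' (a, b)) := by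
  have h : ∀ u, ∃ G : B → State w, (∃ a, F a = u) →
      Exec N (.while r p) u ((PMF.uniformOfFintype B).map G) ∧ ∀ b, Q u b (G b) := by
    intro u
    by_cases hu : ∃ a, F a = u
    · obtain ⟨a, rfl⟩ := hu
      obtain ⟨t, ht⟩ := hq a
      exact ⟨t, fun _ => ht⟩
    · exact ⟨fun _ => u, fun h => absurd h hu⟩
  choose g hg using h
  refine ⟨fun p => g (F p.1) p.2, ?_, fun a b => (hg _ ⟨a, rfl⟩).2 b⟩
  have := Exec.while_true s r p _ (fun u => (PMF.uniformOfFintype B).map (g u)) hr hp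
    fun t ht => (hg t (mem_support_map_uniform ht)).1
  rw [PMF.bind_map] at this
  rwa [← PMF.bind_uniformOfFintype_map fun a b => g (F a) b]

/-- A random word is a uniformly random bit string. -/
theorem exec_rand_bits {d a : ℕ} (ha : (s.regs a).toNat = 2 ^ w - 1) :
    Exec N (.rand d a) s ((PMF.uniformOfFintype (Fin w → Bool)).map
      fun g => s.tick.setReg d (BitVec.ofNat w (Nat.ofBits g))) := by
  have h : Exec N (.rand d a) s (((PMF.uniformOfFintype (Fin ((s.regs a).toNat + 1))).map
      Fin.val).map fun i => s.tick.setReg d (BitVec.ofNat w i)) := Exec.rand s d a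
  have hk : (s.regs a).toNat + 1 = 2 ^ w := by
    rw [ha]
    exact Nat.sub_add_cancel Nat.one_le_two_pow
  have hb : Function.Bijective fun g : Fin w → Bool =>
      (⟨Nat.ofBits g, by rw [hk]; exact Nat.ofBits_lt_two_pow g⟩ : Fin ((s.regs a).toNat + 1)) := by
    rw [Fintype.bijective_iff_injective_and_card]
    refine ⟨fun g g' hg => ?_, by simp [hk]⟩
    funext i
    have := congrArg (fun n => n.val.testBit i) hg
    simpa [Nat.testBit_ofBits_lt _ _ i.2] using this
  rw [← PMF.map_uniformOfFintype_of_bijective hb, PMF.map_comp, PMF.map_comp] at h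
  exact h

end exec

/-- The condition of the loop that fills the table. -/
def fillCond : Expr := .bin .lt (.rg 28) (.rg 0)

/-- Store a random word, and go to the next one. -/
def fillStep : Prog :=
  .seq (.seq (.rand 29 27) (.seq (write (.rg 28) (.rg 29)) (assign 28 (.rg 28 + 1))))
    (assign 63 fillCond)

/-- Fill the memory with random words, from the address in register `28` up to the one in
register `0`; register `27` contains the largest word. -/
def fill : Prog := .seq (assign 63 fillCond) (.while 63 fillStep)

section fill
open WordRAM.Expr
variable {w N : ℕ} [NeZero w]

omit [NeZero w] in
theorem has_fillCond {σ : St} : Has w N σ fillCond (if σ.r 28 < σ.r 0 then 1 else 0) :=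
  Has.lt (.reg (by norm_num) rfl) (.reg (by norm_num) rfl)

theorem exec_fillStep {s : State w} (h27 : s.view.r 27 = 2 ^ w - 1) (h0 : s.view.r 28 < s.view.r 0)
    (hN : s.view.r 0 ≤ N) :
    ∃ F : (Fin w → Bool) → State w,
      Exec N fillStep s ((PMF.uniformOfFintype _).map F) ∧ ∀ g,
        (F g).view.r 27 = 2 ^ w - 1 ∧ (F g).view.r 28 = s.view.r 28 + 1 ∧
        (F g).view.r 0 = s.view.r 0 ∧
        (F g).view.r 63 = (if s.view.r 28 + 1 < s.view.r 0 then 1 else 0) ∧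
        (F g).view.m = Function.update s.view.m (s.view.r 28) (Nat.ofBits g) := by
  have hw : 1 < 2 ^ w := Nat.one_lt_two_pow (NeZero.ne w)
  have hlt : s.view.r 0 < 2 ^ w := view_lt_r 0
  have h1 := exec_rand_bits (N := N) (s := s) (d := 29) (a := 27) (by simpa [State.view] using h27)
  have hv : ∀ g : Fin w → Bool, (s.tick.setReg 29 (BitVec.ofNat w (Nat.ofBits g))).view =
      s.view.set 29 (Nat.ofBits g) := by
    intro g
    ext r
    · simp only [State.view, State.setReg, State.tick, St.set_r, Function.update_apply]
      by_cases hr : r = 29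
      · simp [hr, Nat.mod_eq_of_lt (Nat.ofBits_lt_two_pow g)]
      · simp [hr]
    · rfl
  obtain ⟨F₁, h2, h3⟩ := exec_seq_map (q := .seq (write (.rg 28) (.rg 29))
      (assign 28 (.rg 28 + 1))) (Q := fun t u => u.view =
      (t.view.put (t.view.r 28) (t.view.r 29)).set 28 (t.view.r 28 + 1)) h1 (by
    intro g
    obtain ⟨u, h4, h5, -⟩ := Ht.seq (w := w) (N := N) (T₂ := 4)
      (σ := s.view.set 29 (Nat.ofBits g))
      (Ht.write_has (a := rg 28) (e := rg 29) (Has.reg (r := 28) (by norm_num) rfl)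
        (Has.reg (r := 29) (by norm_num) rfl) (by simpa using h0.trans_le hN)
        (Q := fun τ => τ = _) rfl)
      (Q := fun τ => τ = ((s.view.set 29 (Nat.ofBits g)).put
        (s.view.r 28) (Nat.ofBits g)).set 28 (s.view.r 28 + 1)) (by
        rintro _ rfl
        refine Ht.assign_has (d := 28) (e := rg 28 + 1) (v := s.view.r 28 + 1) (by norm_num)
          (Has.add (Has.reg (r := 28) (by norm_num) (by simp)) (Has.lit hw) (by omega)) (by simp))
      _ (hv g)
    exact ⟨u, h4, by rw [h5, hv]; simp⟩)
  obtain ⟨F₂, h6, h7⟩ := exec_seq_map (q := assign 63 fillCond) (Q := fun t u => u.view =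
      t.view.set 63 (if t.view.r 28 < t.view.r 0 then 1 else 0)) h2 (by
    intro g
    obtain ⟨u, h8, h9, -⟩ := Ht.assign_has (w := w) (N := N) (d := 63) (by norm_num)
      (has_fillCond (σ := (F₁ g).view)) (Q := fun τ => τ = _) rfl (F₁ g) rfl
    exact ⟨u, h8, h9⟩)
  refine ⟨F₂, h6, fun g => ?_⟩
  rw [h7, h3, hv]
  simp [h27, St.put]

/-- The random words of the successive rounds are collected in one uniform element of a product
space, so that the final distribution is the image of a uniform one. -/
theorem exec_fill_while : ∀ (n : ℕ) (s : State w), s.view.r 27 = 2 ^ w - 1 →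
    s.view.r 28 + n = s.view.r 0 → s.view.r 0 ≤ N → (s.view.r 63 ≠ 0 ↔ 0 < n) →
    ∃ F : (Fin n → Fin w → Bool) → State w,
      Exec N (.while 63 fillStep) s ((PMF.uniformOfFintype _).map F) ∧ ∀ g,
        (F g).view.r 0 = s.view.r 0 ∧
        (∀ a, (a < s.view.r 28 ∨ s.view.r 0 ≤ a) → (F g).view.m a = s.view.m a) ∧
        ∀ i : Fin n, (F g).view.m (s.view.r 28 + i) = Nat.ofBits (g i)
  | 0, s, h27, hn, hN, h63 => by
    refine ⟨fun _ => s.tick, ?_, fun g => ⟨rfl, fun a _ => rfl, fun i => i.elim0⟩⟩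
    have h : s.regs 63 = 0 := by
      rw [regs_eq_zero_iff (by norm_num)]
      by_contra h
      exact lt_irrefl _ (h63.1 h)
    have := Exec.while_false (N := N) s 63 fillStep h
    convert this using 1
    exact PMF.map_const _ _
  | n + 1, s, h27, hn, hN, h63 => by
    obtain ⟨F, h1, h2⟩ := exec_fillStep (s := s.tick) h27 (by change s.view.r 28 < s.view.r 0; omega) hN
    have hv : s.tick.view = s.view := rfl
    rw [hv] at h2
    obtain ⟨F', h3, h4⟩ := exec_while_map (s := s) (r := 63) (B := Fin n → Fin w → Bool)
      (Q := fun t g u => u.view.r 0 = t.view.r 0 ∧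
        (∀ a, (a < t.view.r 28 ∨ t.view.r 0 ≤ a) → u.view.m a = t.view.m a) ∧
        ∀ i : Fin n, u.view.m (t.view.r 28 + i) = Nat.ofBits (g i))
      (by rw [Ne, regs_eq_zero_iff (by norm_num)]; exact h63.2 (by omega)) h1 (by
        intro g
        obtain ⟨h5, h6, h7, h8, h9⟩ := h2 g
        refine exec_fill_while n (F g) h5 (by omega) (by omega) ?_
        rw [h8]
        split_ifs with h <;> simp <;> omega)
    -- The word of the first round and those of the remaining rounds form one family of `n + 1`
    -- words.
    let e := Fin.consEquiv fun _ : Fin (n + 1) => Fin w → Bool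
    have he := PMF.map_uniformOfFintype_of_bijective e.bijective
    refine ⟨fun g => F' (e.symm g), ?_, fun g => ?_⟩
    · rw [← he, PMF.map_comp]
      convert h3 using 2
      funext p
      simp
    · obtain ⟨⟨g₀, g₁⟩, rfl⟩ := e.surjective g
      beta_reduce
      rw [Equiv.symm_apply_apply]
      obtain ⟨h5, h6, h7, h8, h9⟩ := h2 g₀
      obtain ⟨h10, h11, h12⟩ := h4 g₀ g₁
      refine ⟨h10.trans h7, fun a ha => ?_, fun i => ?_⟩
      · rw [h11 a (by omega), h9, Function.update_of_ne (by omega)]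
      · refine Fin.cases ?_ (fun j => ?_) i
        · rw [h11 _ (.inl (by rw [h6]; simp)), h9]
          simp [e, Fin.consEquiv]
        · have := h12 j
          rw [h6] at this
          rw [Fin.val_succ, show s.view.r 28 + (j.val + 1) = s.view.r 28 + 1 + j by ring, this]
          simp [e, Fin.consEquiv]

/-- The loop that fills the memory with random words. -/
theorem exec_fill {s : State w} {n : ℕ} (h27 : s.view.r 27 = 2 ^ w - 1)
    (hn : s.view.r 28 + n = s.view.r 0) (hN : s.view.r 0 ≤ N) :
    ∃ F : (Fin n → Fin w → Bool) → State w,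
      Exec N fill s ((PMF.uniformOfFintype _).map F) ∧ ∀ g,
        (F g).view.r 0 = s.view.r 0 ∧
        (∀ a, (a < s.view.r 28 ∨ s.view.r 0 ≤ a) → (F g).view.m a = s.view.m a) ∧
        ∀ i : Fin n, (F g).view.m (s.view.r 28 + i) = Nat.ofBits (g i) := by
  obtain ⟨t, h1, h2, -⟩ := Ht.assign_has (w := w) (N := N) (d := 63) (by norm_num)
      (has_fillCond (σ := s.view)) (Q := fun τ => τ = _) rfl s rfl
  obtain ⟨F, h3, h4⟩ := exec_fill_while (N := N) n t (by rw [h2]; simpa using h27)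
    (by rw [h2]; simpa using hn) (by rw [h2]; simpa using hN) (by
      rw [h2]
      simp only [St.set_r, if_true]
      split_ifs with h <;> simp <;> omega)
  refine ⟨F, Exec.seq_pure h1 h3, ?_⟩
  simpa [h2] using h4

end fill

namespace Par
variable {P : Par}

/-- The memory with the table filled with the bits `g`. -/
def filled (P : Par) (m : ℕ → ℕ) (g : Fin P.words → Fin P.w → Bool) (a : ℕ) : ℕ :=
  if h : 16 ≤ a ∧ a < P.B then Nat.ofBits (g ⟨a - 16, by have := h.2; unfold B at this; omega⟩)
  else m a

/-- Addition of bit families is a bitwise flip, and every bit of every table entry is a different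
bit of the memory. -/
theorem flippable_filled (hP : P.Ok) (m : ℕ → ℕ) :
    Flippable (fun g => P.vget (P.filled m g)) P.size P.S := by
  refine ⟨fun _ _ => vget_lt _ _, fun f => ?_⟩
  let k := 2 ^ (P.lν + P.e)
  -- The inverse of the layout: bit `j` of word `i` is bit `j % k` of the entry `i * 2^sr + j / k`,
  -- or bit `j` of entry `i` if an entry fills a word.
  refine ⟨fun i j => if P.sr = 0 then f i j else f (i * 2 ^ P.sr + j / k) (j % k), ?_⟩
  intro g v hv b hb
  have ha : 16 ≤ 16 + v / 2 ^ P.sr ∧ 16 + v / 2 ^ P.sr < P.B := ⟨Nat.le_add_right _ _, addr_lt_B hv⟩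
  have hj : v % 2 ^ P.sr * 2 ^ (P.lν + P.e) + b < P.w := by
    have := off_add_le hP v
    omega
  rw [testBit_vget, testBit_vget, filled, filled, dif_pos ha, dif_pos ha,
    Nat.testBit_ofBits_lt _ _ hj, Nat.testBit_ofBits_lt _ _ hj]
  simp only [hb, decide_true, Bool.true_and, Pi.add_apply]
  congr 1
  simp only [Nat.add_sub_cancel_left]
  split_ifs with h
  · simp [h, Nat.mod_one]
  · have hS : P.S = k := by
      rcases hP.layout' with ⟨h1, -⟩ | ⟨-, h2, -⟩
      · exact absurd h1 h
      · exact h2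
    have hk : 0 < k := by positivity
    have hbk : b < k := hS ▸ hb
    change f (v / 2 ^ P.sr * 2 ^ P.sr + (v % 2 ^ P.sr * k + b) / k) ((v % 2 ^ P.sr * k + b) % k) = _
    rw [mul_comm (v % 2 ^ P.sr), Nat.mul_add_div hk, Nat.mul_add_mod, Nat.div_eq_of_lt hbk,
      Nat.mod_eq_of_lt hbk, add_zero, Nat.div_add_mod']

end Par

end WordRAM

/-! ### Choice of the parameters and the resulting bounds -/

namespace WordRAM

namespace Par

/-- The logarithm of `min q κ`, rounded up. -/
def logq (κ q : ℕ) : ℕ := Nat.clog 2 (min q κ)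

/-- The logarithm of the distance of two characters in a word. -/
def logν (κ : ℕ) : ℕ := Nat.clog 2 (κ + 13)

/-- The logarithm of the number of characters in a word. -/
def logc (κ w : ℕ) : ℕ := Nat.log 2 w - logν κ

/-- The parameters for given `lam`, `κ`, `q` and word size `w`. -/
def of (lam κ q w : ℕ) : Par where
  lam := lam
  κ := κ
  w := w
  -- Here `G = 32 * 2^(logq + 4)` and `β * 2^(logq + 4) > κ`, whence `β * G > 32 κ`. `Q` is `κ / β`
  -- rounded up. Taking `min q κ` loses nothing, as `β` is already `1` for `q ≥ κ`.
  lD := logq κ q + 16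
  β := κ / 2 ^ (logq κ q + 4) + 1
  Q := (κ + κ / 2 ^ (logq κ q + 4)) / (κ / 2 ^ (logq κ q + 4) + 1)
  -- A word has room for `2^logc` characters and an array has `2^(lam+7)`. If the word is longer,
  -- several entries are packed into it; otherwise a row extends over several words.
  sr := logc κ w - (lam + 7)
  e := min (logc κ w) (lam + 7)
  lν := logν κ
  lR := lam + 7 - min (logc κ w) (lam + 7)
  S := if lam + 7 < logc κ w then 2 ^ (logν κ + (lam + 7)) else w

section arith
variable {lam κ q w : ℕ}

theorem two_pow_logq (hκ : 0 < κ) (hq : 0 < q) :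
    min q κ ≤ 2 ^ logq κ q ∧ 2 ^ logq κ q < 2 * min q κ := by
  refine ⟨Nat.le_pow_clog (by norm_num) _, ?_⟩
  rcases Nat.lt_or_ge 1 (min q κ) with h | h
  · have h1 := Nat.pow_pred_clog_lt_self (b := 2) (by norm_num) h
    have h2 : 0 < logq κ q := Nat.clog_pos (by norm_num) h
    have h3 : 2 ^ logq κ q = 2 * 2 ^ (Nat.clog 2 (min q κ)).pred := by
      rw [← pow_succ']
      congr 1
      unfold logq at h2 ⊢
      exact (Nat.succ_pred_eq_of_pos h2).symm
    omega
  · have : logq κ q = 0 := Nat.clog_of_right_le_one h 2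
    rw [this]
    omega

theorem two_pow_logν : κ + 13 ≤ 2 ^ logν κ ∧ 2 ^ logν κ < 2 * (κ + 13) := by
  refine ⟨Nat.le_pow_clog (by norm_num) _, ?_⟩
  have h1 := Nat.pow_pred_clog_lt_self (b := 2) (x := κ + 13) (by norm_num) (by omega)
  have h2 : 0 < logν κ := Nat.clog_pos (by norm_num) (by omega)
  have h3 : 2 ^ logν κ = 2 * 2 ^ (Nat.clog 2 (κ + 13)).pred := by
    rw [← pow_succ']
    exact congrArg _ (Nat.succ_pred_eq_of_pos h2).symm
  omega

/-- The possible layouts of the table. -/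
theorem of_layout (lam κ q : ℕ) (hw : 0 < w) :
    ((of lam κ q w).e + (of lam κ q w).lR = lam + 7) ∧
    (((of lam κ q w).lR = 0 ∧ (of lam κ q w).S = 2 ^ (logν κ + (of lam κ q w).e) ∧
      2 ^ ((of lam κ q w).sr + (logν κ + (of lam κ q w).e)) ≤ w ∧
      w < 2 * 2 ^ ((of lam κ q w).sr + (logν κ + (of lam κ q w).e))) ∨
    ((of lam κ q w).sr = 0 ∧ (of lam κ q w).S = w ∧
      ((2 ^ (logν κ + (of lam κ q w).e) ≤ w ∧ w < 2 * 2 ^ (logν κ + (of lam κ q w).e)) ∨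
      ((of lam κ q w).e = 0 ∧ w < 2 ^ logν κ)))) := by
  have h1 : 2 ^ Nat.log 2 w ≤ w := Nat.pow_log_le_self 2 hw.ne'
  have h2 : w < 2 * 2 ^ Nat.log 2 w := by
    rw [← pow_succ']
    exact Nat.lt_pow_succ_log_self (by norm_num) w
  refine ⟨by simp only [of]; omega, ?_⟩
  by_cases h : lam + 7 < logc κ w
  · left
    have h3 : (of lam κ q w).e = lam + 7 := by simp only [of]; omega
    have h4 : (of lam κ q w).sr + (logν κ + (of lam κ q w).e) = Nat.log 2 w := by
      rw [h3]
      simp only [of]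
      unfold logc at h ⊢
      omega
    rw [h4]
    refine ⟨by simp only [of]; omega, by rw [h3]; exact if_pos h, h1, h2⟩
  · right
    have h3 : (of lam κ q w).e = logc κ w := by simp only [of]; omega
    refine ⟨by simp only [of]; omega, if_neg h, ?_⟩
    rw [h3]
    -- Last distinction: either at least one full character slot fits into a word, or the slot is
    -- longer than the word; in the latter case `e = 0` and an entry holds one character.
    by_cases h4 : logν κ ≤ Nat.log 2 w
    · left
      rw [show logν κ + logc κ w = Nat.log 2 w by unfold logc; omega]
      exact ⟨h1, h2⟩
    · right
      refine ⟨by unfold logc; omega, h2.trans_le ?_⟩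
      rw [← pow_succ']
      exact Nat.pow_le_pow_right (by norm_num) (by omega)

/-- A row consists of `2^(lam+7)` characters in slots of fewer than `2(κ+13)` bits, and in every
layout rounding to powers of two loses only a constant factor. -/
theorem mul_R_le (lam q : ℕ) (hκ : 0 < κ) (hw : 0 < w) :
    w * (of lam κ q w).R ≤ 2 ^ (lam + 13) * κ * 2 ^ (of lam κ q w).sr := by
  obtain ⟨h1, h2⟩ := of_layout lam κ q hw
  have h3 : 2 ^ logν κ ≤ 28 * κ := by
    have := (two_pow_logν (κ := κ)).2
    omega
  have h4 : w * (of lam κ q w).R ≤ 2 * 2 ^ logν κ * 2 ^ (lam + 7) * 2 ^ (of lam κ q w).sr := by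
    rw [R, ← h1]
    rcases h2 with ⟨h5, -, -, h6⟩ | ⟨h5, -, ⟨-, h6⟩ | ⟨h6, h7⟩⟩
    · rw [h5, pow_zero, mul_one, add_zero]
      refine h6.le.trans (le_of_eq ?_)
      rw [pow_add, pow_add]
      ring
    · rw [h5, pow_zero, mul_one]
      refine (Nat.mul_le_mul_right _ h6.le).trans (le_of_eq ?_)
      rw [pow_add, pow_add]
      ring
    · rw [h5, h6, pow_zero, mul_one, zero_add]
      refine Nat.mul_le_mul_right _ (by omega)
  refine h4.trans (Nat.mul_le_mul_right _ ?_)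
  calc 2 * 2 ^ logν κ * 2 ^ (lam + 7) ≤ 2 * (28 * κ) * 2 ^ (lam + 7) := by gcongr
    _ ≤ 64 * κ * 2 ^ (lam + 7) := Nat.mul_le_mul_right _ (by omega)
    _ = _ := by rw [show lam + 13 = lam + 7 + 6 by ring, pow_add _ (lam + 7)]; ring

theorem of_D_le (lam w : ℕ) (hκ : 0 < κ) (hq : 0 < q) : (of lam κ q w).D ≤ 2 ^ 17 * min q κ := by
  have := (two_pow_logq hκ hq).2
  change 2 ^ (logq κ q + 16) ≤ _
  rw [pow_add]
  omega

theorem of_β_mul : κ < (of lam κ q w).β * 2 ^ (logq κ q + 4) :=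
  Nat.lt_mul_of_div_lt (Nat.lt_succ_self _) (by positivity)

theorem of_β_le : 16 * (of lam κ q w).β ≤ κ + 16 := by
  have h1 : 2 ^ 4 ≤ 2 ^ (logq κ q + 4) := Nat.pow_le_pow_right (by norm_num) (by omega)
  have h2 : κ / 2 ^ (logq κ q + 4) ≤ κ / 2 ^ 4 := Nat.div_le_div_left h1 (by norm_num)
  have h3 : (of lam κ q w).β = κ / 2 ^ (logq κ q + 4) + 1 := rfl
  omega

theorem of_Q_le : (of lam κ q w).Q ≤ 2 ^ (logq κ q + 4) := by
  have h := of_β_mul (lam := lam) (κ := κ) (q := q) (w := w)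
  change (κ + κ / 2 ^ (logq κ q + 4)) / (of lam κ q w).β ≤ _
  have h3 : (of lam κ q w).β = κ / 2 ^ (logq κ q + 4) + 1 := rfl
  refine Nat.le_of_lt_succ (Nat.div_lt_of_lt_mul ?_)
  rw [Nat.mul_succ]
  generalize (of lam κ q w).β * 2 ^ (logq κ q + 4) = X at *
  omega

/-- The length of the row indices, in comparison with the claimed space. -/
theorem of_two_pow_L_le (hκ : 0 < κ) (hq : 0 < q) :
    (2 : ℝ) ^ (of lam κ q w).L ≤ 2 ^ 516 * (2 : ℝ) ^ ((1 + 3 / (q : ℝ)) * (κ : ℝ)) := by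
  have hq' : (0 : ℝ) < q := by exact_mod_cast hq
  have hβ : ((of lam κ q w).β : ℝ) ≤ κ / q + 1 := by
    have h1 : (of lam κ q w).β = κ / 2 ^ (logq κ q + 4) + 1 := rfl
    rw [h1]
    push_cast
    gcongr
    have h2 := (two_pow_logq hκ hq).1
    have h3 : 2 ^ (logq κ q + 4) = 16 * 2 ^ logq κ q := by rw [pow_add]; ring
    rcases le_or_gt q κ with h | h
    · refine Nat.cast_div_le.trans ?_
      gcongr
      exact_mod_cast (by omega : q ≤ 2 ^ (logq κ q + 4))
    · rw [Nat.div_eq_of_lt (by omega)]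
      push_cast
      positivity
  rw [← Real.rpow_natCast, ← Real.rpow_natCast, ← Real.rpow_add (by norm_num)]
  refine Real.rpow_le_rpow_of_exponent_le (by norm_num) ?_
  have h4 : (((of lam κ q w).L : ℕ) : ℝ) = κ + 3 * (of lam κ q w).β + 513 := by
    unfold L
    push_cast
    rfl
  rw [h4]
  push_cast
  have h5 : (1 + 3 / (q : ℝ)) * (κ : ℝ) = κ + 3 * (κ / q) := by ring
  rw [h5]
  linarith

/-- The passage from the real exponent `(1 + 3/q) κ + 2 lam` to the integral size of the table; all
later estimates are in natural numbers. -/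
theorem le_spaceBound (hκ : 0 < κ) (hq : 0 < q) (hw : 0 < w) :
    2 ^ (of lam κ q w).L * 2 ^ (2 * lam) * q ^ 2 * κ ≤ 2 ^ 516 * (w * spaceBound lam κ q w) := by
  have h1 := of_two_pow_L_le (lam := lam) (w := w) hκ hq
  have hw' : (0 : ℝ) < w := by exact_mod_cast hw
  have h2 : _ ≤ (spaceBound lam κ q w : ℝ) := Nat.le_ceil ((2 : ℝ) ^ ((1 + 3 / (q : ℝ)) * (κ : ℝ) + 2 * (lam : ℝ)) * (q : ℝ) ^ 2 *
    (κ : ℝ) / (w : ℝ))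
  rw [div_le_iff₀ hw', Real.rpow_add (by norm_num)] at h2
  have h3 : (2 : ℝ) ^ (2 * (lam : ℝ)) = 2 ^ (2 * lam) := by
    rw [← Real.rpow_natCast]
    push_cast
    rfl
  rw [h3] at h2
  have h4 : ((2 ^ (of lam κ q w).L * 2 ^ (2 * lam) * q ^ 2 * κ : ℕ) : ℝ) ≤
      ((2 ^ 516 * (w * spaceBound lam κ q w) : ℕ) : ℝ) := by
    push_cast
    calc (2 : ℝ) ^ (of lam κ q w).L * 2 ^ (2 * lam) * q ^ 2 * κ
        ≤ (2 ^ 516 * (2 : ℝ) ^ ((1 + 3 / (q : ℝ)) * (κ : ℝ))) * 2 ^ (2 * lam) * q ^ 2 * κ := by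
          gcongr
      _ = 2 ^ 516 * ((2 : ℝ) ^ ((1 + 3 / (q : ℝ)) * (κ : ℝ)) * 2 ^ (2 * lam) * q ^ 2 * κ) := by ring
      _ ≤ 2 ^ 516 * ((spaceBound lam κ q w : ℝ) * w) := mul_le_mul_of_nonneg_left h2 (by positivity)
      _ = _ := by ring
  exact_mod_cast h4

theorem spaceBound_pos (hκ : 0 < κ) (hq : 0 < q) (hw : 0 < w) : 0 < spaceBound lam κ q w := by
  unfold spaceBound
  rw [Nat.ceil_pos]
  positivity

theorem of_words_le (hκ : 0 < κ) (hq : 0 < q) (hw : 0 < w) :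
    (of lam κ q w).words ≤ 2 ^ 569 * spaceBound lam κ q w + 1 := by
  set P := of lam κ q w
  have h1 := le_spaceBound (lam := lam) hκ hq hw
  have h2 : w * P.R ≤ 2 ^ (lam + 13) * κ * 2 ^ P.sr := mul_R_le lam q hκ hw
  have h3 : P.D ≤ 2 ^ 17 * q := (of_D_le lam w hκ hq).trans (Nat.mul_le_mul_left _ (min_le_left _ _))
  have h4 : P.lam = lam := rfl
  have h5 : w * P.size ≤ w * (2 ^ 569 * spaceBound lam κ q w * 2 ^ P.sr) := by
    calc w * P.size = 2 ^ (6 + lam) * (P.D * P.D * 2 ^ P.L) * (w * P.R) := by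
          unfold size block
          rw [h4]
          ring
      _ ≤ 2 ^ (6 + lam) * (2 ^ 17 * q * (2 ^ 17 * q) * 2 ^ P.L) *
          (2 ^ (lam + 13) * κ * 2 ^ P.sr) := by gcongr
      _ = 2 ^ 53 * (2 ^ P.L * 2 ^ (2 * lam) * q ^ 2 * κ) * 2 ^ P.sr := by
          rw [pow_add _ 6, pow_add _ lam, two_mul lam, pow_add 2 lam lam]
          ring
      _ ≤ 2 ^ 53 * (2 ^ 516 * (w * spaceBound lam κ q w)) * 2 ^ P.sr := by gcongr
      _ = _ := by
          rw [show 569 = 53 + 516 by norm_num, pow_add _ 53]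
          ring
  have h6 := Nat.le_of_mul_le_mul_left h5 hw
  unfold words
  refine Nat.succ_le_succ ?_
  refine (Nat.div_le_div_right (Nat.sub_le _ _)).trans ?_
  exact Nat.div_le_of_le_mul (by rwa [mul_comm])

theorem of_N_le (hκ : 0 < κ) (hq : 0 < q) (hw : 0 < w) :
    (of lam κ q w).N ≤ 2 ^ 600 * spaceBound lam κ q w := by
  have h1 := of_words_le (lam := lam) hκ hq hw
  have h2 := spaceBound_pos (lam := lam) hκ hq hw
  have h3 : (2 : ℕ) ^ 600 = 2 ^ 31 * 2 ^ 569 := by rw [← pow_add]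
  have h4 : 0 < (2 : ℕ) ^ 569 := by positivity
  have h5 : 1 ≤ 2 ^ 569 * spaceBound lam κ q w := Nat.mul_pos h4 h2
  unfold N
  rw [h3, mul_assoc]
  omega

theorem le_two_pow_div {n : ℕ} (w : ℕ) (hn : 0 < n) : w ≤ n * 2 ^ (w / n) := by
  have h1 : w / n < 2 ^ (w / n) := Nat.lt_two_pow_self
  have h2 := Nat.lt_mul_div_succ w hn
  exact h2.le.trans (Nat.mul_le_mul_left _ h1)

/-- For packed entries the hypothesis on the word length does not control the virtual indices
directly. But then `128 κ ≤ w`, and `2^lam` and `2^sr` are at most `w`, so there are at most about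
`w^3 * 2^(w/32)` entries up to a constant, which is below `2^w` because `w ≥ 1000`. -/
theorem space_of_le {sr lν D β words : ℕ} (hw : 1000 ≤ w) (hκ : 0 < κ) (hν : κ + 13 ≤ 2 ^ lν)
    (h2 : 2 ^ (sr + (lν + (lam + 7))) ≤ w) (hD : D ≤ 2 ^ 17 * min q κ) (hβ : 16 * β ≤ κ + 16)
    (hwords : words = (2 ^ (6 + lam) * (D * D * 2 ^ (κ + 3 * β + 513)) - 1) / 2 ^ sr + 1) :
    (20 + 4 * words) * 2 ^ sr < 2 ^ w := by
  have h3 : κ * 2 ^ (lam + 7) * 2 ^ sr ≤ w := by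
    refine le_trans ?_ h2
    rw [pow_add _ sr, pow_add _ lν, mul_comm (2 ^ sr)]
    gcongr
    omega
  have h4 : 128 * κ ≤ w ∧ 2 ^ lam ≤ w ∧ κ ≤ w ∧ 2 ^ sr ≤ w := by
    have e1 : 1 ≤ 2 ^ sr := Nat.one_le_two_pow
    have e2 : 1 ≤ 2 ^ lam := Nat.one_le_two_pow
    have e3 : κ * 2 ^ (lam + 7) * 2 ^ sr = 128 * (κ * 2 ^ lam * 2 ^ sr) := by
      rw [pow_add]
      ring
    have e4 : κ ≤ κ * 2 ^ lam * 2 ^ sr := by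
      calc κ = κ * 1 * 1 := by ring
        _ ≤ _ := by gcongr
    have e5 : 2 ^ lam ≤ κ * 2 ^ lam * 2 ^ sr := by
      calc 2 ^ lam = 1 * 2 ^ lam * 1 := by ring
        _ ≤ _ := by gcongr; exact hκ
    have e6 : 2 ^ sr ≤ κ * 2 ^ lam * 2 ^ sr := by
      calc 2 ^ sr = 1 * 1 * 2 ^ sr := by ring
        _ ≤ _ := by gcongr; exact hκ
    generalize κ * 2 ^ lam * 2 ^ sr = X at *
    omega
  have h6 : D ≤ 2 ^ 17 * w :=
    hD.trans (Nat.mul_le_mul_left _ ((min_le_right _ _).trans h4.2.2.1))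
  have h7 : κ + 3 * β + 513 ≤ w / 32 + 520 := by omega
  have hc : (2 : ℕ) ^ 40 * 2 ^ 520 = 2 ^ 560 := (pow_add 2 40 520).symm
  have h8 : 2 ^ (6 + lam) * (D * D * 2 ^ (κ + 3 * β + 513)) ≤
      2 ^ 560 * (w * w * w * 2 ^ (w / 32)) := by
    calc _ ≤ (2 ^ 6 * w) * ((2 ^ 17 * w) * (2 ^ 17 * w) * (2 ^ (w / 32) * 2 ^ 520)) := by
          rw [← pow_add, pow_add 2 6]
          exact Nat.mul_le_mul (Nat.mul_le_mul_left _ h4.2.1) (Nat.mul_le_mul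
            (Nat.mul_le_mul h6 h6) (Nat.pow_le_pow_right (by norm_num) h7))
      _ = _ := by
          rw [← hc]
          generalize (2 : ℕ) ^ 520 = X
          ring
  have h5 : words * 2 ^ sr ≤ 2 ^ 560 * (w * w * w * 2 ^ (w / 32)) + w := by
    rw [hwords, add_mul, one_mul]
    exact Nat.add_le_add (((Nat.div_mul_le_self _ _).trans (Nat.sub_le _ _)).trans h8) h4.2.2.2
  have h10 : w * w * w ≤ 2 ^ 12 * 2 ^ (w / 16 * 3) := by
    have := le_two_pow_div w (n := 16) (by norm_num)
    calc w * w * w ≤ (16 * 2 ^ (w / 16)) * (16 * 2 ^ (w / 16)) * (16 * 2 ^ (w / 16)) := by gcongr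
      _ = _ := by
        rw [pow_mul]
        ring
  have h11 : w ≤ w * w * w * 2 ^ (w / 32) := by
    have h9 : 0 < w := by omega
    rw [mul_assoc, mul_assoc]
    exact Nat.le_mul_of_pos_right _ (by positivity)
  have e1 : (2 : ℕ) ^ 563 = 2 ^ 3 * 2 ^ 560 := pow_add 2 3 560
  have e2 : 64 ≤ 2 ^ 560 := (by norm_num : 64 ≤ 2 ^ 6).trans
    (Nat.pow_le_pow_right (by norm_num) (by norm_num))
  have e3 := Nat.mul_le_mul e2 h11
  have e4 : (2 : ℕ) ^ 563 * (w * w * w * 2 ^ (w / 32)) < 2 ^ w := by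
    calc _ ≤ (2 : ℕ) ^ 563 * (2 ^ 12 * 2 ^ (w / 16 * 3) * 2 ^ (w / 32)) :=
          Nat.mul_le_mul_left _ (Nat.mul_le_mul_right _ h10)
      _ = 2 ^ (563 + (12 + w / 16 * 3 + w / 32)) := by rw [pow_add 2 563, pow_add, pow_add]
      _ < _ := Nat.pow_lt_pow_right (by norm_num) (by omega)
  refine lt_of_le_of_lt ?_ e4
  rw [e1, add_mul, mul_assoc 4, mul_assoc (2 ^ 3)]
  generalize 2 ^ 560 * (w * w * w * 2 ^ (w / 32)) = X at *
  generalize words * 2 ^ sr = Y at *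
  have h12 := h4.2.2.2
  generalize 2 ^ sr = Z at *
  clear e1 e2 e4
  omega

section large
variable (hκ : 0 < κ) (hq : 0 < q) (hw : 0 < w) (hsp : 2 ^ 1000 * spaceBound lam κ q w ≤ 2 ^ w)
include hκ hq hw hsp

theorem large_w : 1000 ≤ w := by
  have h := spaceBound_pos (lam := lam) hκ hq hw
  exact (Nat.pow_le_pow_iff_right (by norm_num : 1 < 2)).1
    ((Nat.le_mul_of_pos_right _ h).trans hsp)

theorem le_two_pow_w :
    2 ^ 484 * (2 ^ (of lam κ q w).L * 2 ^ (2 * lam) * q ^ 2 * κ) ≤ 2 ^ w * w := by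
  calc _ ≤ 2 ^ 484 * (2 ^ 516 * (w * spaceBound lam κ q w)) :=
        Nat.mul_le_mul_left _ (le_spaceBound hκ hq hw)
    _ = 2 ^ 1000 * spaceBound lam κ q w * w := by
        rw [show 1000 = 484 + 516 by norm_num, pow_add _ 484]
        ring
    _ ≤ _ := Nat.mul_le_mul_right _ hsp

/-- If `L > w`, the space bound would force `2^484 * κ ≤ w`, whereas `L` exceeds `513` by only a
small multiple of `κ` plus a constant and `w` is at least `1000`. -/
theorem of_L_le : (of lam κ q w).L ≤ w := by
  have h1 := le_two_pow_w hκ hq hw hsp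
  by_contra! h
  have h2 : (of lam κ q w).L = κ + 3 * (of lam κ q w).β + 513 := rfl
  have h3 := of_β_le (lam := lam) (κ := κ) (q := q) (w := w)
  have h4 : 2 ^ w * (2 ^ 484 * κ) ≤ 2 ^ w * w := by
    refine le_trans ?_ h1
    calc 2 ^ w * (2 ^ 484 * κ) = 2 ^ 484 * (2 ^ w * 1 * 1 * κ) := by ring
      _ ≤ _ := by
        gcongr
        · norm_num
        · exact Nat.one_le_two_pow
        · exact Nat.one_le_pow _ _ hq
  have h5 := Nat.le_of_mul_le_mul_left h4 (by positivity)
  have h6 : 2 ^ 20 * κ ≤ 2 ^ 484 * κ := by gcongr <;> norm_num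
  omega

/-- The argument `q` must be representable in a register. The space contains the factor `q^2`, so `q
≥ 2^w` would exceed it. -/
theorem q_lt : q < 2 ^ w := by
  have h1 := le_two_pow_w hκ hq hw hsp
  by_contra! h
  have h2 : 2 ^ w * 2 ^ w ≤ 2 ^ w * w := by
    calc 2 ^ w * 2 ^ w ≤ q * q := Nat.mul_le_mul h h
      _ = 1 * (1 * 1 * q ^ 2 * 1) := by ring
      _ ≤ 2 ^ 484 * (2 ^ (of lam κ q w).L * 2 ^ (2 * lam) * q ^ 2 * κ) :=
        Nat.mul_le_mul Nat.one_le_two_pow (Nat.mul_le_mul (Nat.mul_le_mul_right _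
          (Nat.mul_le_mul Nat.one_le_two_pow Nat.one_le_two_pow)) hκ)
      _ ≤ _ := h1
  have h3 := Nat.le_of_mul_le_mul_left h2 (by positivity)
  exact absurd h3 (not_le.2 Nat.lt_two_pow_self)

theorem of_space : (20 + 4 * (of lam κ q w).words) * 2 ^ (of lam κ q w).sr < 2 ^ w := by
  have hw' := large_w hκ hq hw hsp
  rcases (of_layout lam κ q hw).2 with ⟨h1, -, h2, -⟩ | ⟨h1, -⟩
  · clear hsp
    have he : (of lam κ q w).e = lam + 7 := by have := (of_layout lam κ q hw).1; omega
    refine space_of_le hw' hκ (sr := (of lam κ q w).sr) (lam := lam) (lν := logν κ)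
      two_pow_logν.1 (by rwa [he] at h2) (of_D_le lam w hκ hq)
      (of_β_le (lam := lam) (κ := κ) (q := q) (w := w)) ?_
    have hR : (of lam κ q w).R = 1 := by simp [R, h1]
    unfold words size block L
    rw [hR, mul_one]
    rfl
  · rw [h1, pow_zero, mul_one]
    refine lt_of_lt_of_le ?_ hsp
    refine (of_N_le (lam := lam) hκ hq hw).trans_lt ?_
    have := spaceBound_pos (lam := lam) hκ hq hw
    exact Nat.mul_lt_mul_of_pos_right (Nat.pow_lt_pow_right (by norm_num) (by norm_num)) this

theorem of_ok (hlam : 0 < lam) : (of lam κ q w).Ok where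
  lam_pos := hlam
  κ_pos := hκ
  β_pos := Nat.succ_pos _
  β_le := Nat.succ_le_succ (Nat.div_le_self _ _)
  le_Qβ := by
    have h1 : (of lam κ q w).Q = (κ + κ / 2 ^ (logq κ q + 4)) / (of lam κ q w).β := rfl
    have h2 : (of lam κ q w).β = κ / 2 ^ (logq κ q + 4) + 1 := rfl
    have h3 := Nat.div_add_mod (κ + κ / 2 ^ (logq κ q + 4)) (of lam κ q w).β
    have h4 := Nat.mod_lt (κ + κ / 2 ^ (logq κ q + 4)) (y := (of lam κ q w).β) (Nat.succ_pos _)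
    rw [← h1, mul_comm] at h3
    change κ ≤ _
    omega
  Qβ_lt := by
    have h1 : (of lam κ q w).Q = (κ + κ / 2 ^ (logq κ q + 4)) / (of lam κ q w).β := rfl
    have h2 : (of lam κ q w).β = κ / 2 ^ (logq κ q + 4) + 1 := rfl
    have h3 := Nat.div_mul_le_self (κ + κ / 2 ^ (logq κ q + 4)) (of lam κ q w).β
    rw [← h1] at h3
    change _ < κ + _
    omega
  Q_lt := by
    refine of_Q_le.trans_lt ?_
    exact Nat.pow_lt_pow_right (by norm_num) (Nat.add_lt_add_left (by norm_num) _)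
  D_eq := by
    unfold G
    have : (of lam κ q w).D = 128 * 2 ^ (logq κ q + 9) := by
      change 2 ^ (logq κ q + 16) = _
      rw [pow_add, pow_add]
      ring
    rw [this]
    omega
  D_large := by
    have h1 : (of lam κ q w).D = 2 ^ 16 * 2 ^ logq κ q := by
      change 2 ^ (logq κ q + 16) = _
      rw [pow_add]
      ring
    have h2 : (of lam κ q w).G = 32 * 2 ^ (logq κ q + 4) := by
      unfold G
      rw [h1, pow_add]
      omega
    have h3 := of_β_mul (lam := lam) (κ := κ) (q := q) (w := w)
    have h4 : 1 ≤ 2 ^ logq κ q := Nat.one_le_two_pow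
    have h5 : (of lam κ q w).β * (of lam κ q w).G =
        32 * ((of lam κ q w).β * 2 ^ (logq κ q + 4)) := by
      rw [h2]
      ring
    rw [h5, h1]
    change 6 * κ + 300 ≤ _
    omega
  e_add := (of_layout lam κ q hw).1
  ν_le := two_pow_logν.1
  char_le := by
    have h1 := (two_pow_logν (κ := κ)).1
    have h2 : (2 ^ (of lam κ q w).e - 1) * 2 ^ logν κ + (κ + 13) ≤
        2 ^ (logν κ + (of lam κ q w).e) := by
      have e1 : 1 ≤ 2 ^ (of lam κ q w).e := Nat.one_le_two_pow
      calc _ ≤ (2 ^ (of lam κ q w).e - 1) * 2 ^ logν κ + 1 * 2 ^ logν κ := by omega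
        _ = _ := by rw [← add_mul, Nat.sub_add_cancel e1, pow_add, mul_comm]
    have h3 := of_L_le hκ hq hw hsp
    unfold L at h3
    rcases (of_layout lam κ q hw).2 with ⟨-, h4, -⟩ | ⟨-, h4, ⟨h5, -⟩ | ⟨h5, -⟩⟩
    · rw [h4]
      exact h2
    · rw [h4]
      exact h2.trans h5
    · rw [h4, h5, pow_zero, Nat.sub_self, zero_mul, zero_add]
      change κ + _ + _ ≤ w at h3
      change κ + 13 ≤ w
      omega
  L_le := by
    have h3 := of_L_le hκ hq hw hsp
    rcases (of_layout lam κ q hw).2 with ⟨h5, h4, -⟩ | ⟨-, h4, -⟩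
    · have he : (of lam κ q w).e = lam + 7 := by have := (of_layout lam κ q hw).1; omega
      rw [h4, he]
      have h1 := (two_pow_logν (κ := κ)).1
      have h2 : (of lam κ q w).L = κ + 3 * (of lam κ q w).β + 513 := rfl
      have h6 := of_β_le (lam := lam) (κ := κ) (q := q) (w := w)
      calc (of lam κ q w).L ≤ (κ + 13) * 2 ^ 7 := by omega
        _ ≤ _ := by
          rw [pow_add]
          gcongr
          · norm_num
          · omega
    · rwa [h4]
  out_le := by
    have h1 := (two_pow_logν (κ := κ)).1
    have h2 : 96 * 2 ^ lam * (κ + 13) ≤ 2 ^ logν κ * 2 ^ (lam + 7) := by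
      calc 96 * 2 ^ lam * (κ + 13) ≤ 128 * 2 ^ lam * 2 ^ logν κ := by gcongr; norm_num
        _ = _ := by rw [pow_add]; ring
    have h3 := of_L_le hκ hq hw hsp
    unfold L at h3
    obtain ⟨h0, h⟩ := of_layout lam κ q hw
    unfold R
    rcases h with ⟨h5, h4, -⟩ | ⟨-, h4, ⟨h5, -⟩ | ⟨h5, -⟩⟩
    · rw [h4, h5, pow_zero, one_mul, pow_add, ← add_zero (of lam κ q w).e, ← h5, h0]
      exact h2
    · rw [h4, mul_comm (2 ^ _)]
      refine h2.trans (le_trans (le_of_eq ?_) (Nat.mul_le_mul_right _ h5))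
      rw [← h0, pow_add, pow_add]
      ring
    · rw [h5, zero_add] at h0
      rw [h4, h0]
      change κ + _ + _ ≤ w at h3
      calc 96 * 2 ^ lam * (κ + 13) ≤ 128 * 2 ^ lam * w := by gcongr; norm_num; omega
        _ = _ := by rw [pow_add]; ring
  S_eq := by
    rcases (of_layout lam κ q hw).2 with ⟨h5, -⟩ | ⟨-, h4, -⟩
    · exact .inl h5
    · exact .inr h4
  layout := by
    rcases (of_layout lam κ q hw).2 with ⟨-, h4, h5, -⟩ | ⟨h3, h4, -⟩
    · exact .inr ⟨h4, h5⟩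
    · exact .inl ⟨h3, h4⟩
  space := of_space hκ hq hw hsp

end large

theorem evalTime_bound {A D Q X Y q : ℝ} (hA : 0 ≤ A) (hQ : 0 ≤ Q) (hX : 0 ≤ X) (hq : 0 ≤ q)
    (hY : 0 ≤ Y) (h1 : D ≤ 2 ^ 17 * q) (h2 : Q ≤ 2 ^ 5 * q) (h3 : X ≤ 2 ^ 15 * Y) :
    71000 * (A * (D * (Q * X))) ≤ 2 ^ 60 * (A * q ^ 2 * Y) := by
  calc 71000 * (A * (D * (Q * X))) ≤ 71000 * (A * ((2 ^ 17 * q) * ((2 ^ 5 * q) * (2 ^ 15 * Y)))) := by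
        gcongr
    _ = 71000 * 2 ^ 37 * (A * q ^ 2 * Y) := by ring
    _ ≤ _ := mul_le_mul_of_nonneg_right (by norm_num) (by positivity)

theorem of_evalTime_le (hlam : 0 < lam) (hκ : 0 < κ) (hq : 0 < q) (hw : 0 < w) :
    ((of lam κ q w).evalTime : ℝ) ≤ 2 ^ 60 * timeBound lam κ q w := by
  set P := of lam κ q w
  have hw' : (0 : ℝ) < w := by exact_mod_cast hw
  have h1 : P.D ≤ 2 ^ 17 * q := (of_D_le lam w hκ hq).trans
    (Nat.mul_le_mul_left _ (min_le_left _ _))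
  have h2 : P.Q + 1 ≤ 2 ^ 5 * q := by
    have e1 : P.Q ≤ 2 ^ (logq κ q + 4) := of_Q_le
    have e2 := (two_pow_logq hκ hq).2
    rw [pow_add] at e1
    omega
  -- If a row is a single entry, then `R = 1` is absorbed by `lam ≥ 1`; otherwise `sr = 0` and
  -- `mul_R_le` gives the second summand.
  have h3 : (P.R : ℝ) ≤ lam + 2 ^ 13 * (2 ^ lam * κ / w) := by
    rcases (of_layout lam κ q hw).2 with ⟨h3, -⟩ | ⟨h3, -⟩
    · have hR : P.R = 1 := by
        change 2 ^ P.lR = 1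
        rw [h3, pow_zero]
      rw [hR]
      have e1 : (1 : ℝ) ≤ lam := by exact_mod_cast hlam
      have e2 : (0 : ℝ) ≤ 2 ^ 13 * (2 ^ lam * κ / w) := by positivity
      push_cast
      linarith
    · have e1 := mul_R_le lam q hκ hw
      rw [h3, pow_zero, mul_one] at e1
      have e2 : (w : ℝ) * P.R ≤ 2 ^ (lam + 13) * κ := by exact_mod_cast e1
      have e3 : (2 : ℝ) ^ 13 * (2 ^ lam * κ / w) = 2 ^ (lam + 13) * κ / w := by
        rw [pow_add]
        ring
      rw [e3]
      have e4 : (P.R : ℝ) ≤ 2 ^ (lam + 13) * κ / w := by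
        rw [le_div_iff₀ hw']
        linarith
      have e5 : (0 : ℝ) ≤ lam := by positivity
      linarith
  have h4 : (P.lam : ℝ) + 2 * P.R ≤ 2 ^ 15 * (lam + 2 ^ lam * κ / w) := by
    have e1 : (P.lam : ℝ) = lam := rfl
    have e2 : (0 : ℝ) ≤ lam := by positivity
    have e3 : (0 : ℝ) ≤ 2 ^ lam * κ / w := by positivity
    rw [e1]
    norm_num at h3 ⊢
    linarith
  have h1' : (P.D : ℝ) ≤ 2 ^ 17 * q := by exact_mod_cast h1
  have h2' : (P.Q : ℝ) + 1 ≤ 2 ^ 5 * q := by exact_mod_cast h2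
  have h5 : ((P.evalTime : ℕ) : ℝ) = 71000 * (2 ^ lam * (P.D * ((P.Q + 1) * (P.lam + 2 * P.R)))) := by
    unfold evalTime
    push_cast
    rfl
  rw [h5, timeBound]
  exact evalTime_bound (by positivity) (add_nonneg (Nat.cast_nonneg _) zero_le_one)
    (add_nonneg (Nat.cast_nonneg _) (mul_nonneg zero_le_two (Nat.cast_nonneg _)))
    (Nat.cast_nonneg _) (by positivity) h1' h2' h4

end arith

end Par

end WordRAM

/-! ### Computing the parameters on the machine -/

namespace WordRAM

open WordRAM.Expr

/-- Started in a state with view `σ`, the program `p` halts in a state whose view satisfies `Q`. -/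
def Hu (w N : ℕ) (p : Prog) (σ : St) (Q : St → Prop) : Prop :=
  ∀ s : State w, s.view = σ → ∃ s', Run N p s s' ∧ Q s'.view

/-- The registers in the list have the prescribed values. -/
def Known (f : ℕ → ℕ) (l : List ℕ) (σ : St) : Prop := ∀ r ∈ l, σ.r r = f r

/-- If the registers in `l` have the prescribed values, then the program `p` leads to a state where
those in `l'` do. -/
def Step (w N : ℕ) (f : ℕ → ℕ) (p : Prog) (l l' : List ℕ) : Prop :=
  ∀ σ, Known f l σ → Hu w N p σ (Known f l')

section
variable {w N : ℕ} {f : ℕ → ℕ} {p q : Prog} {l l' l'' : List ℕ} {σ : St} {e : Expr}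

theorem Ht.hu {T : ℕ} {Q : St → Prop} (h : Ht w N p σ T Q) : Hu w N p σ Q := fun s hs =>
  let ⟨s', h1, h2, _⟩ := h s hs
  ⟨s', h1, h2⟩

theorem Hu.seq {R Q : St → Prop} (hp : Hu w N p σ R) (hq : ∀ σ', R σ' → Hu w N q σ' Q) :
    Hu w N (.seq p q) σ Q := by
  intro s hs
  obtain ⟨s1, h1, h2⟩ := hp s hs
  obtain ⟨s2, h3, h4⟩ := hq _ h2 s1 rfl
  exact ⟨s2, h1.seq h3, h4⟩

theorem Hu.assign_seq_has [NeZero w] {d v : ℕ} {Q : St → Prop} (hd : d < 64) (h : Has w N σ e v)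
    (hq : Hu w N q (σ.set d v) Q) : Hu w N (.seq (WordRAM.assign d e) q) σ Q :=
  Hu.seq (R := fun τ => τ = σ.set d v) (Ht.assign_has (Q := fun τ => τ = _) hd h rfl).hu
    (by rintro _ rfl; exact hq)

namespace Known

theorem has (h : Known f l σ) (r : ℕ) (hr : r ∈ l := by decide) (h64 : r < 64 := by decide) :
    Has w N σ (rg r) (f r) := .reg h64 (h r hr)

theorem set (h : Known f l σ) {d v : ℕ} (hd : d ∉ l) : Known f l (σ.set d v) := by
  intro r hr
  rw [St.set_r, if_neg (by rintro rfl; exact hd hr)]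
  exact h r hr

theorem cons (h : Known f l σ) {d : ℕ} (hd : σ.r d = f d) : Known f (d :: l) σ := by
  intro r hr
  rcases List.mem_cons.1 hr with rfl | hr
  · exact hd
  · exact h r hr

theorem set_cons (h : Known f l σ) {d : ℕ} : Known f (d :: l) (σ.set d (f d)) := by
  intro r hr
  rw [St.set_r]
  split_ifs with h1
  · rw [h1]
  · exact h r ((List.mem_cons.1 hr).resolve_left h1)

end Known

namespace Step

theorem seq (hp : Step w N f p l l') (hq : Step w N f q l' l'') :
    Step w N f (.seq p q) l l'' := fun σ hσ => Hu.seq (hp σ hσ) hq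

variable [NeZero w]

theorem assign {d : ℕ} (h : ∀ σ, Known f l σ → Has w N σ e (f d)) (hd : d < 64 := by decide) :
    Step w N f (WordRAM.assign d e) l (d :: l) :=
  fun σ hσ => (Ht.assign_has hd (h σ hσ) hσ.set_cons).hu

theorem cond {c : Prop} (h : ∀ σ, Known f l σ → ∃ v, Has w N σ e v ∧ (v ≠ 0 ↔ c))
    (hp : c → Step w N f p l l') (hq : ¬ c → Step w N f q l l') (h63 : 63 ∉ l := by decide) :
    Step w N f (WordRAM.cond e p q) l l' := by
  intro σ hσ
  obtain ⟨v, h1, h2⟩ := h σ hσ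
  refine Hu.assign_seq_has (by norm_num) h1 ?_
  intro s hs
  have hs63 : s.view.r 63 = v := by rw [hs]; simp
  by_cases h0 : c
  · obtain ⟨s', h3, h4⟩ := hp h0 _ (hσ.set (v := v) h63) s.tick hs
    refine ⟨s', Exec.ite_true _ _ _ _ _ ?_ h3, h4⟩
    rw [Ne, regs_eq_zero_iff (by norm_num), hs63]
    exact h2.2 h0
  · obtain ⟨s', h3, h4⟩ := hq h0 _ (hσ.set (v := v) h63) s.tick hs
    refine ⟨s', Exec.ite_false _ _ _ _ _ ?_ h3, h4⟩
    rw [regs_eq_zero_iff (by norm_num), hs63]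
    by_contra h5
    exact h0 (h2.1 h5)

end Step

end

/-- Set the register `c` to the number of times that `e` holds when it is counted up from `0`. -/
def count (c : ℕ) (e : Expr) : Prog :=
  .seq (assign c 0) (loop e (assign c (rg c + 1)))

/-- Rounded logarithms are found by counting upwards while a shifted word stays below a bound;
initialization time is not restricted. -/
theorem Step.count {w N : ℕ} [NeZero w] {f : ℕ → ℕ} {l : List ℕ} {e : Expr} {c : ℕ}
    (h : ∀ k ≤ f c, ∀ σ, Known f l σ → Has w N σ (rg c) k →
      ∃ v, Has w N σ e v ∧ (v ≠ 0 ↔ k < f c))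
    (hn : f c < 2 ^ w) (hc : c < 63 := by decide) (hcl : c ∉ l := by decide)
    (h63 : 63 ∉ l := by decide) : Step w N f (WordRAM.count c e) l (c :: l) := by
  intro σ hσ
  have hw : 1 < 2 ^ w := Nat.one_lt_two_pow (NeZero.ne w)
  have hreg : ∀ {τ : St} {k}, τ.r c = k → Has w N τ (rg c) k := Has.reg (by omega)
  refine Hu.assign_seq_has (by omega) (Has.lit (by positivity)) ?_
  have := Ht.loop (w := w) (N := N) (e := e) (p := WordRAM.assign c (rg c + 1)) (T := fun _ => 4)
    (n := f c) (fun k τ => Known f l τ ∧ τ.r c = k)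
    (fun k hk τ hτ => by
      obtain ⟨v, h1, -⟩ := h k hk τ hτ.1 (hreg hτ.2)
      exact h1.1)
    (fun k hk τ hτ => by
      obtain ⟨v, h1, h2⟩ := h k hk τ hτ.1 (hreg hτ.2)
      rw [h1.2, h2])
    (fun k τ v hτ => ⟨hτ.1.set h63, by rw [St.set_r, if_neg (by omega), hτ.2]⟩)
    (fun k hk τ hτ => (Ht.assign_has (d := c) (e := rg c + 1) (by omega)
      ((hreg hτ.2).add (.lit hw) (by omega)) ⟨hτ.1.set hcl, by simp⟩))
    (σ := σ.set c 0) ⟨hσ.set hcl, by simp⟩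
  intro s hs
  obtain ⟨s', h1, h2, -⟩ := this s hs
  exact ⟨s', h1, h2.1.cons h2.2⟩

/-- Round up the quotient of the contents of the registers `2` and `5`. -/
def quotient : Prog :=
  .seq (assign 6 0) (.seq (assign 29 0)
    (loop (.bin .lt (rg 29) (rg 2)) (.seq (assign 29 (rg 29 + rg 5)) (assign 6 (rg 6 + 1)))))

/-- Division by repeated addition. The two inequalities characterize `f 6` as the quotient rounded
up, so the loop makes exactly `f 6` rounds. -/
theorem step_quotient {w N : ℕ} [NeZero w] {f : ℕ → ℕ} {l : List ℕ} (h2 : 2 ∈ l) (h5 : 5 ∈ l)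
    (h6 : 6 ∉ l) (h29 : 29 ∉ l) (h63 : 63 ∉ l) (hpos : 0 < f 5) (hle : f 2 ≤ f 6 * f 5)
    (hlt : f 6 * f 5 < f 2 + f 5) (hw : f 6 * f 5 < 2 ^ w) : Step w N f quotient l (6 :: l) := by
  intro σ hσ
  have hw1 : 1 < 2 ^ w := Nat.one_lt_two_pow (NeZero.ne w)
  have hlow : ∀ k ≤ f 6, k * f 5 < f 2 ↔ k < f 6 := by
    intro k hk
    constructor
    · intro h
      rcases hk.lt_or_eq with h' | rfl
      · exact h'
      · omega
    · intro h
      have : (k + 1) * f 5 ≤ f 6 * f 5 := Nat.mul_le_mul_right _ h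
      rw [add_mul, one_mul] at this
      omega
  have h6w : f 6 < 2 ^ w := (Nat.le_mul_of_pos_right _ hpos).trans_lt hw
  refine Hu.assign_seq_has (by norm_num) (Has.lit (by positivity)) ?_
  refine Hu.assign_seq_has (by norm_num) (Has.lit (by positivity)) ?_
  have hc : ∀ k ≤ f 6, ∀ τ, (Known f l τ ∧ τ.r 6 = k ∧ τ.r 29 = k * f 5) →
      Has w N τ (.bin .lt (rg 29) (rg 2)) (if k * f 5 < f 2 then 1 else 0) := by
    rintro k hk τ ⟨h7, h8, h9⟩
    exact Has.lt (.reg (by norm_num) h9) (h7.has 2 h2)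
  have := Ht.loop (w := w) (N := N) (e := .bin .lt (rg 29) (rg 2))
    (p := .seq (assign 29 (rg 29 + rg 5)) (assign 6 (rg 6 + 1))) (T := fun _ => 8)
    (n := f 6) (fun k τ => Known f l τ ∧ τ.r 6 = k ∧ τ.r 29 = k * f 5)
    (fun k hk τ hτ => (hc k hk τ hτ).1)
    (fun k hk τ hτ => by
      rw [(hc k hk τ hτ).2, ← hlow k hk]
      split_ifs with h <;> simp [h])
    (fun k τ v hτ => ⟨hτ.1.set h63, by simp [hτ.2.1], by simp [hτ.2.2]⟩)
    (fun k hk τ hτ => by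
      have h7 : (k + 1) * f 5 ≤ f 6 * f 5 := Nat.mul_le_mul_right _ hk
      rw [add_mul, one_mul] at h7
      exact Ht.assign_seq_has (d := 29) (e := rg 29 + rg 5) (by norm_num)
        ((Has.reg (r := 29) (by norm_num) hτ.2.2).add (hτ.1.has 5 h5) (by omega))
        (Ht.assign_has (d := 6) (e := rg 6 + 1) (by norm_num)
          ((Has.reg (r := 6) (x := k) (by norm_num) (by simpa using hτ.2.1)).add (.lit hw1) (by omega))
          ⟨(hτ.1.set h29).set h6, by simp, by simp [add_mul]⟩))
    (σ := (σ.set 6 0).set 29 0) ⟨(hσ.set h6).set h29, by simp, by simp⟩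
  intro s hs
  obtain ⟨s', h1, h2, -⟩ := this s hs
  exact ⟨s', h1, h2.1.cons h2.2.1⟩

/-- Store the first registers. -/
def storeParams : ℕ → Prog
  | 0 => .skip
  | n + 1 => .seq (storeParams n) (write (.lit n) (rg n))

theorem hu_storeParams {w N : ℕ} [NeZero w] (hN : N < 2 ^ w) {σ : St} : ∀ n ≤ 16, n ≤ N →
    Hu w N (storeParams n) σ fun σ' => σ'.r = σ.r ∧ ∀ r < n, σ'.m r = σ.r r
  | 0, _, _ => (Ht.skip ⟨rfl, by simp⟩).hu
  | n + 1, h, hn => by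
    refine Hu.seq (hu_storeParams hN n (by omega) (by omega)) ?_
    rintro τ ⟨h1, h2⟩
    refine (Ht.write_has (u := n) ⟨(by simp only [ok]; omega), rfl⟩ (.reg (by omega) rfl) (by omega)
      ⟨h1, fun r hr => ?_⟩).hu
    rw [St.put_m]
    split_ifs with h3
    · rw [h3, h1]
    · exact h2 r (by omega)

/-- Compute the parameters that depend only on `lam`, `κ` and `q`. -/
def params : Prog :=
  .seq (cond (.bin .lt (rg 20) (rg 2)) (assign 21 (rg 20)) (assign 21 (rg 2))) <|
  .seq (count 22 (.bin .lt ((1 : Expr) <<< rg 22) (rg 21))) <|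
  .seq (assign 23 (rg 2 + 13)) <|
  .seq (count 11 (.bin .lt ((1 : Expr) <<< rg 11) (rg 23))) <|
  .seq (assign 4 (rg 22 + 16)) <|
  .seq (assign 5 ((rg 2 >>> (rg 22 + 4)) + 1)) <|
  .seq quotient <|
  assign 15 (rg 2 + (rg 5 + rg 5 + rg 5) + 513)

/-- Compute the parameters for the layout of the table. -/
def layout : Prog :=
  .seq (count 24 (.bin .lt ((2 : Expr) <<< rg 24) (rg 3 + 1))) <|
  .seq (cond (.bin .lt (rg 11) (rg 24)) (assign 25 (rg 24 - rg 11)) (assign 25 0)) <|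
  .seq (cond (.bin .lt (rg 1 + 7) (rg 25))
    (.seq (assign 7 (rg 25 - (rg 1 + 7))) (.seq (assign 10 (rg 1 + 7))
      (.seq (assign 8 (rg 11 + rg 10)) (assign 9 (((1 : Expr) <<< ((1 : Expr) <<< rg 8)) - 1)))))
    (.seq (assign 7 0) (.seq (assign 10 (rg 25)) (.seq (assign 8 (rg 11 + rg 10))
      (assign 9 .ones))))) <|
  assign 12 (rg 1 + 7 - rg 10)

/-- Compute the parameters that are addresses. -/
def addresses : Prog :=
  .seq (assign 26 (((((1 : Expr) <<< (6 + rg 1 + rg 4 + rg 4 + rg 15 + rg 12)) - 1) >>> rg 7) + 1)) <|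
  .seq (assign 0 (16 + rg 26)) <|
  .seq (assign 13 ((rg 26 + ((1 : Expr) <<< rg 12) + 1) <<< rg 7)) <|
  .seq (assign 14 (rg 13 + ((1 : Expr) <<< (rg 1 + rg 12)))) <|
  .seq (assign 27 .ones) (assign 28 16)

/-- Compute and store all parameters, and prepare to fill the table. -/
def setup : Prog :=
  .seq (assign 20 (rg 2)) <| .seq (assign 2 (rg 1)) <| .seq (assign 1 (rg 0)) <|
  .seq (.seq params (.seq layout addresses)) (storeParams 16)

namespace Par

/-- The values of the registers after the computation of the parameters. -/
structure Vals (lam κ q w : ℕ) (f : ℕ → ℕ) : Prop where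
  param : ∀ r < 16, f r = (of lam κ q w).param r
  h20 : f 20 = q
  h21 : f 21 = min q κ
  h22 : f 22 = logq κ q
  h23 : f 23 = κ + 13
  h24 : f 24 = Nat.log 2 w
  h25 : f 25 = logc κ w
  h26 : f 26 = (of lam κ q w).words
  h27 : f 27 = 2 ^ w - 1
  h28 : f 28 = 16

theorem lt_two_pow_of_le {w n : ℕ} (h : n ≤ w) : n < 2 ^ w := h.trans_lt Nat.lt_two_pow_self

theorem two_pow_logν_lt {lam κ q w : ℕ} (hP : (of lam κ q w).Ok) : 2 * (κ + 13) < 2 ^ w := by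
  have h1 := (lt_w hP).1
  have h2 : (of lam κ q w).L = κ + 3 * (of lam κ q w).β + 513 := rfl
  have h3 : w ≤ 2 * 2 ^ (w / 2) := le_two_pow_div w (by norm_num)
  change (of lam κ q w).L ≤ w at h1
  obtain ⟨v, rfl⟩ : ∃ v, w = v + 2 := ⟨w - 2, by omega⟩
  have h4 : v < 2 ^ v := Nat.lt_two_pow_self
  rw [pow_add]
  omega

theorem one_or_zero_ne {a b : ℕ} : ((if a < b then 1 else 0 : ℕ) ≠ 0 ↔ a < b) := by
  split_ifs with h <;> simp [h]

section
variable {lam κ q w N : ℕ} [NeZero w] {f : ℕ → ℕ}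

theorem step_params (hP : (of lam κ q w).Ok) (hf : Vals lam κ q w f) :
    Step w N f
      params [1, 2, 20, 3]
      [15, 6, 5, 4, 11, 23, 22, 21, 1, 2, 20, 3] := by
  have hw : (of lam κ q w).L ≤ w := (lt_w hP).1
  have hL : (of lam κ q w).L = κ + 3 * (of lam κ q w).β + 513 := rfl
  have hD : 2 ^ (of lam κ q w).lD < 2 ^ w := D_lt hP
  have hlD : (of lam κ q w).lD < w := (Nat.pow_lt_pow_iff_right (by norm_num : 1 < 2)).1 hD
  rw [show (of lam κ q w).lD = logq κ q + 16 from rfl] at hlD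
  clear hD
  have hν : logν κ < w := (Nat.pow_lt_pow_iff_right (by norm_num : 1 < 2)).1
    (two_pow_logν.2.trans (two_pow_logν_lt hP))
  have hβ : (of lam κ q w).β = κ / 2 ^ (logq κ q + 4) + 1 := rfl
  have hle : ∀ n ≤ w, n < 2 ^ w := fun n hn => lt_two_pow_of_le hn
  have f2 : f 2 = κ := hf.param 2 (by norm_num)
  have f4 : f 4 = logq κ q + 16 := hf.param 4 (by norm_num)
  have f5 : f 5 = (of lam κ q w).β := hf.param 5 (by norm_num)
  have f6 : f 6 = (of lam κ q w).Q := hf.param 6 (by norm_num)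
  have f11 : f 11 = logν κ := hf.param 11 (by norm_num)
  have f15 : f 15 = (of lam κ q w).L := hf.param 15 (by norm_num)
  have hQ := hP.Qβ_lt
  have hQ' := hP.le_Qβ
  have hβ0 := hP.β_pos
  rw [← f5, ← f6] at hQ hQ'
  rw [← f5] at hβ0
  change _ < κ + _ at hQ
  change κ ≤ _ at hQ'
  clear hP
  generalize (of lam κ q w).β = β at *
  generalize (of lam κ q w).L = L at *
  refine Step.seq (Step.cond (c := q < κ) (l' := [21, 1, 2, 20, 3])
    (fun σ h => ⟨_, ((h.has 20).eq hf.h20).lt ((h.has 2).eq f2), one_or_zero_ne⟩)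
    (fun hc => Step.assign fun σ h => (h.has 20).eq (by rw [hf.h20, hf.h21, min_eq_left hc.le]))
    (fun hc => Step.assign fun σ h => (h.has 2).eq (by
      rw [f2, hf.h21, min_eq_right (not_lt.1 hc)]))) ?_
  refine Step.seq (Step.count (fun k hk σ h hc => ⟨_, (Has.pow_two (NeZero.pos w) hc
    (by rw [hf.h22] at hk; omega)).lt (h.has 21), one_or_zero_ne.trans (by
      rw [hf.h22, hf.h21]
      exact (Nat.lt_clog_iff_pow_lt (by norm_num)).symm)⟩)
    (hle _ (by rw [hf.h22]; omega))) ?_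
  refine Step.seq (Step.assign fun σ h => (((h.has 2).eq f2).add (.lit (hle _ (by omega)))
    (hle _ (by omega))).eq hf.h23.symm) ?_
  refine Step.seq (Step.count (fun k hk σ h hc => ⟨_, (Has.pow_two (NeZero.pos w) hc
    (by rw [f11] at hk; omega)).lt (h.has 23), one_or_zero_ne.trans (by
      rw [f11, hf.h23]
      exact (Nat.lt_clog_iff_pow_lt (by norm_num)).symm)⟩) (hle _ (by rw [f11]; omega))) ?_
  refine Step.seq (Step.assign fun σ h => (((h.has 22).eq hf.h22).add (.lit (hle _ (by omega)))
    (hle _ (by omega))).eq f4.symm) ?_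
  refine Step.seq (Step.assign fun σ h => ((((h.has 2).eq f2).shr (((h.has 22).eq hf.h22).add
    (.lit (hle _ (by omega))) (hle _ (by omega)))).add
    (.lit (hle _ (by omega))) (hle _ (by omega))).eq (by rw [f5, hβ])) ?_
  refine Step.seq (step_quotient (by decide) (by decide) (by decide) (by decide) (by decide)
    hβ0 (by rwa [f2]) (by rwa [f2]) (hle _ (by omega))) ?_
  refine Step.assign fun σ h => ?_
  have h5 : Has w N σ (rg 5) β := (h.has 5).eq f5
  exact ((((h.has 2).eq f2).add ((h5.add h5 (hle _ (by omega))).add h5 (hle _ (by omega)))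
    (hle _ (by omega))).add (.lit ((hle _ (by omega)))) (hle _ (by omega))).eq (by omega)

theorem step_layout (hP : (of lam κ q w).Ok) (hf : Vals lam κ q w f) :
    Step w N f
      layout [15, 6, 5, 4, 11, 23, 22, 21, 1, 2, 20, 3]
      [12, 9, 8, 10, 7, 25, 24, 15, 6, 5, 4, 11, 23, 22, 21, 1, 2, 20, 3] := by
  have hw : 500 < w := (lt_w hP).2.trans_le (lt_w hP).1
  have hlam : 2 ^ (6 + lam) < 2 ^ w := size_lt hP
    ((Nat.le_mul_of_pos_right _ R_pos).trans (pow_lam_mul_R_le (of lam κ q w)))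
  have hlam' := (Nat.pow_lt_pow_iff_right (by norm_num : 1 < 2)).1 hlam
  have hν : logν κ < w := (Nat.pow_lt_pow_iff_right (by norm_num : 1 < 2)).1
    (two_pow_logν.2.trans (two_pow_logν_lt hP))
  have hle : ∀ n ≤ w, n < 2 ^ w := fun n hn => lt_two_pow_of_le hn
  have hle' : ∀ n ≤ 2 * w, n < 2 ^ w := by
    intro n hn
    obtain ⟨v, rfl⟩ : ∃ v, w = v + 3 := ⟨w - 3, by omega⟩
    have := Nat.lt_two_pow_self (n := v)
    rw [pow_add]
    omega
  have hlog : 2 ^ Nat.log 2 w ≤ w := Nat.pow_log_le_self 2 (by omega)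
  have hlogw : Nat.log 2 w < w := Nat.lt_two_pow_self.trans_le hlog
  have hcw : logc κ w = Nat.log 2 w - logν κ := rfl
  have f1 : f 1 = lam := hf.param 1 (by norm_num)
  have f3 : f 3 = w := hf.param 3 (by norm_num)
  have f7 : f 7 = logc κ w - (lam + 7) := hf.param 7 (by norm_num)
  have f8 : f 8 = logν κ + min (logc κ w) (lam + 7) := hf.param 8 (by norm_num)
  have f9 : f 9 = 2 ^ (if lam + 7 < logc κ w then 2 ^ (logν κ + (lam + 7)) else w) - 1 :=
    hf.param 9 (by norm_num)
  have f10 : f 10 = min (logc κ w) (lam + 7) := hf.param 10 (by norm_num)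
  have f11 : f 11 = logν κ := hf.param 11 (by norm_num)
  have f12 : f 12 = lam + 7 - min (logc κ w) (lam + 7) := hf.param 12 (by norm_num)
  clear hP
  refine Step.seq (Step.count (fun k hk σ h hc => ?_) (hle _ (by rw [hf.h24]; omega))) ?_
  · rw [hf.h24] at hk ⊢
    -- The guard `2 * 2^k < w + 1` holds exactly for `k < log w`, and up to the last round its left
    -- side is at most `2 * w`, so the shift does not overflow.
    have h1 : 2 ^ k ≤ 2 ^ Nat.log 2 w := Nat.pow_le_pow_right (by norm_num) hk
    refine ⟨_, ((Has.lit (hle _ (by omega))).shl hc (hle' _ (by omega))).lt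
      (((h.has 3).eq f3).add (.lit (hle _ (by omega))) (hle' _ (by omega))),
      one_or_zero_ne.trans ?_⟩
    rw [← Nat.succ_le_iff (m := k), Nat.le_log_iff_pow_le (by norm_num) (by omega), pow_succ]
    omega
  refine Step.seq (Step.cond (c := logν κ < Nat.log 2 w)
    (l' := [25, 24, 15, 6, 5, 4, 11, 23, 22, 21, 1, 2, 20, 3])
    (fun σ h => ⟨_, ((h.has 11).eq f11).lt ((h.has 24).eq hf.h24), one_or_zero_ne⟩)
    (fun hc => Step.assign fun σ h => (((h.has 24).eq hf.h24).sub ((h.has 11).eq f11) hc.le).eq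
      hf.h25.symm)
    (fun hc => Step.assign fun σ h => (Has.lit (hle _ (by omega))).eq (by
      rw [hf.h25]
      omega))) ?_
  have h17 : ∀ {l σ}, Known f l σ → (1 ∈ l) → Has w N σ (rg 1 + 7) (lam + 7) := fun h h1 =>
    ((h.has 1 h1).eq f1).add (.lit (hle _ (by omega))) (hle' _ (by omega))
  have h25 : ∀ {l σ}, Known f l σ → (25 ∈ l) → Has w N σ (rg 25) (logc κ w) := fun h h1 =>
    (h.has 25 h1).eq hf.h25
  refine Step.seq (Step.cond (c := lam + 7 < logc κ w)
    (l' := [9, 8, 10, 7, 25, 24, 15, 6, 5, 4, 11, 23, 22, 21, 1, 2, 20, 3])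
    (fun σ h => ⟨_, (h17 h (by decide)).lt (h25 h (by decide)), one_or_zero_ne⟩)
    (fun hc => ?_) (fun hc => ?_)) ?_
  · refine Step.seq (Step.assign fun σ h =>
      ((h25 h (by decide)).sub (h17 h (by decide)) hc.le).eq f7.symm) ?_
    refine Step.seq (Step.assign fun σ h => (h17 h (by decide)).eq (by omega)) ?_
    refine Step.seq (Step.assign fun σ h => (((h.has 11).eq f11).add ((h.has 10).eq f10)
      (hle _ (by omega))).eq f8.symm) ?_
    refine Step.assign fun σ h => ?_
    have h8 : f 8 = logν κ + (lam + 7) := by omega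
    have h9 : 2 ^ (logν κ + (lam + 7)) < w := (Nat.pow_lt_pow_right (by norm_num)
      (by omega)).trans_le hlog
    exact ((Has.pow_two (by omega) (Has.pow_two (by omega) ((h.has 8).eq h8) (by omega)) h9).sub
      (.lit (hle _ (by omega))) Nat.one_le_two_pow).eq (by rw [f9, if_pos hc])
  · refine Step.seq (Step.assign fun σ h => (Has.lit (hle _ (by omega))).eq (by omega)) ?_
    refine Step.seq (Step.assign fun σ h => (h25 h (by decide)).eq (by omega)) ?_
    refine Step.seq (Step.assign fun σ h => (((h.has 11).eq f11).add ((h.has 10).eq f10)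
      (hle' _ (by omega))).eq f8.symm) ?_
    exact Step.assign fun σ h => Has.ones.eq (by rw [f9, if_neg hc])
  · exact Step.assign fun σ h => ((h17 h (by decide)).sub ((h.has 10).eq f10) (by omega)).eq
      f12.symm

theorem step_addresses (hP : (of lam κ q w).Ok) (hf : Vals lam κ q w f) :
    Step w N f
      addresses
      [12, 9, 8, 10, 7, 25, 24, 15, 6, 5, 4, 11, 23, 22, 21, 1, 2, 20, 3]
      [28, 27, 14, 13, 0, 26, 12, 9, 8, 10, 7, 25, 24, 15, 6, 5, 4, 11, 23, 22, 21, 1, 2, 20, 3] := by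
  set P := of lam κ q w
  have f0 : f 0 = P.B := hf.param 0 (by norm_num)
  have f1 : f 1 = P.lam := hf.param 1 (by norm_num)
  have f4 : f 4 = P.lD := hf.param 4 (by norm_num)
  have f7 : f 7 = P.sr := hf.param 7 (by norm_num)
  have f12 : f 12 = P.lR := hf.param 12 (by norm_num)
  have f13 : f 13 = P.src := hf.param 13 (by norm_num)
  have f14 : f 14 = P.src + 2 ^ P.lam * P.R := hf.param 14 (by norm_num)
  have f15 : f 15 = P.L := hf.param 15 (by norm_num)
  have f26 : f 26 = P.words := hf.h26
  have hlit : ∀ n ≤ 500, n < 2 ^ w := fun n hn => lit_lt hP hn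
  have hle : ∀ n ≤ w, n < 2 ^ w := fun n hn => lt_two_pow_of_le hn
  -- The size of the table is a power of two, so a single shift computes it.
  have hsize : P.size = 2 ^ (6 + P.lam + P.lD + P.lD + P.L + P.lR) := by
    unfold size block D R
    rw [pow_add _ _ P.lR, pow_add _ _ P.L, pow_add _ (6 + P.lam + P.lD), pow_add _ (6 + P.lam)]
    ring
  have hexp : 6 + P.lam + P.lD + P.lD + P.L + P.lR < w := by
    have := size_lt hP (v := P.size) le_rfl
    rw [hsize] at this
    exact (Nat.pow_lt_pow_iff_right (by norm_num : 1 < 2)).1 this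
  have hN : 20 + 4 * P.words < 2 ^ w := N_lt hP
  have hR := R_le_words hP
  have hlast : P.src + 2 ^ P.lam * P.R < 2 ^ w := by
    refine vaddr_lt hP (Nat.add_lt_add_left ?_ _)
    refine lt_of_lt_of_le ?_ P.pow_lam_mul_R_le
    exact Nat.mul_lt_mul_of_pos_right (Nat.pow_lt_pow_right (by norm_num) (by omega)) P.R_pos
  have hsrc : P.src < 2 ^ w := lt_of_le_of_lt (Nat.le_add_right _ _) hlast
  have hwords : P.words = (P.size - 1) / 2 ^ P.sr + 1 := rfl
  have hB : P.B = 16 + P.words := rfl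
  have hsrc' : P.src = (P.words + P.R + 1) * 2 ^ P.sr := rfl
  have hRdef : P.R = 2 ^ P.lR := rfl
  have hw : 0 < w := by omega
  clear_value P
  refine Step.seq (Step.assign fun σ h => ?_) ?_
  · have h4 : Has w N σ (rg 4) P.lD := (h.has 4).eq f4
    have h60 : Has w N σ 6 6 := .lit (hlit _ (by norm_num))
    have h6 := Has.pow_two hw (((((h60.add ((h.has 1).eq f1) (hle _ (by omega))).add h4
      (hle _ (by omega))).add h4 (hle _ (by omega))).add ((h.has 15).eq f15)
      (hle _ (by omega))).add ((h.has 12).eq f12) (hle _ (by omega))) hexp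
    rw [← hsize] at h6
    exact (((h6.sub (.lit (hlit _ (by norm_num))) (by rw [hsize]; exact Nat.one_le_two_pow)).shr
      ((h.has 7).eq f7)).add (.lit (hlit _ (by norm_num))) (by rw [← hwords]; omega)).eq
      (by rw [f26, hwords])
  refine Step.seq (Step.assign fun σ h => ((Has.lit (hlit _ (by norm_num))).add
    ((h.has 26).eq f26) (by omega)).eq (by rw [f0, hB])) ?_
  refine Step.seq (Step.assign fun σ h => ?_) ?_
  · have h12 : Has w N σ _ _ := Has.pow_two hw ((h.has 12).eq f12) (by omega)
    rw [← hRdef] at h12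
    exact (((((h.has 26).eq f26).add h12 (by omega)).add (.lit (hlit _ (by norm_num)))
      (by omega)).shl ((h.has 7).eq f7) (by rwa [← hsrc'])).eq (by rw [f13, hsrc'])
  refine Step.seq (Step.assign fun σ h => ?_) ?_
  · have h12 : Has w N σ _ _ := Has.pow_two hw (((h.has 1).eq f1).add ((h.has 12).eq f12) (hle _ (by omega)))
      (by omega)
    rw [pow_add, ← hRdef] at h12
    exact (((h.has 13).eq f13).add h12 hlast).eq f14.symm
  exact Step.seq (Step.assign fun σ h => Has.ones.eq hf.h27.symm)
    (Step.assign fun σ h => (Has.lit (hlit _ (by norm_num))).eq hf.h28.symm)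

/-- A single assignment records the final values of all registers involved; every step of the setup
is stated relative to it. -/
theorem exists_vals (lam κ q w : ℕ) : ∃ f, Vals lam κ q w f := by
  let g : ℕ → ℕ
    | 0 => q
    | 1 => min q κ
    | 2 => logq κ q
    | 3 => κ + 13
    | 4 => Nat.log 2 w
    | 5 => logc κ w
    | 6 => (of lam κ q w).words
    | 7 => 2 ^ w - 1
    | _ => 16
  refine ⟨fun r => if r < 16 then (of lam κ q w).param r else g (r - 20),
    fun r hr => if_pos hr, ?_, ?_, ?_, ?_, ?_, ?_, ?_, ?_, ?_⟩ <;>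
  exact if_neg (by norm_num)

theorem hu_setup (hP : (of lam κ q w).Ok) (hN : (of lam κ q w).N ≤ N) (hN' : N < 2 ^ w) {σ : St}
    (h0 : σ.r 0 = lam) (h1 : σ.r 1 = κ) (h2 : σ.r 2 = q) (h3 : σ.r 3 = w) :
    Hu w N setup σ fun σ' => (∀ r < 16, σ'.r r = (of lam κ q w).param r ∧
      σ'.m r = (of lam κ q w).param r) ∧ σ'.r 27 = 2 ^ w - 1 ∧ σ'.r 28 = 16 := by
  obtain ⟨f, hf⟩ := exists_vals lam κ q w
  -- The arguments arrive in registers `0` to `3`; the first three are moved, last one first, to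
  -- their places `20`, `2` and `1`.
  refine Hu.assign_seq_has (v := q) (by norm_num) (.reg (by norm_num) h2) ?_
  refine Hu.assign_seq_has (v := κ) (by norm_num) (.reg (by norm_num) (by simpa using h1)) ?_
  refine Hu.assign_seq_has (v := lam) (by norm_num) (.reg (by norm_num) (by simpa using h0)) ?_
  refine Hu.seq (((step_params hP hf).seq ((step_layout hP hf).seq (step_addresses hP hf))) _ ?_) ?_
  · have f1 : f 1 = lam := hf.param 1 (by norm_num)
    have f2 : f 2 = κ := hf.param 2 (by norm_num)
    have f3 : f 3 = w := hf.param 3 (by norm_num)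
    intro r hr
    fin_cases hr
    · simp [f1]
    · simp [f2]
    · simp [hf.h20]
    · simp [f3, h3]
  · intro τ hτ s hs
    have h16 : 16 ≤ N := le_trans (by unfold Par.N; omega) hN
    obtain ⟨s', h4, h5, h6⟩ := hu_storeParams hN' 16 le_rfl h16 s hs
    have hreg : ∀ r < 16, τ.r r = (of lam κ q w).param r := by
      intro r hr
      rw [← hf.param r hr]
      refine hτ r ?_
      interval_cases r <;> decide
    refine ⟨s', h4, fun r hr => ⟨?_, ?_⟩, ?_, ?_⟩
    · rw [h5, hreg r hr]
    · rw [h6 r hr, hreg r hr]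
    · rw [h5, hτ 27 (by decide), hf.h27]
    · rw [h5, hτ 28 (by decide), hf.h28]

end

end Par

end WordRAM

theorem toReal_toOuterMeasure_map_uniform {A B : Type*} [Fintype A] [Nonempty A] (F : A → B)
    (E : B → Prop) : (((PMF.uniformOfFintype A).map F).toOuterMeasure {b | E b}).toReal =
      1 - prob (fun a => ¬ E (F a)) := by
  classical
  have hA : (0 : ℝ) < Fintype.card A := by exact_mod_cast Fintype.card_pos
  have h := Finset.card_filter_add_card_filter_not (s := Finset.univ) fun a => E (F a)
  have h' : ((Finset.univ.filter fun a => E (F a)).card : ℝ) +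
      (Finset.univ.filter fun a => ¬ E (F a)).card = Fintype.card A := by
    exact_mod_cast h
  rw [PMF.toOuterMeasure_map_apply, PMF.toOuterMeasure_uniformOfFintype_apply, prob_eq,
    eq_sub_iff_add_eq, ENNReal.toReal_div, ENNReal.toReal_natCast, ENNReal.toReal_natCast,
    ← add_div, div_eq_one_iff_eq hA.ne', ← h', Fintype.card_subtype]
  rfl

/-! ### The initialized data structure and the theorem -/

namespace WordRAM

theorem toNat_start {w : ℕ} {args : List ℕ} {r : ℕ} (hr : r < 64) (h : args.getD r 0 < 2 ^ w) :
    (State.start w args).view.r r = args.getD r 0 := by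
  simp only [State.view, State.start, if_pos hr, BitVec.toNat_ofNat, Nat.mod_eq_of_lt h]

/-- The result of the initialization. -/
theorem Par.exec_init {lam κ q w : ℕ} [NeZero w] (hP : (of lam κ q w).Ok) (hq : q < 2 ^ w) :
    ∃ (m : ℕ → ℕ) (F : (Fin (of lam κ q w).words → Fin w → Bool) → State w),
      Exec (of lam κ q w).N (.seq setup fill) (State.start w [lam, κ, q, w])
        ((PMF.uniformOfFintype _).map F) ∧ ∀ g, ((F g).regs 0).toNat = (of lam κ q w).B ∧
        (∀ r < 16, ((F g).mem r).toNat = (of lam κ q w).param r) ∧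
        (fun a => ((F g).mem a).toNat) = (of lam κ q w).filled m g := by
  have hw : (of lam κ q w).L ≤ w := (lt_w hP).1
  have hL : (of lam κ q w).L = κ + 3 * (of lam κ q w).β + 513 := rfl
  have hN : (of lam κ q w).N < 2 ^ w := N_lt hP
  have hlam : lam < 2 ^ w := lt_two_pow_of_le (lam_lt hP).le
  have hκ : κ < 2 ^ w := lt_two_pow_of_le (by omega)
  obtain ⟨s, h1, h2, h3, h4⟩ := hu_setup (N := (of lam κ q w).N) hP le_rfl hN
    (σ := (State.start w [lam, κ, q, w]).view) (toNat_start (by norm_num) hlam)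
    (toNat_start (by norm_num) hκ) (toNat_start (by norm_num) hq)
    (toNat_start (by norm_num) Nat.lt_two_pow_self) _ rfl
  have h0 : s.view.r 0 = (of lam κ q w).B := (h2 0 (by norm_num)).1
  have hB : (of lam κ q w).B = 16 + (of lam κ q w).words := rfl
  have hBN : (of lam κ q w).B ≤ (of lam κ q w).N := by
    unfold B N
    omega
  obtain ⟨F, h5, h6⟩ := exec_fill (N := (of lam κ q w).N) (n := (of lam κ q w).words) h3
    (by rw [h4, h0, hB]) (by rwa [h0])
  rw [h4, h0] at h6
  refine ⟨s.view.m, F, Exec.seq_pure h1 h5, fun g => ?_⟩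
  obtain ⟨h7, h8, h9⟩ := h6 g
  refine ⟨h7, fun r hr => (h8 r (.inl hr)).trans (h2 r hr).2, ?_⟩
  funext a
  unfold filled
  split_ifs with ha
  · have := h9 ⟨a - 16, by have := ha.2; omega⟩
    rw [show 16 + (a - 16) = a by have := ha.1; omega] at this
    exact this
  · exact h8 a (by omega)

end WordRAM

open WordRAM WordRAM.Par in
theorem mainTheorem7 :
    ∃ (init eval : WordRAM.Prog) (C₁ C₂ : ℝ), 0 < C₁ ∧ 0 < C₂ ∧
      ∀ lam κ q w : ℕ, 0 < lam → 0 < κ → 0 < q → 0 < w →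
        C₁ * (spaceBound lam κ q w : ℝ) ≤ (2 : ℝ) ^ w →
        ∃ (N B : ℕ) (μ : PMF (WordRAM.State w))
          (Γ : WordRAM.State w → BitStrings κ (2 ^ lam) →
            BitStrings (2 * κ + 26) (48 * 2 ^ lam)),
          (N : ℝ) ≤ C₁ * (spaceBound lam κ q w : ℝ) ∧
          WordRAM.Exec N init (WordRAM.State.start w [lam, κ, q, w]) μ ∧
          (∀ s ∈ μ.support, (s.regs 0).toNat = B ∧
            WordRAM.Represents eval N B (C₂ * timeBound lam κ q w) s.mem (Γ s)) ∧
          1 - (2 : ℝ) ^ (-(2 * ((κ : ℝ) - 1))) ≤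
            (μ.toOuterMeasure {s | IsKUnique (2 ^ κ) (Γ s)}).toReal := by
  -- The memory needs only `2^600` times the space bound. The larger constant `2^1000` ensures that
  -- the word length is at least `1000`, and that indices and arguments fit into words.
  refine ⟨.seq setup fill, evalProg, 2 ^ 1000, 2 ^ 60, by positivity, by positivity, ?_⟩
  intro lam κ q w hlam hκ hq hw hsp'
  have hsp : 2 ^ 1000 * spaceBound lam κ q w ≤ 2 ^ w := by exact_mod_cast hsp'
  have : NeZero w := ⟨hw.ne'⟩
  have hP := of_ok hκ hq hw hsp hlam
  obtain ⟨m, F, h1, h2⟩ := exec_init hP (q_lt hκ hq hw hsp)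
  have : NeZero (of lam κ q w).w := ⟨hw.ne'⟩
  refine ⟨(of lam κ q w).N, (of lam κ q w).B, _, fun s x => (of lam κ q w).out
    ((of lam κ q w).vget fun a => (s.mem a).toNat) ((of lam κ q w).toTree x), ?_, h1, ?_, ?_⟩
  · refine le_trans (Nat.cast_le.2 (of_N_le hκ hq hw)) ?_
    rw [Nat.cast_mul, Nat.cast_pow, Nat.cast_ofNat]
    exact mul_le_mul_of_nonneg_right (pow_le_pow_right₀ (by norm_num) (by norm_num))
      (Nat.cast_nonneg _)
  · intro s hs
    obtain ⟨g, rfl⟩ := mem_support_map_uniform hs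
    obtain ⟨h3, h4, h5⟩ := h2 g
    refine ⟨h3, fun x t ht h0 hx => ?_⟩
    obtain ⟨t', h6, h7, h8, h9⟩ := represents hP (F g).mem h4 x t ht h0 hx
    exact ⟨t', h6, h7, h8, h9.trans (add_le_add le_rfl (of_evalTime_le hlam hκ hq hw))⟩
  · rw [toReal_toOuterMeasure_map_uniform]
    have h3 := prob_not_outGood_le hP (flippable_filled hP m)
    have h4 : prob (fun g => ¬ IsKUnique (2 ^ κ) fun x => (of lam κ q w).out
        ((of lam κ q w).vget fun a => ((F g).mem a).toNat) ((of lam κ q w).toTree x)) ≤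
        prob fun g => ¬ (of lam κ q w).OutGood ((of lam κ q w).vget ((of lam κ q w).filled m g)) := by
      refine prob_mono fun g hg hgood => hg ?_
      rw [(h2 g).2.2]
      exact hgood.isKUnique _ toTree_injective
    -- The failure probability obtained is `2^(-2κ)`, slightly better than required.
    have h5 : ((1 : ℝ) / 2) ^ (2 * κ) ≤ (2 : ℝ) ^ (-(2 * ((κ : ℝ) - 1))) := by
      rw [one_div, inv_pow, ← Real.rpow_natCast, ← Real.rpow_neg (by norm_num)]
      refine Real.rpow_le_rpow_of_exponent_le (by norm_num) ?_
      push_cast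
      linarith
    exact sub_le_sub_left ((h4.trans h3).trans h5) 1
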